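/- **Theorem (Proof diagram representation).** For all derivations $d,d'$ in $\mathrm{MLL}_u$ of the same sequent $\vdash\Gamma$: $d\sim d'$ if and only if $d\sim_D d'$. The notions are as follows. **Derivations.** Formulas are built from variables $p$, negated variables $p^\bot$, $1$, $\bot$, $A\otimes B$, $A\parr B$; negation is the involution with $1^\bot=\bot$, $(A\otimes B)^\bot=B^\bot\parr A^\bot$, $(A\parr B)^\bot=B^\bot\otimes A^\bot$. Sequents are finite lists of formulas. The rules are: $Ax$: $\vdash A,A^\bot$; $1$: $\vdash 1$; $\parr$: from $\vdash\Gamma,A,B$ infer $\vdash\Gamma,A\parr B$; $\bot$: from $\vdash\Gamma$ infer $\vdash\Gamma,\bot$; $\otimes$: from $\vdash\Gamma,A$ and $\vdash B,\Delta$ infer $\vdash\Gamma,A\otimes B,\Delta$; $Cut$: from $\vdash\Gamma,A$ and $\vdash A^\bot,\Delta$ infer $\vdash\Gamma,\Delta$; exchange along any permutation $\sigma$ of occurrences: from $\vdash A_1,\dots,A_k$ infer $\vdash A_{\sigma(1)},\dots,A_{\sigma(k)}$. **The equivalence $\sim$** is the least congruence on derivations such that: (i) derivations that differ only in the order in which occurrences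 are listed are equivalent: the identity exchange is trivial; two successive exchanges compose; an exchange of the context of a $\parr$, $\bot$, $\otimes$ or $Cut$ commutes with that rule; and $Ax_A$ followed by the exchange of its two formulas is equivalent to $Ax_{A^\bot}$; (ii) up to exchanges, independent rules permute, where $\odot(A,B)$ denotes $A\otimes B$ for $\odot=\otimes$ and the empty list for $\odot=Cut$ (with $B=A^\bot$): two consecutive rules in $\{\parr,\bot\}$ permute if the principal formula of the first is not active in the second; a rule in $\{\otimes,Cut\}$ followed by a rule in $\{\parr,\bot\}$ whose active occurrences all come from the context of one premise permutes with it, the latter rule being then applied to that premise; and two rules $\odot_1,\odot_2\in\{\otimes,Cut\}$ permute in the three cases - $\odot_2(\odot_1(d_1,d_2),d_3)\sim\odot_1(d_1,\odot_2(d_2,d_3))$ for $d_1:\ \vdash\Gamma,A$, $d_2:\ \vdash B,\Sigma,C$, $d_3:\ \vdash D,\Delta$; - $\odot_2(\odot_1(d_1,d_2),d_3)\sim\odot_1(\odot_2(d_1,d_3),d_2)$ for $d_1:\ \vdash\Gamma,C,A$, $d_2:\ \vdash B,\Sigma$, $d_3:\ \vdash D,\Delta$; - $\odot_2(d_1,\odot_1(d_2,d_3))\sim\odot_1(d_2,\odot_2(d_1,d_3))$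 for $d_1:\ \vdash\Sigma,C$, $d_2:\ \vdash\Gamma,A$, $d_3:\ \vdash B,D,\Delta$, where $\odot_1$ acts on $A,B$ and $\odot_2$ on $C,D$. **Diagrams.** For a set of string labels, a set of gate types $\alpha:X\to Y$ ($X,Y$ words of labels) and a set of rewriting rules between parallel diagrams, diagrams are the morphisms of the free strict monoidal category on the gate types (parallel composition written as a comma, vertical composition from top to bottom written $\phi\,;\psi$), rules are applied under any context, and the presented category has as morphisms the classes $[\phi]$ of diagrams modulo the rules. A diagram is irreducible if no rule applies to it. *The polygraph $\widetilde{\mathrm{Mll}}_u$.* Labels: the formulas and two control labels $L,R$. Gate types, for all $A,B$: $\otimes_{A,B}:A,R,L,B\to A\otimes B$; $\parr_{A,B}:A,B\to A\parr B$; $Ax_A:\emptyset\to L,A,A^\bot,R$; $Cut_A:A,R,L,A^\bot\to\emptyset$; $s_{A,B}:A,B\to B,A$; $1:\emptyset\to L,1,R$; $\bot:\emptyset\to\bot$. Rules, for all $A,B,C$: $s_{A,B};s_{B,A}\Rightarrow\mathrm{id}$; $(s_{A,B},C);(B,s_{A,C});(s_{B,C},A)\Rightarrow(A,s_{B,C});(s_{A,C},B);(C,s_{A,B})$;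 $(\parr_{A,B},C);s_{A\parr B,C}\Rightarrow(A,s_{B,C});(s_{A,C},B);(C,\parr_{A,B})$; $(A,\parr_{B,C});s_{A,B\parr C}\Rightarrow(s_{A,B},C);(B,s_{A,C});(\parr_{B,C},A)$; $Ax_A;(L,s_{A,A^\bot},R)\Rightarrow Ax_{A^\bot}$; $(\bot,A);s_{\bot,A}\Rightarrow(A,\bot)$; $(A,\bot);s_{A,\bot}\Rightarrow(\bot,A)$ (a word in place of a gate is its identity). *The polygraph $\mathrm{Mll}_u$* adds gates $B_{W,W'}:L,W,R,L,W',R\to L,W',R,L,W,R$ for all words $W,W'$ over the formulas and the pair $RL$, and the following rules. - *Untangle relations.* For every gate $g:X\to Y$ of $\widetilde{\mathrm{Mll}}_u$ and words $U,V$ such that $U,X,V=L,W,R$ and $U,Y,V=L,W_2,R$: $(U,g,V,L,W',R);B_{W_2,W'}\Rightarrow B_{W,W'};(L,W',R,U,g,V)$, and symmetrically $(L,W',R,U,g,V);B_{W',W_2}\Rightarrow B_{W',W};(U,g,V,L,W',R)$. For a gate $g:\emptyset\to L,W_2,R$ (an $Ax$ or a $1$), which creates the whole sheaf, the gate $B$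 disappears: $(g,L,W',R);B_{W_2,W'}\Rightarrow(L,W',R,g)$, and symmetrically $(L,W',R,g);B_{W',W_2}\Rightarrow(g,L,W',R)$. - *$B$-introduction, left.* Let $\beta:A,R,L,B\to\beta(A,B)$ and $\gamma:C,R,L,D\to\gamma(C,D)$ be gates of type $\otimes$ or $Cut$, let $\phi:\emptyset\to L,\Gamma,\Gamma',A,R$, $\phi_1:\emptyset\to L,B,\Delta,R$, $\phi_2:\emptyset\to L,D,\Sigma,R$ be irreducible diagrams of $\widetilde{\mathrm{Mll}}_u$, and $N:\Gamma'\to C$ an irreducible one made of gates $s,\parr,\bot$; $\phi$ is required to be of the form $\phi_0$, then the crossing of $\Upsilon$ and $\Gamma'''$, then $N'$, where $\phi_0:\emptyset\to L,\Gamma,\Gamma'',\Upsilon,\Gamma''',R$, $\Gamma'=\Gamma'',\Gamma'''$ (lists of formulas, possibly empty), and $N':\Upsilon\to A$ is irreducible and made of gates $s,\parr,\bot$. The source is: $(\phi,\phi_1,\phi_2)$; apply $\beta$ to $A,R,L,B$; move $\Gamma'$ to the right of $\beta(A,B),\Delta$ by twisting operators; apply $N$ to $\Gamma'$; apply $\gamma$.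 The target is: $(\phi,\phi_1,\phi_2)$; move $A$ to the left of $\Gamma'$; apply $B_{(B,\Delta),(D,\Sigma)}$ to the outputs of $\phi_1,\phi_2$; apply $N$ to $\Gamma'$; apply $\gamma$; move $A$ to the right of $\Sigma$ and $\gamma(C,D)$; apply $\beta$; rearrange by twisting operators to the outputs $L,\Gamma,\beta(A,B),\Delta,\gamma(C,D),\Sigma,R$ of the source. - *$B$-introduction, right:* the mirror image, with $(\psi_1,\psi_2,\psi)$, $\psi_1:\emptyset\to L,\Sigma,C,R$, $\psi_2:\emptyset\to L,\Delta,A,R$, $\psi:\emptyset\to L,B,\Gamma',\Gamma,R$ and $N:\Gamma'\to D$. The source applies $\beta$ to $A,R,L,B$, moves $\Gamma'$ to the left of $\Delta,\beta(A,B)$, applies $N$, then $\gamma$. The target crosses $\psi_1,\psi_2$ by a $B$-gate, moves $B$ to the right of $\Gamma'$, applies $N$ and $\gamma$, moves $B$ to the left of $\Sigma,\gamma(C,D)$, applies $\beta$, and rearranges the outputs to $L,\Sigma,\gamma(C,D),\Delta,\beta(A,B),\Gamma,R$. **Representation.** A diagram $\phi:\emptyset\to L,\Gamma,R$ of $\widetilde{\mathrm{Mll}}_u$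 represents a derivation of $\vdash\Gamma$ if it imitates it rule by rule: the gates $Ax_A$ and $1$ represent the rules $Ax$ and $1$; if $\phi$ represents $d$, then $\phi$ followed by a gate $\parr$ or $\bot$ (on adjacent strings of formulas, anywhere between $L$ and $R$) represents $d$ followed by that rule (applied at the end of the sequent, or through exchanges in the middle of it), and $\phi$ followed by $(L,\tau,R)$, $\tau$ a diagram of gates $s$ that performs the permutation $\sigma$, represents $d$ followed by the exchange $\sigma$; if $\phi,\psi$ represent the premises of a $\otimes$ or $Cut$, then $(\phi,\psi)$ followed by the corresponding gate represents its conclusion. **The equivalence $\sim_D$:** $d\sim_D d'$ if and only if there are diagrams $\phi,\phi'$ of $\widetilde{\mathrm{Mll}}_u$ that represent $d$ and $d'$ respectively and satisfy $[\phi]=[\phi']$ in the category presented by $\mathrm{Mll}_u$. -/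

import Mathlib

universe u v

namespace MLLu

/-! ### Formulas, inference rules, exchanges and derivations -/

/-- Formulas of multiplicative linear logic with units, over a type `α` of propositional
variables. Negation is primitive on variables only. -/
inductive Formula (α : Type u) : Type u
  | atom (p : α)
  | natom (p : α)
  | one
  | bot
  | tensor (A B : Formula α)
  | par (A B : Formula α)

/-- Linear negation, with the order-reversing De Morgan laws. -/
def Formula.neg {α : Type u} : Formula α → Formula α
  | .atom p => .natom p
  | .natom p => .atom p
  | .one => .bot
  | .bot => .one
  | .tensor A B => .par B.neg A.neg
  | .par A B => .tensor B.neg A.neg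

theorem Formula.neg_neg {α : Type u} (A : Formula α) : A.neg.neg = A := by
  induction A <;> simp_all [Formula.neg]

/-- The unary logical rules: par and bottom. -/
inductive UnRule (α : Type u) : Type u
  | par (A B : Formula α)
  | bot

/-- Active formulas of a unary rule. -/
def UnRule.act {α : Type u} : UnRule α → List (Formula α)
  | .par A B => [A, B]
  | .bot => []

/-- Principal formula of a unary rule. -/
def UnRule.prin {α : Type u} : UnRule α → Formula α
  | .par A B => .par A B
  | .bot => .bot

/-- The binary rules: tensor and cut. -/
inductive BinRule (α : Type u) : Type u
  | tensor (A B : Formula α)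
  | cut (A : Formula α)

/-- Active formula of the left premise. -/
def BinRule.left {α : Type u} : BinRule α → Formula α
  | .tensor A _ => A
  | .cut A => A

/-- Active formula of the right premise. -/
def BinRule.right {α : Type u} : BinRule α → Formula α
  | .tensor _ B => B
  | .cut A => A.neg

/-- The list of principal formulas: `A ⊗ B` for a tensor, nothing for a cut. -/
def BinRule.prin {α : Type u} : BinRule α → List (Formula α)
  | .tensor A B => [.tensor A B]
  | .cut _ => []

/-- A rearrangement of the sequent `Γ` into the sequent `Δ`: a bijection of occurrences `σ`
such that the `i`-th formula of `Δ` is the `σ i`-th formula of `Γ`. -/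
@[ext]
structure Reorder {F : Type u} (Γ Δ : List F) where
  toEquiv : Fin Δ.length ≃ Fin Γ.length
  get_eq : ∀ i, Δ.get i = Γ.get (toEquiv i)

namespace Reorder

variable {F : Type u}

/-- The rearrangement that keeps every position. -/
def ofEq {Γ Δ : List F} (h : Γ = Δ) : Reorder Γ Δ where
  toEquiv := finCongr (by rw [h])
  get_eq := by subst h; intro i; rfl

def refl (Γ : List F) : Reorder Γ Γ := ofEq rfl

/-- First `σ`, then `τ`. -/
def trans {Γ Δ Θ : List F} (σ : Reorder Γ Δ) (τ : Reorder Δ Θ) : Reorder Γ Θ where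
  toEquiv := τ.toEquiv.trans σ.toEquiv
  get_eq i := by rw [τ.get_eq, σ.get_eq]; rfl

/-- Positions of a concatenation. -/
def split (Γ Δ : List F) : Fin Γ.length ⊕ Fin Δ.length ≃ Fin (Γ ++ Δ).length :=
  finSumFinEquiv.trans (finCongr List.length_append.symm)

theorem get_split_inl (Γ Δ : List F) (i : Fin Γ.length) :
    (Γ ++ Δ).get (split Γ Δ (.inl i)) = Γ.get i := by
  simp [split]

theorem get_split_inr (Γ Δ : List F) (i : Fin Δ.length) :
    (Γ ++ Δ).get (split Γ Δ (.inr i)) = Δ.get i := by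
  simp [split]

/-- Side by side rearrangement of two consecutive parts of a sequent. -/
def append {Γ Γ' Δ Δ' : List F} (σ : Reorder Γ Γ') (τ : Reorder Δ Δ') :
    Reorder (Γ ++ Δ) (Γ' ++ Δ') where
  toEquiv := (split Γ' Δ').symm.trans ((Equiv.sumCongr σ.toEquiv τ.toEquiv).trans (split Γ Δ))
  get_eq i := by
    obtain ⟨j, rfl⟩ := (split Γ' Δ').surjective i
    rcases j with j | j
    · simp only [Equiv.trans_apply, Equiv.symm_apply_apply, Equiv.sumCongr_apply, Sum.map_inl,
        get_split_inl, σ.get_eq]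
    · simp only [Equiv.trans_apply, Equiv.symm_apply_apply, Equiv.sumCongr_apply, Sum.map_inr,
        get_split_inr, τ.get_eq]

/-- Exchange of two consecutive blocks. -/
def comm (Γ Δ : List F) : Reorder (Γ ++ Δ) (Δ ++ Γ) where
  toEquiv := (split Δ Γ).symm.trans ((Equiv.sumComm _ _).trans (split Γ Δ))
  get_eq i := by
    obtain ⟨j, rfl⟩ := (split Δ Γ).surjective i
    rcases j with j | j
    · simp only [Equiv.trans_apply, Equiv.symm_apply_apply, Equiv.sumComm_apply, Sum.swap_inl,
        get_split_inl, get_split_inr]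
    · simp only [Equiv.trans_apply, Equiv.symm_apply_apply, Equiv.sumComm_apply, Sum.swap_inr,
        get_split_inl, get_split_inr]

/-- Exchange of the two inner blocks of `Γ, X, Y, Z`. -/
def block (Γ X Y Z : List F) {S T : List F}
    (hS : S = Γ ++ (X ++ Y) ++ Z := by simp) (hT : T = Γ ++ (Y ++ X) ++ Z := by simp) :
    Reorder S T :=
  (ofEq hS).trans ((append (append (refl Γ) (comm X Y)) (refl Z)).trans (ofEq hT.symm))

end Reorder

/-- Derivations of one-sided sequents (lists of formulas), with an explicit exchange rule. -/
inductive Deriv {α : Type u} : List (Formula α) → Type u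
  | ax (A : Formula α) : Deriv [A, A.neg]
  | one : Deriv [.one]
  | unary {Γ : List (Formula α)} (r : UnRule α) (d : Deriv (Γ ++ r.act)) : Deriv (Γ ++ [r.prin])
  | binary {Γ Δ : List (Formula α)} (b : BinRule α) (d : Deriv (Γ ++ [b.left]))
      (e : Deriv (b.right :: Δ)) : Deriv (Γ ++ b.prin ++ Δ)
  | ex {Γ Δ : List (Formula α)} (σ : Reorder Γ Δ) (d : Deriv Γ) : Deriv Δ

namespace Deriv

variable {α : Type u}

/-- A derivation of a sequent, read as a derivation of a syntactically equal one. -/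
def recast {Γ Δ : List (Formula α)} (d : Deriv Γ) (h : Γ = Δ := by simp) : Deriv Δ :=
  .ex (.ofEq h) d

/-- A unary rule applied in the middle of a sequent, through exchanges. -/
def unaryAt (Γ : List (Formula α)) (r : UnRule α) (Δ : List (Formula α))
    (d : Deriv (Γ ++ r.act ++ Δ)) : Deriv (Γ ++ [r.prin] ++ Δ) :=
  .ex (.block Γ Δ [r.prin] []) (.unary (Γ := Γ ++ Δ) r (.ex (.block Γ r.act Δ []) d))

/-- The standard equivalence of derivations: the congruence generated by the permutations of
independent rules, where derivations that differ only by the bookkeeping of exchanges (the order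
in which formula occurrences are listed in sequents) are identified. -/
inductive StdEquiv : {Γ : List (Formula α)} → Deriv Γ → Deriv Γ → Prop
  | refl {Γ : List (Formula α)} (d : Deriv Γ) : StdEquiv d d
  | symm {Γ : List (Formula α)} {d e : Deriv Γ} : StdEquiv d e → StdEquiv e d
  | trans {Γ : List (Formula α)} {d e f : Deriv Γ} : StdEquiv d e → StdEquiv e f → StdEquiv d f
  | congr_unary {Γ : List (Formula α)} (r : UnRule α) {d d' : Deriv (Γ ++ r.act)} :
      StdEquiv d d' → StdEquiv (.unary r d) (.unary r d')
  | congr_binary {Γ Δ : List (Formula α)} (b : BinRule α) {d d' : Deriv (Γ ++ [b.left])}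
      {e e' : Deriv (b.right :: Δ)} :
      StdEquiv d d' → StdEquiv e e' → StdEquiv (.binary b d e) (.binary b d' e')
  | congr_ex {Γ Δ : List (Formula α)} (σ : Reorder Γ Δ) {d d' : Deriv Γ} :
      StdEquiv d d' → StdEquiv (.ex σ d) (.ex σ d')
  -- bookkeeping of exchanges
  | ex_refl {Γ : List (Formula α)} (d : Deriv Γ) : StdEquiv (.ex (.refl Γ) d) d
  | ex_trans {Γ Δ Θ : List (Formula α)} (σ : Reorder Γ Δ) (τ : Reorder Δ Θ) (d : Deriv Γ) :
      StdEquiv (.ex τ (.ex σ d)) (.ex (σ.trans τ) d)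
  | ex_unary {Γ Γ' : List (Formula α)} (ρ : Reorder Γ Γ') (r : UnRule α)
      (d : Deriv (Γ ++ r.act)) :
      StdEquiv (.unary r (.ex (ρ.append (.refl r.act)) d))
        (.ex (ρ.append (.refl [r.prin])) (.unary r d))
  | ex_binary {Γ Γ' Δ Δ' : List (Formula α)} (ρ : Reorder Γ Γ') (τ : Reorder Δ Δ')
      (b : BinRule α) (d : Deriv (Γ ++ [b.left])) (e : Deriv (b.right :: Δ)) :
      StdEquiv
        (.binary b (.ex (ρ.append (.refl [b.left])) d)
          (.ex (Reorder.append (.refl [b.right]) τ) e))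
        (.ex ((ρ.append (.refl b.prin)).append τ) (.binary b d e))
  | ex_ax (A : Formula α) :
      StdEquiv (.ex (.comm [A] [A.neg]) (.ax A))
        ((Deriv.ax A.neg).recast (by simp [Formula.neg_neg]))
  -- two unary rules
  | unary_unary (Γ Δ Θ : List (Formula α)) (r s : UnRule α)
      (d : Deriv (Γ ++ r.act ++ Δ ++ s.act ++ Θ)) :
      StdEquiv
        (unaryAt (Γ ++ [r.prin] ++ Δ) s Θ (unaryAt Γ r (Δ ++ s.act ++ Θ) d.recast).recast)
        (unaryAt Γ r (Δ ++ [s.prin] ++ Θ) (unaryAt (Γ ++ r.act ++ Δ) s Θ d).recast).recast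
  -- a binary rule followed by a unary one on the right or on the left context
  | unary_right (Δ Γ Θ : List (Formula α)) (b : BinRule α) (r : UnRule α)
      (d : Deriv (Δ ++ [b.left])) (e : Deriv (b.right :: (Γ ++ r.act ++ Θ))) :
      StdEquiv
        (unaryAt (Δ ++ b.prin ++ Γ) r Θ (binary b d e).recast)
        (binary b d (unaryAt (b.right :: Γ) r Θ e.recast).recast :
          Deriv (Δ ++ b.prin ++ (Γ ++ [r.prin] ++ Θ))).recast
  | unary_left (Γ Θ Δ : List (Formula α)) (b : BinRule α) (r : UnRule α)
      (d : Deriv (Γ ++ r.act ++ Θ ++ [b.left])) (e : Deriv (b.right :: Δ)) :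
      StdEquiv
        (unaryAt Γ r (Θ ++ b.prin ++ Δ) (binary b d e).recast)
        (binary b ((unaryAt Γ r (Θ ++ [b.left]) d.recast).recast :
          Deriv (Γ ++ [r.prin] ++ Θ ++ [b.left])) e).recast
  -- two binary rules, the active formulas of the middle premise going to different rules
  | binary_mid (Γ Θ Δ : List (Formula α)) (b c : BinRule α)
      (d₁ : Deriv (Γ ++ [b.left])) (d₂ : Deriv (b.right :: (Θ ++ [c.left])))
      (d₃ : Deriv (c.right :: Δ)) :
      StdEquiv
        (binary c ((binary b d₁ d₂).recast : Deriv (Γ ++ b.prin ++ Θ ++ [c.left])) d₃)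
        (binary b d₁ ((binary c (d₂.recast : Deriv (b.right :: Θ ++ [c.left])) d₃).recast :
          Deriv (b.right :: (Θ ++ c.prin ++ Δ)))).recast
  -- two binary rules, both acting on the left premise
  | binary_left (Γ Θ Δ : List (Formula α)) (b c : BinRule α)
      (d₁ : Deriv (Γ ++ [c.left] ++ [b.left])) (d₂ : Deriv (b.right :: Θ))
      (d₃ : Deriv (c.right :: Δ)) :
      StdEquiv
        (binary c (.ex (.block Γ [c.left] (b.prin ++ Θ) []) (binary b d₁ d₂) :
          Deriv (Γ ++ b.prin ++ Θ ++ [c.left])) d₃)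
        (.ex (.block Γ (c.prin ++ Δ) (b.prin ++ Θ) [])
          (binary b (.ex (.block Γ [b.left] (c.prin ++ Δ) [])
            (binary c (.ex (.block Γ [c.left] [b.left] []) d₁ :
              Deriv (Γ ++ [b.left] ++ [c.left])) d₃) :
            Deriv (Γ ++ c.prin ++ Δ ++ [b.left])) d₂))
  -- two binary rules, both acting on the right premise
  | binary_right (Γ Θ Δ : List (Formula α)) (b c : BinRule α)
      (d₁ : Deriv (Θ ++ [c.left])) (d₂ : Deriv (Γ ++ [b.left]))
      (d₃ : Deriv (b.right :: c.right :: Δ)) :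
      StdEquiv
        (binary c d₁ (.ex (.block [] (Γ ++ b.prin) [c.right] Δ) (binary b d₂ d₃) :
          Deriv (c.right :: (Γ ++ b.prin ++ Δ))))
        (.ex (.block [] (Γ ++ b.prin) (Θ ++ c.prin) Δ)
          (binary b d₂ (.ex (.block [] (Θ ++ c.prin) [b.right] Δ)
            (binary c d₁ (.ex (.block [] [b.right] [c.right] Δ) d₃ :
              Deriv (c.right :: b.right :: Δ))) :
            Deriv (b.right :: (Θ ++ c.prin ++ Δ)))))

end Deriv

/-! ### Polygraphs with one 0-cell and their string diagrams -/

/-- An elementary diagram: one gate with identity strings on both sides. -/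
structure Slice (C : Type u) (G : Type v) where
  left : List C
  gate : G
  right : List C

/-- The diagram `id_a * φ * id_b`. -/
def whisker {C : Type u} {G : Type v} (a : List C) (φ : List (Slice C G)) (b : List C) :
    List (Slice C G) :=
  φ.map fun s => ⟨a ++ s.left, s.gate, s.right ++ b⟩

/-- A 3-polygraph with one 0-cell: string labels, gate types with inputs and outputs, and
rewriting rules between diagrams written as sequences of elementary diagrams, from top to
bottom. -/
structure Polygraph where
  Color : Type u
  Gate : Type v
  dom : Gate → List Color
  cod : Gate → List Color
  Cell : List (Slice Color Gate) → List (Slice Color Gate) → Prop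

namespace Polygraph

variable (P : Polygraph.{u, v})

/-- The sequence of elementary diagrams is composable, from inputs `x` to outputs `y`. -/
def Typed : List (Slice P.Color P.Gate) → List P.Color → List P.Color → Prop
  | [], x, y => x = y
  | s :: φ, x, y => x = s.left ++ P.dom s.gate ++ s.right ∧
      Typed φ (s.left ++ P.cod s.gate ++ s.right) y

/-- String diagrams from `x` to `y`. Each diagram is a vertical composite of elementary ones; two
such composites are the same diagram when they are related by `SameDiagram` below. -/
structure Diagram (x y : List P.Color) where
  slices : List (Slice P.Color P.Gate)
  typed : P.Typed slices x y

/-- The interchange rule: of two neighbouring gates with disjoint strings, either can be the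
upper one. -/
inductive Interchange : List (Slice P.Color P.Gate) → List (Slice P.Color P.Gate) → Prop
  | mk (χ χ' : List (Slice P.Color P.Gate)) (g h : P.Gate) (a b c : List P.Color) :
      Interchange
        (χ ++ [⟨a, g, b ++ P.dom h ++ c⟩, ⟨a ++ P.cod g ++ b, h, c⟩] ++ χ')
        (χ ++ [⟨a ++ P.dom g ++ b, h, c⟩, ⟨a, g, b ++ P.cod h ++ c⟩] ++ χ')

/-- Equality of string diagrams, as morphisms of the free strict monoidal category. -/
def SameDiagram : List (Slice P.Color P.Gate) → List (Slice P.Color P.Gate) → Prop :=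
  Relation.EqvGen P.Interchange

/-- One application of a rewriting rule, under any context. -/
inductive Rewrite : List (Slice P.Color P.Gate) → List (Slice P.Color P.Gate) → Prop
  | mk (χ χ' l r : List (Slice P.Color P.Gate)) (a b x y : List P.Color)
      (hl : P.Typed l x y) (hr : P.Typed r x y) (h : P.Cell l r) :
      Rewrite (χ ++ whisker a l b ++ χ') (χ ++ whisker a r b ++ χ')

variable {P}

/-- No rewriting rule applies to the diagram. -/
def Diagram.Irreducible {x y : List P.Color} (φ : P.Diagram x y) : Prop :=
  ∀ φ' ψ : P.Diagram x y, P.SameDiagram φ.slices φ'.slices → ¬ P.Rewrite φ'.slices ψ.slices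

variable (P)

/-- Morphisms from `x` to `y` of the monoidal category presented by the polygraph: string
diagrams modulo the rewriting rules. -/
def Hom (x y : List P.Color) : Type (max u v) :=
  Quot fun φ ψ : P.Diagram x y =>
    P.Interchange φ.slices ψ.slices ∨ P.Rewrite φ.slices ψ.slices

variable {P}

/-- The class of a diagram in the presented category. -/
def Diagram.cls {x y : List P.Color} (φ : P.Diagram x y) : P.Hom x y := Quot.mk _ φ

end Polygraph

/-! ### The control polygraph -/

/-- String labels: two control strings and the formulas. -/
inductive Color (α : Type u) : Type u
  | L
  | R
  | fm (A : Formula α)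

/-- Gate types of the control polygraph. -/
inductive CGate (α : Type u) : Type u
  | ax (A : Formula α)
  | one
  | un (r : UnRule α)
  | bin (b : BinRule α)
  | swap (A B : Formula α)

/-- A list of formulas as a word of string labels. -/
def fw {α : Type u} (Γ : List (Formula α)) : List (Color α) := Γ.map Color.fm

/-- The word `L, Γ, R`. -/
def blk {α : Type u} (Γ : List (Formula α)) : List (Color α) := .L :: (fw Γ ++ [.R])

def CGate.dom {α : Type u} : CGate α → List (Color α)
  | .ax _ => []
  | .one => []
  | .un r => fw r.act
  | .bin b => [.fm b.left, .R, .L, .fm b.right]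
  | .swap A B => [.fm A, .fm B]

def CGate.cod {α : Type u} : CGate α → List (Color α)
  | .ax A => [.L, .fm A, .fm A.neg, .R]
  | .one => [.L, .fm .one, .R]
  | .un r => [.fm r.prin]
  | .bin b => fw b.prin
  | .swap A B => [.fm B, .fm A]

/-- Twisting relations of the control polygraph. -/
inductive ControlCell {α : Type u} :
    List (Slice (Color α) (CGate α)) → List (Slice (Color α) (CGate α)) → Prop
  | swap_swap (A B : Formula α) :
      ControlCell [⟨[], .swap A B, []⟩, ⟨[], .swap B A, []⟩] []
  | yang_baxter (A B C : Formula α) :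
      ControlCell
        [⟨[], .swap A B, [.fm C]⟩, ⟨[.fm B], .swap A C, []⟩, ⟨[], .swap B C, [.fm A]⟩]
        [⟨[.fm A], .swap B C, []⟩, ⟨[], .swap A C, [.fm B]⟩, ⟨[.fm C], .swap A B, []⟩]
  | par_swap (A B C : Formula α) :
      ControlCell
        [⟨[], .un (.par A B), [.fm C]⟩, ⟨[], .swap (.par A B) C, []⟩]
        [⟨[.fm A], .swap B C, []⟩, ⟨[], .swap A C, [.fm B]⟩, ⟨[.fm C], .un (.par A B), []⟩]
  | swap_par (A B C : Formula α) :
      ControlCell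
        [⟨[.fm A], .un (.par B C), []⟩, ⟨[], .swap A (.par B C), []⟩]
        [⟨[], .swap A B, [.fm C]⟩, ⟨[.fm B], .swap A C, []⟩, ⟨[], .un (.par B C), [.fm A]⟩]
  | ax_swap (A : Formula α) :
      ControlCell [⟨[], .ax A, []⟩, ⟨[.L], .swap A A.neg, [.R]⟩] [⟨[], .ax A.neg, []⟩]
  | bot_swap (A : Formula α) :
      ControlCell [⟨[], .un .bot, [.fm A]⟩, ⟨[], .swap .bot A, []⟩] [⟨[.fm A], .un .bot, []⟩]
  | swap_bot (A : Formula α) :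
      ControlCell [⟨[.fm A], .un .bot, []⟩, ⟨[], .swap A .bot, []⟩] [⟨[], .un .bot, [.fm A]⟩]

/-- The control polygraph of multiplicative linear logic with units. -/
abbrev control (α : Type u) : Polygraph.{u, u} where
  Color := Color α
  Gate := CGate α
  dom := CGate.dom
  cod := CGate.cod
  Cell := ControlCell

/-! ### The polygraph of proof diagrams -/

/-- Letters of the words labelling the big gates: a formula or the pair `R, L`. -/
inductive Letter (α : Type u) : Type u
  | fm (A : Formula α)
  | rl

def Letter.word {α : Type u} : Letter α → List (Color α)
  | .fm A => [.fm A]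
  | .rl => [.R, .L]

/-- The word `L, W, R`. -/
def sheaf {α : Type u} (W : List (Letter α)) : List (Color α) :=
  .L :: (W.flatMap Letter.word ++ [.R])

/-- Gate types: those of the control polygraph and the `B`-gates, which cross two sheaves of
strings. -/
inductive FGate (α : Type u) : Type u
  | ctrl (g : CGate α)
  | big (W W' : List (Letter α))

def FGate.dom {α : Type u} : FGate α → List (Color α)
  | .ctrl g => g.dom
  | .big W W' => sheaf W ++ sheaf W'

def FGate.cod {α : Type u} : FGate α → List (Color α)
  | .ctrl g => g.cod
  | .big W W' => sheaf W' ++ sheaf W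

/-- Diagrams of the control polygraph seen in the larger signature. -/
def incl {α : Type u} (φ : List (Slice (Color α) (CGate α))) :
    List (Slice (Color α) (FGate α)) :=
  φ.map fun s => ⟨s.left, .ctrl s.gate, s.right⟩

/-- The string labelled `b` crosses all strings `X` on its left: `X, b` becomes `b, X`. -/
def cross₁ {α : Type u} : List (Formula α) → Formula α → List (Slice (Color α) (CGate α))
  | [], _ => []
  | a :: X, b => whisker [.fm a] (cross₁ X b) [] ++ [⟨[], .swap a b, fw X⟩]

/-- The strings `X` cross the strings `Y`: the diagram `X, Y` to `Y, X` in which every string of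
`X` crosses every string of `Y` exactly once. -/
def cross {α : Type u} (X : List (Formula α)) :
    List (Formula α) → List (Slice (Color α) (CGate α))
  | [] => []
  | b :: Y => whisker [] (cross₁ X b) (fw Y) ++ whisker [.fm b] (cross X Y) []

/-- All gates are twisting operators, pars or bottoms. -/
def NoControl {α : Type u} (N : List (Slice (Color α) (CGate α))) : Prop :=
  ∀ s ∈ N, (∃ A B, s.gate = .swap A B) ∨ ∃ r, s.gate = .un r

/-- Rewriting rules of the polygraph of proof diagrams. -/
inductive FullCell {α : Type u} :
    List (Slice (Color α) (FGate α)) → List (Slice (Color α) (FGate α)) → Prop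
  | control {l r : List (Slice (Color α) (CGate α))} (h : ControlCell l r) :
      FullCell (incl l) (incl r)
  /- Untangle relations: a gate above a `B`-gate slides below it, along its sheaf of strings. -/
  | untangle_left (g : CGate α) (a c : List (Color α)) (W W₂ W' : List (Letter α))
      (h : sheaf W = a ++ g.dom ++ c) (h₂ : sheaf W₂ = a ++ g.cod ++ c) :
      FullCell
        [⟨a, .ctrl g, c ++ sheaf W'⟩, ⟨[], .big W₂ W', []⟩]
        [⟨[], .big W W', []⟩, ⟨sheaf W' ++ a, .ctrl g, c⟩]
  | untangle_right (g : CGate α) (a c : List (Color α)) (W W₂ W' : List (Letter α))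
      (h : sheaf W = a ++ g.dom ++ c) (h₂ : sheaf W₂ = a ++ g.cod ++ c) :
      FullCell
        [⟨sheaf W' ++ a, .ctrl g, c⟩, ⟨[], .big W' W₂, []⟩]
        [⟨[], .big W' W, []⟩, ⟨a, .ctrl g, c ++ sheaf W'⟩]
  /- The same for a gate without inputs that creates the whole sheaf: no sheaf is left to be
  crossed above the gate, and the `B`-gate disappears. -/
  | untangle_left_nil (g : CGate α) (W₂ W' : List (Letter α))
      (h : g.dom = []) (h₂ : sheaf W₂ = g.cod) :
      FullCell [⟨[], .ctrl g, sheaf W'⟩, ⟨[], .big W₂ W', []⟩] [⟨sheaf W', .ctrl g, []⟩]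
  | untangle_right_nil (g : CGate α) (W₂ W' : List (Letter α))
      (h : g.dom = []) (h₂ : sheaf W₂ = g.cod) :
      FullCell [⟨sheaf W', .ctrl g, []⟩, ⟨[], .big W' W₂, []⟩] [⟨[], .ctrl g, sheaf W'⟩]
  /- `B`-introduction, crossing split on the left premise. In the source, `b` is applied to `φ` and
  `φ₁`, the strings `X ++ Z` go to the right through `N`, and `c` is applied to the outcome
  and `φ₂`. In the target, `φ₁` and `φ₂` are crossed by a `B`-gate and `c` comes before `b`. -/
  | big_intro_left (b c : BinRule α) (Γ X Y Z Δ Θ : List (Formula α))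
      (φ : (control α).Diagram [] (blk (Γ ++ (X ++ Z) ++ [b.left])))
      (φ₁ : (control α).Diagram [] (blk (b.right :: Δ)))
      (φ₂ : (control α).Diagram [] (blk (c.right :: Θ)))
      (N : (control α).Diagram (fw (X ++ Z)) (fw [c.left]))
      (φ₀ : (control α).Diagram [] (blk (Γ ++ X ++ Y ++ Z)))
      (N' : (control α).Diagram (fw Y) (fw [b.left]))
      (hφ : φ.Irreducible) (hφ₁ : φ₁.Irreducible) (hφ₂ : φ₂.Irreducible)
      (hN : N.Irreducible) (hN' : N'.Irreducible)
      (hNc : NoControl N.slices) (hNc' : NoControl N'.slices)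
      (hφ₀ : (control α).SameDiagram φ.slices
        (φ₀.slices ++ whisker (.L :: fw (Γ ++ X)) (cross Y Z) [.R]
          ++ whisker (.L :: fw (Γ ++ X ++ Z)) N'.slices [.R])) :
      FullCell
        (incl (φ.slices
          ++ whisker (blk (Γ ++ (X ++ Z) ++ [b.left])) φ₁.slices []
          ++ whisker (blk (Γ ++ (X ++ Z) ++ [b.left]) ++ blk (b.right :: Δ)) φ₂.slices []
          ++ [⟨.L :: fw (Γ ++ (X ++ Z)), .bin b, fw Δ ++ [.R] ++ blk (c.right :: Θ)⟩]
          ++ whisker (.L :: fw Γ) (cross (X ++ Z) (b.prin ++ Δ)) (.R :: blk (c.right :: Θ))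
          ++ whisker (.L :: fw (Γ ++ b.prin ++ Δ)) N.slices (.R :: blk (c.right :: Θ))
          ++ [⟨.L :: fw (Γ ++ b.prin ++ Δ), .bin c, fw Θ ++ [.R]⟩]))
        (incl (φ.slices
          ++ whisker (blk (Γ ++ (X ++ Z) ++ [b.left])) φ₁.slices []
          ++ whisker (blk (Γ ++ (X ++ Z) ++ [b.left]) ++ blk (b.right :: Δ)) φ₂.slices []
          ++ whisker (.L :: fw Γ) (cross (X ++ Z) [b.left])
              (.R :: (blk (b.right :: Δ) ++ blk (c.right :: Θ))))
          ++ [⟨blk (Γ ++ [b.left] ++ (X ++ Z)),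
              .big ((b.right :: Δ).map .fm) ((c.right :: Θ).map .fm), []⟩]
          ++ incl (whisker (.L :: fw (Γ ++ [b.left])) N.slices
              (.R :: (blk (c.right :: Θ) ++ blk (b.right :: Δ)))
          ++ [⟨.L :: fw (Γ ++ [b.left]), .bin c, fw Θ ++ [.R] ++ blk (b.right :: Δ)⟩]
          ++ whisker (.L :: fw (Γ ++ [b.left])) (cross c.prin Θ) (.R :: blk (b.right :: Δ))
          ++ whisker (.L :: fw Γ) (cross [b.left] (Θ ++ c.prin)) (.R :: blk (b.right :: Δ))
          ++ [⟨.L :: fw (Γ ++ Θ ++ c.prin), .bin b, fw Δ ++ [.R]⟩]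
          ++ whisker (.L :: fw Γ) (cross (Θ ++ c.prin) b.prin) (fw Δ ++ [.R])
          ++ whisker (.L :: fw (Γ ++ b.prin)) (cross (Θ ++ c.prin) Δ) [.R]
          ++ whisker (.L :: fw (Γ ++ b.prin ++ Δ)) (cross Θ c.prin) [.R]))
  /- `B`-introduction, crossing split on the right premise. -/
  | big_intro_right (b c : BinRule α) (Γ X Y Z Δ Θ : List (Formula α))
      (ψ : (control α).Diagram [] (blk ([b.right] ++ (X ++ Z) ++ Γ)))
      (ψ₁ : (control α).Diagram [] (blk (Θ ++ [c.left])))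
      (ψ₂ : (control α).Diagram [] (blk (Δ ++ [b.left])))
      (N : (control α).Diagram (fw (X ++ Z)) (fw [c.right]))
      (ψ₀ : (control α).Diagram [] (blk (X ++ Y ++ Z ++ Γ)))
      (N' : (control α).Diagram (fw Y) (fw [b.right]))
      (hψ : ψ.Irreducible) (hψ₁ : ψ₁.Irreducible) (hψ₂ : ψ₂.Irreducible)
      (hN : N.Irreducible) (hN' : N'.Irreducible)
      (hNc : NoControl N.slices) (hNc' : NoControl N'.slices)
      (hψ₀ : (control α).SameDiagram ψ.slices
        (ψ₀.slices ++ whisker [.L] (cross X Y) (fw (Z ++ Γ) ++ [.R])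
          ++ whisker [.L] N'.slices (fw (X ++ Z ++ Γ) ++ [.R]))) :
      FullCell
        (incl (ψ₁.slices
          ++ whisker (blk (Θ ++ [c.left])) ψ₂.slices []
          ++ whisker (blk (Θ ++ [c.left]) ++ blk (Δ ++ [b.left])) ψ.slices []
          ++ [⟨blk (Θ ++ [c.left]) ++ .L :: fw Δ, .bin b, fw ((X ++ Z) ++ Γ) ++ [.R]⟩]
          ++ whisker (blk (Θ ++ [c.left]) ++ [.L]) (cross (Δ ++ b.prin) (X ++ Z)) (fw Γ ++ [.R])
          ++ whisker (blk (Θ ++ [c.left]) ++ [.L]) N.slices (fw (Δ ++ b.prin ++ Γ) ++ [.R])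
          ++ [⟨.L :: fw Θ, .bin c, fw (Δ ++ b.prin ++ Γ) ++ [.R]⟩]))
        (incl (ψ₁.slices
          ++ whisker (blk (Θ ++ [c.left])) ψ₂.slices []
          ++ whisker (blk (Θ ++ [c.left]) ++ blk (Δ ++ [b.left])) ψ.slices []
          ++ whisker (blk (Θ ++ [c.left]) ++ blk (Δ ++ [b.left]) ++ [.L])
              (cross [b.right] (X ++ Z)) (fw Γ ++ [.R]))
          ++ [⟨[], .big ((Θ ++ [c.left]).map .fm) ((Δ ++ [b.left]).map .fm),
              blk ((X ++ Z) ++ [b.right] ++ Γ)⟩]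
          ++ incl (whisker (blk (Δ ++ [b.left]) ++ blk (Θ ++ [c.left]) ++ [.L]) N.slices
              (fw ([b.right] ++ Γ) ++ [.R])
          ++ [⟨blk (Δ ++ [b.left]) ++ .L :: fw Θ, .bin c, fw ([b.right] ++ Γ) ++ [.R]⟩]
          ++ whisker (blk (Δ ++ [b.left]) ++ .L :: fw Θ) (cross c.prin [b.right]) (fw Γ ++ [.R])
          ++ whisker (blk (Δ ++ [b.left]) ++ [.L]) (cross Θ [b.right]) (fw (c.prin ++ Γ) ++ [.R])
          ++ [⟨.L :: fw Δ, .bin b, fw (Θ ++ c.prin ++ Γ) ++ [.R]⟩]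
          ++ whisker [.L] (cross (Δ ++ b.prin) (Θ ++ c.prin)) (fw Γ ++ [.R])))

/-- The polygraph of multiplicative proof diagrams. -/
abbrev full (α : Type u) : Polygraph.{u, u} where
  Color := Color α
  Gate := FGate α
  dom := FGate.dom
  cod := FGate.cod
  Cell := FullCell

theorem typed_incl {α : Type u} (φ : List (Slice (Color α) (CGate α))) (x y : List (Color α))
    (h : (control α).Typed φ x y) : (full α).Typed (incl φ) x y := by
  induction φ generalizing x with
  | nil => exact h
  | cons s φ ih => exact ⟨h.1, ih _ h.2⟩

/-- A diagram of the control polygraph as a diagram of the larger polygraph. -/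
def toFull {α : Type u} {x y : List (Color α)} (φ : (control α).Diagram x y) :
    (full α).Diagram x y :=
  ⟨incl φ.slices, typed_incl _ _ _ φ.typed⟩

/-! ### Representation of derivations by diagrams -/

/-- The position, among the inputs of a diagram of twisting operators, of the string that ends at
position `i` of its outputs. -/
def trace {α : Type u} : List (Slice (Color α) (CGate α)) → ℕ → ℕ
  | [], i => i
  | s :: τ, i => Equiv.swap s.left.length (s.left.length + 1) (trace τ i)

/-- The twisting diagram `τ` from `Γ` to `Δ` performs the rearrangement `σ`. -/
def Realizes {α : Type u} {Γ Δ : List (Formula α)} (τ : List (Slice (Color α) (CGate α)))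
    (σ : Reorder Γ Δ) : Prop :=
  (∀ s ∈ τ, ∃ A B, s.gate = .swap A B) ∧ (control α).Typed τ (fw Γ) (fw Δ) ∧
    ∀ i, (σ.toEquiv i : ℕ) = trace τ i

/-- The diagram represents the derivation: reading it from top to bottom, its gates imitate the
inference rules of the derivation. -/
inductive Represents {α : Type u} :
    {Γ : List (Formula α)} → List (Slice (Color α) (CGate α)) → Deriv Γ → Prop
  | ax (A : Formula α) : Represents [⟨[], .ax A, []⟩] (Deriv.ax A)
  | one : Represents [⟨[], .one, []⟩] Deriv.one
  | unary {Γ : List (Formula α)} {φ : List (Slice (Color α) (CGate α))} (r : UnRule α)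
      {d : Deriv (Γ ++ r.act)} (h : Represents φ d) :
      Represents (φ ++ [⟨.L :: fw Γ, .un r, [.R]⟩]) (Deriv.unary r d)
  | unaryAt {φ : List (Slice (Color α) (CGate α))} (Γ : List (Formula α)) (r : UnRule α)
      (Δ : List (Formula α)) {d : Deriv (Γ ++ r.act ++ Δ)} (h : Represents φ d) :
      Represents (φ ++ [⟨.L :: fw Γ, .un r, fw Δ ++ [.R]⟩]) (Deriv.unaryAt Γ r Δ d)
  | binary {Γ Δ : List (Formula α)} {φ ψ : List (Slice (Color α) (CGate α))} (b : BinRule α)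
      {d : Deriv (Γ ++ [b.left])} {e : Deriv (b.right :: Δ)}
      (h : Represents φ d) (h' : Represents ψ e) :
      Represents
        (φ ++ whisker (blk (Γ ++ [b.left])) ψ [] ++ [⟨.L :: fw Γ, .bin b, fw Δ ++ [.R]⟩])
        (Deriv.binary b d e)
  | ex {Γ Δ : List (Formula α)} {φ τ : List (Slice (Color α) (CGate α))} {σ : Reorder Γ Δ}
      {d : Deriv Γ} (h : Represents φ d) (hτ : Realizes τ σ) :
      Represents (φ ++ whisker [.L] τ [.R]) (Deriv.ex σ d)
  | same {Γ : List (Formula α)} {φ φ' : List (Slice (Color α) (CGate α))} {d : Deriv Γ}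
      (h : Represents φ d) (h' : (control α).SameDiagram φ φ') : Represents φ' d

/-- Two derivations are represented by proof diagrams of the control polygraph that are equal in
the category presented by the polygraph of proof diagrams. -/
def DiagEquiv {α : Type u} {Γ : List (Formula α)} (d d' : Deriv Γ) : Prop :=
  ∃ φ φ' : (control α).Diagram [] (blk Γ),
    Represents φ.slices d ∧ Represents φ'.slices d' ∧ (toFull φ).cls = (toFull φ').cls

end MLLu

namespace MLLu

/-! Equivalent derivations have equal diagrams. Every derivation `d` has a canonical diagram `diag
d`, and every diagram that represents `d` is convertible to it in the control polygraph
(`Represents.conv_diag`). The choices in a representation are the twisting diagrams, settled by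
coherence for permutations (`conv_of_trace_eq`), and the place of a unary gate, which slides along
crossings (`conv_unaryAt`). Each generator of `StdEquiv` can therefore be tested on convenient
representatives, and all but two of them come from coherence, the interchange law or the relation
`ax_swap`. The other two, `binary_left` and `binary_right`, list two premises in a different order,
and control strings cannot be crossed by twisting operators. Here `B`-introduction is applied with
empty `N` and `N'`. The new `B`-gate has a closed diagram above one of its two sheaves; this diagram
slides through gate by gate, and its first gate makes the `B`-gate vanish (`conv_big_right`).

Two facts support this step. `B`-introduction asks for irreducible diagrams, so the control
polygraph has to terminate; a numerical interpretation of strings and gates shows that it does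
(`heat_rewrite`, `exists_irreducible`). Untangling asks that the nonempty words met inside a closed
diagram be sheaves, which follows from an analysis of the nesting of `L` and `R`
(`nesting_of_typed`, `exists_blocks`).

Equal diagrams come from equivalent derivations. This direction is semantic: a diagram acts as a
partial function on lists of items, an item being a sequent with a `StdEquiv` class of its
derivations. An `Ax` or `1` gate creates an item, `s`, `⅋` and `⊥` act inside one item, `⊗` and
`Cut` merge two neighbours, and a `B`-gate exchanges two consecutive sublists. The action is
deterministic (`Step.unique`, `Eval.unique`), and it is defined on every diagram whose target is a
sequence of blocks `L, Γ, R` (`exists_eval`). It is invariant under interchange (`step_interchange`)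
and under the rules (`sound_cell`). In each case one inclusion is proved, and determinism with
totality gives the converse. Soundness of `B`-introduction is the generator `binary_left` or
`binary_right`, once the effect of `N` has been moved into the premise; the untangle relations hold
because a `B`-gate only permutes items. A diagram that represents `d` creates exactly the class of
`d` from the empty list (`Represents.eval`), so equal diagrams force equal classes. -/

@[simp] theorem whisker_nil {C : Type u} {G : Type v} (a b : List C) :
    whisker a ([] : List (Slice C G)) b = [] := rfl

@[simp] theorem whisker_cons {C : Type u} {G : Type v} (a b : List C) (s : Slice C G)
    (φ : List (Slice C G)) :
    whisker a (s :: φ) b = ⟨a ++ s.left, s.gate, s.right ++ b⟩ :: whisker a φ b := rfl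

@[simp] theorem whisker_append {C : Type u} {G : Type v} (a b : List C)
    (φ ψ : List (Slice C G)) : whisker a (φ ++ ψ) b = whisker a φ b ++ whisker a ψ b := by
  simp [whisker]

@[simp] theorem whisker_whisker {C : Type u} {G : Type v} (a b a' b' : List C)
    (φ : List (Slice C G)) : whisker a (whisker a' φ b') b = whisker (a ++ a') φ (b' ++ b) := by
  simp [whisker]

@[simp] theorem whisker_nil_nil {C : Type u} {G : Type v} (φ : List (Slice C G)) :
    whisker [] φ [] = φ := by
  simp [whisker]

/-! ### Typing and conversion of diagrams -/

namespace Polygraph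

variable {P : Polygraph.{u, v}} {x y z x' y' a b : List P.Color}
  {φ ψ φ' ψ' l r : List (Slice P.Color P.Gate)}

@[simp] theorem typed_nil : P.Typed [] x y ↔ x = y := Iff.rfl

theorem typed_append : P.Typed (φ ++ ψ) x z ↔ ∃ y, P.Typed φ x y ∧ P.Typed ψ y z := by
  induction φ generalizing x with
  | nil => simp [Typed]
  | cons s φ ih => simp [Typed, ih, and_assoc]

theorem Typed.append (h : P.Typed φ x y) (h' : P.Typed ψ y z) : P.Typed (φ ++ ψ) x z :=
  typed_append.2 ⟨y, h, h'⟩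

theorem Typed.whisker (h : P.Typed φ x y) (a b : List P.Color) :
    P.Typed (whisker a φ b) (a ++ x ++ b) (a ++ y ++ b) := by
  induction φ generalizing x with
  | nil => cases h; exact rfl
  | cons s φ ih =>
    obtain ⟨rfl, h⟩ := h
    rw [whisker_cons]
    exact ⟨by simp, by simpa using ih h⟩

theorem Typed.unique (h : P.Typed φ x y) (h' : P.Typed φ x z) : y = z := by
  induction φ generalizing x with
  | nil => exact h.symm.trans h'
  | cons s φ ih => exact ih h.2 h'.2

theorem typed_slice (a b : List P.Color) (g : P.Gate) (hx : x = a ++ P.dom g ++ b)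
    (hy : y = a ++ P.cod g ++ b) : P.Typed [⟨a, g, b⟩] x y :=
  ⟨hx, hy.symm⟩

theorem Interchange.typed_iff (h : P.Interchange l r) : P.Typed l x y ↔ P.Typed r x y := by
  obtain ⟨χ, χ', g, h, a, b, c⟩ := h
  simp only [typed_append]
  constructor
  · rintro ⟨_, ⟨w, h1, h2, h3, rfl⟩, h4⟩
    refine ⟨_, ⟨w, h1, by simpa using h2, ?_, rfl⟩, by simpa using h4⟩
    simp
  · rintro ⟨_, ⟨w, h1, h2, h3, rfl⟩, h4⟩
    refine ⟨_, ⟨w, h1, by simpa using h2, ?_, rfl⟩, by simpa using h4⟩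
    simp

theorem SameDiagram.typed_iff (h : P.SameDiagram l r) : P.Typed l x y ↔ P.Typed r x y := by
  induction h with
  | rel _ _ h => exact h.typed_iff
  | refl => rfl
  | symm _ _ _ ih => exact ih.symm
  | trans _ _ _ _ _ ih ih' => exact ih.trans ih'

theorem Rewrite.mk' {χ χ' : List (Slice P.Color P.Gate)} (h : P.Rewrite l r) (a b : List P.Color) :
    P.Rewrite (χ ++ MLLu.whisker a l b ++ χ') (χ ++ MLLu.whisker a r b ++ χ') := by
  obtain ⟨ψ, ψ', l, r, a', b', x, y, hl, hr, h⟩ := h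
  simpa using Rewrite.mk (χ ++ MLLu.whisker a ψ b) (MLLu.whisker a ψ' b ++ χ') l r (a ++ a') (b' ++ b) x y hl hr h

theorem Interchange.mk' {χ χ' : List (Slice P.Color P.Gate)} (h : P.Interchange l r)
    (a b : List P.Color) :
    P.Interchange (χ ++ MLLu.whisker a l b ++ χ') (χ ++ MLLu.whisker a r b ++ χ') := by
  obtain ⟨ψ, ψ', g, h, a', b', c⟩ := h
  simpa using Interchange.mk (χ ++ MLLu.whisker a ψ b) (MLLu.whisker a ψ' b ++ χ') g h (a ++ a') b' (c ++ b)

variable (P) in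
/-- Two sequences of elementary diagrams from `x` to `y` are equal in the presented category. -/
def Conv (x y : List P.Color) (l r : List (Slice P.Color P.Gate)) : Prop :=
  ∃ (hl : P.Typed l x y) (hr : P.Typed r x y), (⟨l, hl⟩ : P.Diagram x y).cls = Diagram.cls ⟨r, hr⟩

namespace Conv

theorem typed_left (h : P.Conv x y l r) : P.Typed l x y := h.1
theorem typed_right (h : P.Conv x y l r) : P.Typed r x y := h.2.1

theorem refl (h : P.Typed l x y) : P.Conv x y l l := ⟨h, h, rfl⟩

theorem of_eq (h : P.Typed l x y) (e : l = r) : P.Conv x y l r := e ▸ refl h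

theorem symm (h : P.Conv x y l r) : P.Conv x y r l := ⟨h.2.1, h.1, h.2.2.symm⟩

theorem trans (h : P.Conv x y l φ) (h' : P.Conv x y φ r) : P.Conv x y l r :=
  ⟨h.1, h'.2.1, h.2.2.trans h'.2.2⟩

/-- Conversions are transported along congruences. -/
theorem map {F : List (Slice P.Color P.Gate) → List (Slice P.Color P.Gate)}
    (hF : ∀ l, P.Typed l x y → P.Typed (F l) x' y')
    (hI : ∀ l r, P.Interchange l r → P.Interchange (F l) (F r))
    (hR : ∀ l r, P.Rewrite l r → P.Rewrite (F l) (F r))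
    (h : P.Conv x y l r) : P.Conv x' y' (F l) (F r) := by
  obtain ⟨hl, hr, h⟩ := h
  refine ⟨hF _ hl, hF _ hr, ?_⟩
  exact congrArg (Quot.map (fun φ : P.Diagram x y => (⟨F φ.slices, hF _ φ.typed⟩ : P.Diagram x' y'))
    (fun φ ψ h => h.imp (hI _ _) (hR _ _))) h

theorem whisker (h : P.Conv x y l r) (a b : List P.Color) :
    P.Conv (a ++ x ++ b) (a ++ y ++ b) (whisker a l b) (MLLu.whisker a r b) :=
  map (F := fun l => MLLu.whisker a l b) (fun _ h => h.whisker a b)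
    (fun l r h => by simpa using h.mk' (χ := []) (χ' := []) a b)
    (fun l r h => by simpa using h.mk' (χ := []) (χ' := []) a b) h

theorem append_left (hχ : P.Typed φ x y) (h : P.Conv y z l r) : P.Conv x z (φ ++ l) (φ ++ r) :=
  map (F := fun l => φ ++ l) (fun _ h => hχ.append h)
    (fun l r h => by simpa using h.mk' (χ := φ) (χ' := []) [] [])
    (fun l r h => by simpa using h.mk' (χ := φ) (χ' := []) [] []) h

theorem append_right (h : P.Conv x y l r) (hχ : P.Typed φ y z) : P.Conv x z (l ++ φ) (r ++ φ) :=
  map (F := fun l => l ++ φ) (fun _ h => h.append hχ)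
    (fun l r h => by simpa using h.mk' (χ := []) (χ' := φ) [] [])
    (fun l r h => by simpa using h.mk' (χ := []) (χ' := φ) [] []) h

theorem append (h : P.Conv x y l r) (h' : P.Conv y z φ ψ) : P.Conv x z (l ++ φ) (r ++ ψ) :=
  (h.append_right h'.1).trans (append_left h.2.1 h')

theorem of_cell (h : P.Cell l r) (hl : P.Typed l x y) (hr : P.Typed r x y) : P.Conv x y l r :=
  ⟨hl, hr, Quot.sound (.inr (by simpa using Rewrite.mk [] [] l r [] [] x y hl hr h))⟩

theorem of_rewrite (h : P.Rewrite l r) (hl : P.Typed l x y) (hr : P.Typed r x y) :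
    P.Conv x y l r := ⟨hl, hr, Quot.sound (.inr h)⟩

theorem of_interchange (h : P.Interchange l r) (hl : P.Typed l x y) : P.Conv x y l r :=
  ⟨hl, h.typed_iff.1 hl, Quot.sound (.inl h)⟩

theorem of_sameDiagram (h : P.SameDiagram l r) (hl : P.Typed l x y) : P.Conv x y l r := by
  induction h with
  | rel _ _ h => exact of_interchange h hl
  | refl => exact refl hl
  | symm _ _ h ih => exact (ih ((SameDiagram.typed_iff h).2 hl)).symm
  | trans _ _ _ h _ ih ih' => exact (ih hl).trans (ih' ((SameDiagram.typed_iff h).1 hl))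

/-- Of two neighbouring gates with disjoint strings, either can be the upper one. -/
theorem slices (g h : P.Gate) (a b c : List P.Color) :
    P.Conv (a ++ P.dom g ++ b ++ P.dom h ++ c) (a ++ P.cod g ++ b ++ P.cod h ++ c)
      [⟨a, g, b ++ P.dom h ++ c⟩, ⟨a ++ P.cod g ++ b, h, c⟩]
      [⟨a ++ P.dom g ++ b, h, c⟩, ⟨a, g, b ++ P.cod h ++ c⟩] :=
  of_interchange (by simpa using Interchange.mk [] [] g h a b c)
    ⟨by simp, by simp, by simp⟩

/-- Of two neighbouring diagrams with disjoint strings, either can be the upper one. -/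
theorem interchange (h : P.Typed φ x x') (h' : P.Typed ψ y y') :
    P.Conv (x ++ y) (x' ++ y') (MLLu.whisker [] φ y ++ MLLu.whisker x' ψ [])
      (MLLu.whisker x ψ [] ++ MLLu.whisker [] φ y') := by
  induction φ generalizing x with
  | nil =>
    cases h
    simpa using refl (by simpa using h'.whisker x' [])
  | cons s φ ih =>
    -- A single slice of `φ` is first moved below all of `ψ`, by induction on `ψ`; the outer
    -- induction then treats the slices of `φ` one after the other.
    have key : P.Conv (x ++ y) (s.left ++ P.cod s.gate ++ s.right ++ y')
        (MLLu.whisker [] [s] y ++ MLLu.whisker (s.left ++ P.cod s.gate ++ s.right) ψ [])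
        (MLLu.whisker x ψ [] ++ MLLu.whisker [] [s] y') := by
      obtain ⟨rfl, h⟩ := h
      clear ih
      induction ψ generalizing y with
      | nil =>
        cases h'
        simpa using refl (typed_slice s.left (s.right ++ y') s.gate (by simp) (by simp))
      | cons t ψ ih2 =>
        obtain ⟨rfl, h'⟩ := h'
        have e := slices s.gate t.gate s.left (s.right ++ t.left) t.right
        have e1 := e.append_right (z := s.left ++ P.cod s.gate ++ s.right ++ y')
          (φ := MLLu.whisker (s.left ++ P.cod s.gate ++ s.right) ψ [])
          (by simpa using h'.whisker (s.left ++ P.cod s.gate ++ s.right) [])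
        have e2 := ih2 h'
        have e3 := append_left (x := s.left ++ P.dom s.gate ++ s.right ++ (t.left ++ P.dom t.gate ++ t.right))
          (φ := [⟨s.left ++ P.dom s.gate ++ s.right ++ t.left, t.gate, t.right⟩])
          (typed_slice _ _ _ (by simp) (by simp)) e2
        exact (by simpa using e1 : P.Conv _ _ _ _).trans (by simpa using e3)
    obtain ⟨rfl, h⟩ := h
    have e1 := ih h
    have e2 := append_left (x := s.left ++ P.dom s.gate ++ s.right ++ y)
      (φ := MLLu.whisker [] [s] y) (typed_slice _ _ _ (by simp) (by simp)) e1
    have e3 := key.append_right (φ := MLLu.whisker [] φ y') (z := x' ++ y')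
      (by simpa using h.whisker [] y')
    exact (by simpa using e2 : P.Conv _ _ _ _).trans (by simpa using e3)

end Conv

end Polygraph

open Polygraph

/-! ### Twisting diagrams and coherence for permutations -/

variable {α : Type u}

@[simp] theorem fw_nil : fw ([] : List (Formula α)) = [] := rfl
@[simp] theorem fw_cons (A : Formula α) (Γ : List (Formula α)) : fw (A :: Γ) = .fm A :: fw Γ := rfl
@[simp] theorem fw_append (Γ Δ : List (Formula α)) : fw (Γ ++ Δ) = fw Γ ++ fw Δ := List.map_append
@[simp] theorem length_fw (Γ : List (Formula α)) : (fw Γ).length = Γ.length := List.length_map _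

theorem fw_injective : Function.Injective (fw (α := α)) :=
  List.map_injective_iff.2 fun _ _ h => Color.fm.inj h

theorem fw_eq_append {Γ : List (Formula α)} {x y : List (Color α)} (h : fw Γ = x ++ y) :
    ∃ Γ₁ Γ₂, Γ = Γ₁ ++ Γ₂ ∧ x = fw Γ₁ ∧ y = fw Γ₂ := by
  obtain ⟨a, b, rfl, rfl, rfl⟩ := List.map_eq_append_iff.1 h
  exact ⟨a, b, rfl, rfl, rfl⟩

/-- All gates are twisting operators. -/
def SwapOnly (τ : List (Slice (Color α) (CGate α))) : Prop :=
  ∀ s ∈ τ, ∃ A B, s.gate = CGate.swap A B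

theorem SwapOnly.append {τ τ' : List (Slice (Color α) (CGate α))} (h : SwapOnly τ)
    (h' : SwapOnly τ') : SwapOnly (τ ++ τ') := fun s hs =>
  (List.mem_append.1 hs).elim (h s) (h' s)

theorem SwapOnly.whisker {τ : List (Slice (Color α) (CGate α))} (h : SwapOnly τ)
    (a b : List (Color α)) : SwapOnly (whisker a τ b) := by
  intro s hs
  obtain ⟨t, ht, rfl⟩ := List.mem_map.1 hs
  exact h t ht

theorem swapOnly_nil : SwapOnly ([] : List (Slice (Color α) (CGate α))) := by simp [SwapOnly]

theorem swapOnly_swap (a b : List (Color α)) (A B : Formula α) :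
    SwapOnly [⟨a, CGate.swap A B, b⟩] := by
  intro s hs
  obtain rfl := List.mem_singleton.1 hs
  exact ⟨A, B, rfl⟩

theorem trace_append (τ τ' : List (Slice (Color α) (CGate α))) (i : ℕ) :
    trace (τ ++ τ') i = trace τ (trace τ' i) := by
  induction τ with
  | nil => rfl
  | cons s τ ih => simp [trace, ih]

theorem trace_whisker (a b : List (Color α)) (τ : List (Slice (Color α) (CGate α))) (i : ℕ) :
    trace (whisker a τ b) i = if i < a.length then i else a.length + trace τ (i - a.length) := by
  induction τ with
  | nil => simp only [whisker_nil, trace]; split_ifs <;> omega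
  | cons s τ ih =>
    simp only [whisker_cons, trace, ih, Equiv.swap_apply_def, List.length_append]
    split_ifs <;> omega

/-- The string labelled `A` crosses all strings `X` on its right. -/
def crossOver (A : Formula α) : List (Formula α) → List (Slice (Color α) (CGate α))
  | [] => []
  | b :: X => ⟨[], .swap A b, fw X⟩ :: whisker [.fm b] (crossOver A X) []

theorem crossOver_append (A : Formula α) (X Y : List (Formula α)) :
    crossOver A (X ++ Y) =
      whisker [] (crossOver A X) (fw Y) ++ whisker (fw X) (crossOver A Y) [] := by
  induction X with
  | nil => simp [crossOver]
  | cons b X ih => simp [crossOver, ih]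

theorem typed_crossOver (A : Formula α) (X : List (Formula α)) :
    (control α).Typed (crossOver A X) (.fm A :: fw X) (fw X ++ [.fm A]) := by
  induction X with
  | nil => exact rfl
  | cons b X ih =>
    refine ⟨rfl, ?_⟩
    simpa [CGate.cod] using ih.whisker [.fm b] []

theorem swapOnly_crossOver (A : Formula α) (X : List (Formula α)) : SwapOnly (crossOver A X) := by
  induction X with
  | nil => exact swapOnly_nil
  | cons b X ih => exact (swapOnly_swap _ _ _ _).append (ih.whisker _ _)

theorem trace_crossOver (A : Formula α) (X : List (Formula α)) (i : ℕ) :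
    trace (crossOver A X) i = if i < X.length then i + 1 else if i = X.length then 0 else i := by
  induction X generalizing i with
  | nil => simp only [crossOver, trace, List.length_nil]; split_ifs <;> omega
  | cons b X ih =>
    simp only [crossOver, trace, trace_whisker, ih, Equiv.swap_apply_def, List.length_cons,
      List.length_nil]
    grind

/-- A string crosses a gate, provided that it can cross the gate alone. -/
theorem crossOver_gate (A : Formula α) (g : CGate α) (X Y U V : List (Formula α))
    (hX : g.dom = fw X) (hY : g.cod = fw Y)
    (h : (control α).Conv (.fm A :: fw X) (fw Y ++ [.fm A])
      (⟨[.fm A], g, []⟩ :: crossOver A Y) (crossOver A X ++ [⟨[], g, [.fm A]⟩])) :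
    (control α).Conv (.fm A :: fw (U ++ X ++ V)) (fw (U ++ Y ++ V) ++ [.fm A])
      (⟨.fm A :: fw U, g, fw V⟩ :: crossOver A (U ++ Y ++ V))
      (crossOver A (U ++ X ++ V) ++ [⟨fw U, g, fw V ++ [.fm A]⟩]) := by
  -- The crossings with `U` and with `V` do not meet the gate and are moved by interchange (`e1`,
  -- `e3`); only the crossings next to the gate need `h` (`e2`).
  have e1 := ((Conv.interchange (P := control α) (typed_crossOver A U)
    ((typed_slice [] (fw V) g (by simp [hX]) (by simp [hY]) :
      (control α).Typed _ (fw X ++ fw V) (fw Y ++ fw V)))).symm.append_right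
      (φ := whisker (fw U) (crossOver A Y) (fw V)) (z := fw U ++ fw Y ++ .fm A :: fw V)
      (by simpa using (typed_crossOver A Y).whisker (fw U) (fw V))).append_right
      (φ := whisker (fw U ++ fw Y) (crossOver A V) []) (z := fw U ++ fw Y ++ fw V ++ [.fm A])
      (by simpa using (typed_crossOver A V).whisker (fw U ++ fw Y) [])
  have e2 := Conv.append_left (P := control α) (φ := whisker [] (crossOver A U) (fw X ++ fw V))
      (x := .fm A :: (fw U ++ fw X ++ fw V))
      (by simpa using (typed_crossOver A U).whisker [] (fw X ++ fw V))
      ((h.whisker (fw U) (fw V)).append_right (φ := whisker (fw U ++ fw Y) (crossOver A V) [])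
        (z := fw U ++ fw Y ++ fw V ++ [.fm A])
        (by simpa using (typed_crossOver A V).whisker (fw U ++ fw Y) []))
  have e3 := Conv.append_left (P := control α)
      (φ := whisker [] (crossOver A U) (fw X ++ fw V) ++ whisker (fw U) (crossOver A X) (fw V))
      (x := .fm A :: (fw U ++ fw X ++ fw V)) (y := fw U ++ fw X ++ .fm A :: fw V)
      (Typed.append (y := fw U ++ .fm A :: (fw X ++ fw V))
        (by simpa using (typed_crossOver A U).whisker [] (fw X ++ fw V))
        (by simpa using (typed_crossOver A X).whisker (fw U) (fw V)))
      (Conv.interchange (P := control α)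
        (typed_slice (fw U) [] g (by simp [hX]) (by simp [hY]) :
          (control α).Typed _ (fw U ++ fw X) (fw U ++ fw Y)) (typed_crossOver A V))
  simp only [crossOver_append, fw_append, whisker_append, whisker_cons, whisker_whisker,
    List.append_assoc, List.cons_append, List.nil_append, List.append_nil, whisker_nil] at e1 e2 e3 ⊢
  exact (e1.trans e2).trans e3

theorem crossOver_swap (A B C : Formula α) :
    (control α).Conv (.fm A :: fw [B, C]) (fw [C, B] ++ [.fm A])
      (⟨[.fm A], .swap B C, []⟩ :: crossOver A [C, B])
      (crossOver A [B, C] ++ [⟨[], .swap B C, [.fm A]⟩]) :=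
  (Conv.of_cell (P := control α) (.yang_baxter A B C) (by simp [Typed, CGate.dom, CGate.cod])
    (by simp [Typed, CGate.dom, CGate.cod])).symm

/-- The relations `swap_par` and `swap_bot` in the common form that `crossAll_un` iterates. -/
theorem crossOver_un (A : Formula α) (r : UnRule α) :
    (control α).Conv (.fm A :: fw r.act) (fw [r.prin] ++ [.fm A])
      (⟨[.fm A], .un r, []⟩ :: crossOver A [r.prin])
      (crossOver A r.act ++ [⟨[], .un r, [.fm A]⟩]) := by
  rcases r with ⟨B, C⟩ | -
  · exact Conv.of_cell (P := control α) (ControlCell.swap_par A B C)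
      (by simp [crossOver, Typed, CGate.dom, CGate.cod, UnRule.act, UnRule.prin])
      (by simp [crossOver, Typed, CGate.dom, CGate.cod, UnRule.act, UnRule.prin])
  · exact Conv.of_cell (P := control α) (ControlCell.swap_bot A)
      (by simp [crossOver, Typed, CGate.dom, CGate.cod, UnRule.act, UnRule.prin])
      (by simp [crossOver, Typed, CGate.dom, CGate.cod, UnRule.act, UnRule.prin])

theorem conv_swap_swap (A B : Formula α) :
    (control α).Conv (fw [A, B]) (fw [A, B]) [⟨[], .swap A B, []⟩, ⟨[], .swap B A, []⟩] [] :=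
  Conv.of_cell (P := control α) (.swap_swap A B) (by simp [Typed, CGate.dom, CGate.cod]) rfl

theorem typed_swap_inv {a b y : List (Color α)} {A B : Formula α} {Γ : List (Formula α)}
    (h : (control α).Typed [⟨a, .swap A B, b⟩] (fw Γ) y) :
    ∃ U V, Γ = U ++ A :: B :: V ∧ a = fw U ∧ b = fw V ∧ y = fw (U ++ B :: A :: V) := by
  obtain ⟨h, rfl⟩ := h
  simp only [CGate.dom, List.append_assoc] at h
  obtain ⟨U, W, rfl, rfl, h⟩ := fw_eq_append h
  rcases W with - | ⟨A', - | ⟨B', V⟩⟩ <;> simp [fw] at h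
  obtain ⟨rfl, rfl, rfl⟩ := h
  exact ⟨U, V, rfl, rfl, rfl, by simp [CGate.cod, fw]⟩

/-- A twisting diagram can be rearranged so that the first string is moved last. -/
theorem exists_crossOver_form {A : Formula α} {Γ : List (Formula α)}
    (τ : List (Slice (Color α) (CGate α))) (hτ : SwapOnly τ) {y : List (Color α)}
    (hy : (control α).Typed τ (.fm A :: fw Γ) y) :
    ∃ X Y τ₁, SwapOnly τ₁ ∧ (control α).Typed τ₁ (fw Γ) (fw (X ++ Y)) ∧
      y = fw (X ++ A :: Y) ∧
      (control α).Conv (.fm A :: fw Γ) y τ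
        (whisker [.fm A] τ₁ [] ++ whisker [] (crossOver A X) (fw Y)) ∧
      ∀ i, trace τ i = if i < X.length then 1 + trace τ₁ i else if i = X.length then 0
        else 1 + trace τ₁ (i - 1) := by
  induction τ using List.reverseRecOn generalizing y with
  | nil =>
    cases hy
    exact ⟨[], Γ, [], swapOnly_nil, rfl, by simp,
      by simpa [crossOver] using (Conv.refl rfl : (control α).Conv (Color.fm A :: fw Γ) _ [] []),
      by intro i; simp only [trace, List.length_nil]; grind⟩
  | append_singleton τ s ih =>
    obtain ⟨a, g, b⟩ := s
    obtain ⟨B, C, hg⟩ := hτ ⟨a, g, b⟩ (by simp)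
    obtain rfl : g = .swap B C := hg
    obtain ⟨z, hz, hs⟩ := typed_append.1 hy
    obtain ⟨X, Y, τ₁, hτ₁, ht₁, rfl, hc, htr⟩ := ih (fun s hs => hτ s (by simp [hs])) hz
    obtain ⟨U, V, hU, rfl, rfl, rfl⟩ := typed_swap_inv hs
    have hc' := hc.append_right hs
    clear ih hc
    have htr' : ∀ i, trace (τ ++ [⟨fw U, .swap B C, fw V⟩]) i =
        trace τ (Equiv.swap U.length (U.length + 1) i) := by
      intro i; rw [trace_append]; simp [trace]
    simp only [htr, Equiv.swap_apply_def] at htr'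
    clear htr
    rcases List.append_eq_append_iff.1 hU with ⟨M, rfl, hM⟩ | ⟨M, rfl, hM⟩
    · -- `X` is a prefix of `U`
      rcases M with - | ⟨M, U'⟩
      -- The moved string is the left input of the new operator: it crosses one more string, and
      -- `τ₁` is unchanged.
      · obtain ⟨rfl, rfl⟩ := List.cons.inj hM
        refine ⟨X ++ [C], V, τ₁, hτ₁, by simpa using ht₁, by simp, ?_, ?_⟩
        · simpa [crossOver_append, crossOver] using hc'
        · intro i
          rw [htr']
          simp only [List.length_append, List.length_cons, List.length_nil]
          grind
      -- The new operator lies to the right of the moved string; interchange lifts it above all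
      -- crossings of that string, into `τ₁`.
      · obtain ⟨rfl, rfl⟩ := List.cons.inj hM
        have hs' : (control α).Typed [⟨fw (X ++ U'), .swap B C, fw V⟩] (fw (X ++ (U' ++ B :: C :: V)))
          (fw (X ++ (U' ++ C :: B :: V))) := typed_slice _ _ _ (by simp [CGate.dom]) (by simp [CGate.cod])
        refine ⟨X, U' ++ C :: B :: V, τ₁ ++ [⟨fw (X ++ U'), .swap B C, fw V⟩],
          hτ₁.append (swapOnly_swap _ _ _ _), ht₁.append hs', by simp, ?_, ?_⟩
        · have e := Conv.interchange (P := control α) (typed_crossOver A X)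
            ((typed_slice (fw U') (fw V) (CGate.swap B C) rfl rfl : (control α).Typed _ _ _))
          have e' := Conv.append_left (P := control α) (x := .fm A :: fw Γ)
            (by simpa [CGate.dom] using ht₁.whisker [.fm A] []) e
          refine (by simpa using hc' : (control α).Conv _ _ _ _).trans (by simpa [CGate.dom, CGate.cod] using e')
        · intro i
          rw [htr']
          simp only [trace_append, trace, Equiv.swap_apply_def,
            List.length_append, List.length_cons, length_fw]
          grind
    · -- `U` is a prefix of `X`
      rcases M with - | ⟨B', - | ⟨C', V'⟩⟩
      · obtain ⟨rfl, rfl⟩ := List.cons.inj hM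
        refine ⟨U ++ [C], V, τ₁, hτ₁, by simpa using ht₁, by simp, ?_, ?_⟩
        · simpa [crossOver_append, crossOver] using hc'
        · intro i
          rw [htr']
          simp only [List.length_append, List.length_cons, List.length_nil]
          grind
      -- The moved string is the right input of the new operator, which undoes the last crossing.
      · simp only [List.cons_append, List.nil_append, List.cons.injEq] at hM
        obtain ⟨rfl, rfl, rfl⟩ := hM
        refine ⟨U, B :: V, τ₁, hτ₁, by simpa using ht₁, by simp, ?_, ?_⟩
        · have e := Conv.append_left (P := control α)
            (φ := whisker [Color.fm C] τ₁ [] ++ whisker [] (crossOver C U) (fw (B :: V)))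
            (x := Color.fm C :: fw Γ) (Typed.append (y := Color.fm C :: fw (U ++ B :: V))
              (by simpa using ht₁.whisker [.fm C] [])
              (by simpa using (typed_crossOver C U).whisker [] (fw (B :: V))))
            ((conv_swap_swap C B).whisker (fw U) (fw V))
          refine (by simpa [crossOver_append, crossOver] using hc' : (control α).Conv _ _ _ _).trans
            (by simpa using e)
        · intro i
          rw [htr']
          simp only [List.length_append, List.length_cons, List.length_nil]
          grind
      -- Both inputs of the new operator have already been crossed by the moved string; Yang–Baxter
      -- lifts the operator through these crossings into `τ₁`.
      · simp only [List.cons_append, List.cons.injEq] at hM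
        obtain ⟨rfl, rfl, rfl⟩ := hM
        have hs' : (control α).Typed [⟨fw U, .swap B C, fw (V' ++ Y)⟩] (fw (U ++ B :: C :: V' ++ Y))
          (fw (U ++ C :: B :: V' ++ Y)) := typed_slice _ _ _ (by simp [CGate.dom]) (by simp [CGate.cod])
        refine ⟨U ++ C :: B :: V', Y, τ₁ ++ [⟨fw U, .swap B C, fw (V' ++ Y)⟩],
          hτ₁.append (swapOnly_swap _ _ _ _), ht₁.append hs', by simp, ?_, ?_⟩
        · have e := (crossOver_gate A (.swap B C) [B, C] [C, B] U V' rfl rfl (crossOver_swap A B C)).symm.whisker [] (fw Y)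
          have e' := Conv.append_left (P := control α) (x := .fm A :: fw Γ)
            (by simpa [CGate.dom] using ht₁.whisker [.fm A] []) e
          refine (by simpa using hc' : (control α).Conv _ _ _ _).trans (by simpa [CGate.dom, CGate.cod] using e')
        · intro i
          rw [htr']
          simp only [trace_append, trace, Equiv.swap_apply_def,
            List.length_append, List.length_cons, length_fw]
          grind

/-- Twisting diagrams that perform the same permutation are equal. -/
theorem conv_of_trace_eq {Γ : List (Formula α)} {τ τ' : List (Slice (Color α) (CGate α))}
    {y : List (Color α)} (hτ : SwapOnly τ) (hτ' : SwapOnly τ')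
    (ht : (control α).Typed τ (fw Γ) y) (ht' : (control α).Typed τ' (fw Γ) y)
    (h : ∀ i, trace τ i = trace τ' i) : (control α).Conv (fw Γ) y τ τ' := by
  induction Γ generalizing τ τ' y with
  | nil =>
    have aux : ∀ {τ : List (Slice (Color α) (CGate α))}, SwapOnly τ →
        (control α).Typed τ (fw []) y → τ = [] := by
      intro τ hτ ht
      rcases τ with - | ⟨⟨a, g, b⟩, τ⟩
      · rfl
      · obtain ⟨B, C, hg⟩ := hτ ⟨a, g, b⟩ (by simp)
        obtain rfl : g = .swap B C := hg
        simpa [CGate.dom] using ht.1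
    obtain rfl := aux hτ ht
    obtain rfl := aux hτ' ht'
    exact .refl ht
  | cons A Γ ih =>
    obtain ⟨X, Y, σ, hσ, hσt, hy, hc, htr⟩ := exists_crossOver_form τ hτ ht
    obtain ⟨X', Y', σ', hσ', hσt', hy', hc', htr'⟩ := exists_crossOver_form τ' hτ' ht'
    have key := fun i => (htr i).symm.trans ((h i).trans (htr' i))
    -- The final position of the first string is the only place where the trace is `0`, so the
    -- permutation determines the length of `X`.
    have hl : X.length = X'.length := by
      have := key X.length
      split_ifs at this <;> omega
    have hXY := fw_injective (hy.symm.trans hy')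
    obtain ⟨rfl, hYY⟩ := List.append_inj hXY hl
    obtain ⟨-, rfl⟩ := List.cons.inj hYY
    have htr₁ : ∀ i, trace σ i = trace σ' i := by
      intro i
      by_cases hi : i < X.length
      · have := key i
        simpa [hi] using this
      -- Beyond the moved string the positions of the remaining ones are shifted by one.
      · have := key (i + 1)
        simpa [show ¬ i + 1 < X.length by omega, show ¬ i + 1 = X.length by omega] using this
    have e := (ih hσ hσ' hσt hσt' htr₁).whisker [.fm A] []
    have e' := e.append_right (φ := whisker [] (crossOver A X) (fw Y)) (z := y)
      (by subst hy; simpa using (typed_crossOver A X).whisker [] (fw Y))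
    exact (hc.trans (by simpa using e')).trans hc'.symm

end MLLu

namespace MLLu
open Polygraph

/-! ### Rearrangements as functions on natural numbers -/

namespace Reorder
variable {F : Type u} {Γ Γ' Δ Δ' Θ : List F}

theorem length_eq (σ : Reorder Γ Δ) : Γ.length = Δ.length := by
  simpa using (Fintype.card_congr σ.toEquiv).symm

/-- The underlying permutation, extended by the identity to all natural numbers. -/
def fn (σ : Reorder Γ Δ) (i : ℕ) : ℕ :=
  if h : i < Δ.length then σ.toEquiv ⟨i, h⟩ else i

theorem fn_coe (σ : Reorder Γ Δ) (i : Fin Δ.length) : σ.fn i = σ.toEquiv i := by simp [fn]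

theorem fn_of_le (σ : Reorder Γ Δ) {i : ℕ} (h : Δ.length ≤ i) : σ.fn i = i := by
  simp [fn, Nat.not_lt.2 h]

theorem fn_lt (σ : Reorder Γ Δ) {i : ℕ} (h : i < Δ.length) : σ.fn i < Γ.length := by
  simp only [fn, h, dif_pos]; exact (σ.toEquiv ⟨i, h⟩).2

theorem ext_fn {σ τ : Reorder Γ Δ} (h : ∀ i, σ.fn i = τ.fn i) : σ = τ := by
  ext i
  rw [← fn_coe, ← fn_coe, h]

/-- Since `fn` is defined on all of `ℕ`, this identifies target lists through `List.ext_getElem?`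
without transport between index types. -/
theorem getElem?_eq (σ : Reorder Γ Δ) (i : ℕ) : Δ[i]? = Γ[σ.fn i]? := by
  by_cases h : i < Δ.length
  · have h1 := σ.get_eq ⟨i, h⟩
    have h2 := σ.fn_lt h
    rw [List.getElem?_eq_getElem h, List.getElem?_eq_getElem h2]
    simpa [fn, h] using h1
  · rw [fn_of_le _ (Nat.not_lt.1 h), List.getElem?_eq_none (Nat.not_lt.1 h),
      List.getElem?_eq_none (by have := σ.length_eq; omega)]

@[simp] theorem fn_ofEq (h : Γ = Δ) (i : ℕ) : (ofEq h).fn i = i := by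
  simp [fn, ofEq]

@[simp] theorem fn_refl (i : ℕ) : (refl Γ).fn i = i := fn_ofEq _ _

@[simp] theorem fn_trans (σ : Reorder Γ Δ) (τ : Reorder Δ Θ) (i : ℕ) :
    (σ.trans τ).fn i = σ.fn (τ.fn i) := by
  by_cases h : i < Θ.length
  · have h1 := τ.fn_lt h
    have h2 : τ.fn i = τ.toEquiv ⟨i, h⟩ := by simp [fn, h]
    simp [fn, h, trans]
  · rw [fn_of_le _ (Nat.not_lt.1 h), fn_of_le τ (Nat.not_lt.1 h), fn_of_le]
    have := τ.length_eq
    omega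

theorem split_inl_val (i : Fin Γ.length) : (split Γ Δ (.inl i) : ℕ) = i := by simp [split]
theorem split_inr_val (i : Fin Δ.length) : (split Γ Δ (.inr i) : ℕ) = Γ.length + i := by
  simp [split]

theorem fn_append (σ : Reorder Γ Γ') (τ : Reorder Δ Δ') (i : ℕ) :
    (σ.append τ).fn i = if i < Γ'.length then σ.fn i else Γ'.length + τ.fn (i - Γ'.length) := by
  by_cases h : i < (Γ' ++ Δ').length
  · obtain ⟨j, hj⟩ := (split Γ' Δ').surjective ⟨i, h⟩
    have e : (σ.append τ).fn i = (σ.append τ).toEquiv (split Γ' Δ' j) := by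
      rw [hj]; exact dif_pos h
    have hi : i = (split Γ' Δ' j : ℕ) := by rw [hj]
    rw [e]
    rcases j with j | j
    · rw [split_inl_val] at hi
      subst hi
      simp [append, split_inl_val, fn]
    · rw [split_inr_val] at hi
      subst hi
      have := σ.length_eq
      simp [append, split_inr_val, fn, this]
  · rw [fn_of_le _ (Nat.not_lt.1 h)]
    rw [List.length_append] at h
    rw [if_neg (by omega), fn_of_le τ (by omega)]
    omega

theorem fn_comm (i : ℕ) : (comm Γ Δ).fn i = if i < Δ.length then i + Γ.length else
    if i < Δ.length + Γ.length then i - Δ.length else i := by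
  by_cases h : i < (Δ ++ Γ).length
  · obtain ⟨j, hj⟩ := (split Δ Γ).surjective ⟨i, h⟩
    have e : (comm Γ Δ).fn i = (comm Γ Δ).toEquiv (split Δ Γ j) := by
      rw [hj]; exact dif_pos h
    have hi : i = (split Δ Γ j : ℕ) := by rw [hj]
    rw [e]
    rcases j with j | j
    · rw [split_inl_val] at hi
      subst hi
      simp [comm, split_inr_val, Nat.add_comm]
    · rw [split_inr_val] at hi
      subst hi
      simp [comm, split_inl_val]
  · rw [fn_of_le _ (Nat.not_lt.1 h)]
    rw [List.length_append] at h
    split_ifs <;> omega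

/-- Explicit arithmetic on positions: identities between composite exchanges become goals for
`omega` or `grind`. -/
theorem fn_block (Γ X Y Z : List F) {S T : List F} (hS : S = Γ ++ (X ++ Y) ++ Z)
    (hT : T = Γ ++ (Y ++ X) ++ Z) (i : ℕ) :
    (block Γ X Y Z hS hT).fn i = if i < Γ.length then i else
      if i < Γ.length + Y.length then i + X.length else
      if i < Γ.length + Y.length + X.length then i - Y.length else i := by
  simp only [block, fn_trans, fn_ofEq, fn_append, fn_refl, fn_comm, List.length_append]
  grind

end Reorder

variable {α : Type u}

/-! ### Existence and uniqueness of twisting diagrams for a rearrangement -/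

theorem SwapOnly.getElem? {τ : List (Slice (Color α) (CGate α))} (hτ : SwapOnly τ)
    {Γ : List (Formula α)} {y : List (Color α)} (h : (control α).Typed τ (fw Γ) y) :
    ∃ Δ, y = fw Δ ∧ ∀ i, Δ[i]? = Γ[trace τ i]? := by
  induction τ using List.reverseRecOn generalizing y with
  | nil => cases h; exact ⟨Γ, rfl, fun _ => rfl⟩
  | append_singleton τ s ih =>
    obtain ⟨z, hz, hs⟩ := typed_append.1 h
    obtain ⟨Δ, rfl, hΔ⟩ := ih (fun s hs => hτ s (by simp [hs])) hz
    obtain ⟨a, g, b⟩ := s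
    obtain ⟨B, C, hg⟩ := hτ ⟨a, g, b⟩ (by simp)
    obtain rfl : g = .swap B C := hg
    obtain ⟨U, V, rfl, rfl, rfl, rfl⟩ := typed_swap_inv hs
    refine ⟨_, rfl, fun i => ?_⟩
    rw [trace_append, ← hΔ]
    simp only [trace, length_fw, Equiv.swap_apply_def]
    grind

theorem trace_of_le {τ : List (Slice (Color α) (CGate α))} (hτ : SwapOnly τ)
    {Γ : List (Formula α)} {y : List (Color α)} (h : (control α).Typed τ (fw Γ) y) {i : ℕ}
    (hi : Γ.length ≤ i) : trace τ i = i := by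
  induction τ using List.reverseRecOn generalizing y with
  | nil => rfl
  | append_singleton τ s ih =>
    obtain ⟨z, hz, hs⟩ := typed_append.1 h
    have hτ' : SwapOnly τ := fun s hs => hτ s (by simp [hs])
    obtain ⟨Δ, rfl, hΔ⟩ := hτ'.getElem? hz
    have hi' := hΔ i
    rw [ih hτ' hz, List.getElem?_eq_none hi] at hi'
    obtain ⟨a, g, b⟩ := s
    obtain ⟨B, C, hg⟩ := hτ ⟨a, g, b⟩ (by simp)
    obtain rfl : g = .swap B C := hg
    obtain ⟨U, V, rfl, rfl, rfl, rfl⟩ := typed_swap_inv hs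
    rw [trace_append]
    -- Labels give the bound: position `i` is past the end of the source, hence also past the end of
    -- the word above the last operator.
    have : (U ++ B :: C :: V).length ≤ i := by simpa using hi'
    simp only [List.length_append, List.length_cons] at this
    simp only [trace, length_fw]
    rw [Equiv.swap_apply_of_ne_of_ne (by omega) (by omega)]
    exact ih hτ' hz

theorem realizes_iff {Γ Δ : List (Formula α)} {τ : List (Slice (Color α) (CGate α))}
    {σ : Reorder Γ Δ} : Realizes τ σ ↔
      SwapOnly τ ∧ (control α).Typed τ (fw Γ) (fw Δ) ∧ ∀ i, trace τ i = σ.fn i := by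
  refine and_congr_right fun h => and_congr_right fun ht => ⟨fun H i => ?_, fun H i => ?_⟩
  · by_cases hi : i < Δ.length
    · rw [← H ⟨i, hi⟩]; simp [Reorder.fn, hi]
    · rw [σ.fn_of_le (Nat.not_lt.1 hi), trace_of_le h ht]
      have := σ.length_eq
      omega
  · rw [H, σ.fn_coe]

/-- Adjacent transpositions generate the symmetric group as a monoid, and each of them is one
twisting operator. The list `Γ` varies in the induction because the second factor of a product
starts from permuted labels. -/
theorem exists_swaps_of_perm {n : ℕ} (π : Equiv.Perm (Fin n)) (Γ : List (Formula α))
    (hΓ : Γ.length = n) : ∃ τ y, SwapOnly τ ∧ (control α).Typed τ (fw Γ) y ∧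
      ∀ i : Fin n, trace τ i = π i := by
  rcases n with - | n
  · exact ⟨[], _, swapOnly_nil, rfl, fun i => i.elim0⟩
  have hπ : π ∈ Submonoid.closure
      (Set.range fun i : Fin n => Equiv.swap i.castSucc i.succ) := by
    rw [Equiv.Perm.mclosure_swap_castSucc_succ]; trivial
  induction hπ using Submonoid.closure_induction generalizing Γ with
  | mem π hπ =>
    obtain ⟨k, rfl⟩ := hπ
    have h1 : (k : ℕ) + 1 < Γ.length := by omega
    refine ⟨[⟨fw (Γ.take k), .swap Γ[(k : ℕ)] Γ[(k : ℕ) + 1], fw (Γ.drop (k + 2))⟩], _,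
      swapOnly_swap _ _ _ _, typed_slice _ _ _ ?_ rfl, fun i => ?_⟩
    · have e := List.take_append_drop (k : ℕ) Γ
      rw [List.drop_eq_getElem_cons (by omega), List.drop_eq_getElem_cons h1] at e
      exact (congrArg fw e).symm.trans (by rw [fw_append]; simp only [CGate.dom, List.append_assoc]; rfl)
    · have : min (k : ℕ) Γ.length = k := by omega
      simp only [trace, length_fw, List.length_take, this, Equiv.swap_apply_def, Fin.ext_iff]
      simp only [Fin.val_castSucc, Fin.val_succ]
      split_ifs <;> simp
  | one => exact ⟨[], _, swapOnly_nil, rfl, fun i => rfl⟩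
  | mul π π' _ _ ih ih' =>
    obtain ⟨τ, y, hτ, ht, h⟩ := ih Γ hΓ
    obtain ⟨Δ, rfl, hΔ⟩ := hτ.getElem? ht
    -- A trace only relates labels; the length of the intermediate list is recovered by looking up
    -- the positions `n` and `n + 1`.
    have hl : Δ.length = n + 1 := by
      apply le_antisymm
      · have := hΔ (n + 1)
        rw [trace_of_le hτ ht hΓ.le, List.getElem?_eq_none hΓ.le] at this
        simpa using this
      · have := hΔ n
        have hn := h (Fin.last n)
        rw [Fin.val_last] at hn
        rw [hn, List.getElem?_eq_getElem (l := Γ) (by have := (π (Fin.last n)).2; omega), List.getElem?_eq_some_iff] at this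
        exact this.1
    obtain ⟨τ', y', hτ', ht', h'⟩ := ih' Δ hl
    exact ⟨τ ++ τ', y', hτ.append hτ', ht.append ht', fun i => by
      rw [trace_append, h', h]; rfl⟩

theorem exists_realizes {Γ Δ : List (Formula α)} (σ : Reorder Γ Δ) :
    ∃ τ : List (Slice (Color α) (CGate α)), Realizes τ σ := by
  have hl := σ.length_eq
  obtain ⟨τ, y, hτ, ht, h⟩ := exists_swaps_of_perm
    (σ.toEquiv.trans (finCongr hl)) Γ hl
  obtain ⟨Δ', rfl, hΔ⟩ := hτ.getElem? ht
  have hf : ∀ i, trace τ i = σ.fn i := by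
    intro i
    by_cases hi : i < Δ.length
    · rw [h ⟨i, hi⟩]; simp [Reorder.fn, hi]
    · rw [σ.fn_of_le (Nat.not_lt.1 hi), trace_of_le hτ ht (by omega)]
  obtain rfl : Δ' = Δ := List.ext_getElem? fun i => by rw [hΔ, hf, σ.getElem?_eq]
  exact ⟨τ, realizes_iff.2 ⟨hτ, ht, hf⟩⟩

/-- A twisting diagram that performs a given rearrangement. -/
noncomputable def twist {Γ Δ : List (Formula α)} (σ : Reorder Γ Δ) :
    List (Slice (Color α) (CGate α)) := (exists_realizes σ).choose

theorem realizes_twist {Γ Δ : List (Formula α)} (σ : Reorder Γ Δ) : Realizes (twist σ) σ :=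
  (exists_realizes σ).choose_spec

theorem swapOnly_twist {Γ Δ : List (Formula α)} (σ : Reorder Γ Δ) : SwapOnly (twist σ) :=
  (realizes_iff.1 (realizes_twist σ)).1

theorem typed_twist {Γ Δ : List (Formula α)} (σ : Reorder Γ Δ) :
    (control α).Typed (twist σ) (fw Γ) (fw Δ) :=
  (realizes_iff.1 (realizes_twist σ)).2.1

@[simp] theorem trace_twist {Γ Δ : List (Formula α)} (σ : Reorder Γ Δ) (i : ℕ) :
    trace (twist σ) i = σ.fn i :=
  (realizes_iff.1 (realizes_twist σ)).2.2 i

theorem Realizes.conv {Γ Δ : List (Formula α)} {σ : Reorder Γ Δ}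
    {τ τ' : List (Slice (Color α) (CGate α))} (h : Realizes τ σ) (h' : Realizes τ' σ) :
    (control α).Conv (fw Γ) (fw Δ) τ τ' := by
  rw [realizes_iff] at h h'
  exact conv_of_trace_eq h.1 h'.1 h.2.1 h'.2.1 fun i => by rw [h.2.2, h'.2.2]

/-! ### Sliding a unary gate along crossings -/

/-- The strings `Δ` cross the strings `X` on their right, starting with the rightmost one. -/
def crossAll : List (Formula α) → List (Formula α) → List (Slice (Color α) (CGate α))
  | [], _ => []
  | a :: Δ, X => whisker [.fm a] (crossAll Δ X) [] ++ whisker [] (crossOver a X) (fw Δ)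

theorem swapOnly_crossAll (Δ X : List (Formula α)) : SwapOnly (crossAll Δ X) := by
  induction Δ with
  | nil => exact swapOnly_nil
  | cons a Δ ih => exact (ih.whisker _ _).append ((swapOnly_crossOver a X).whisker _ _)

theorem typed_crossAll (Δ X : List (Formula α)) :
    (control α).Typed (crossAll Δ X) (fw Δ ++ fw X) (fw X ++ fw Δ) := by
  induction Δ with
  | nil => exact (List.append_nil (fw X)).symm
  | cons a Δ ih =>
    exact Typed.append (by simpa using ih.whisker [.fm a] [])
      (by simpa using (typed_crossOver a X).whisker [] (fw Δ))

theorem trace_crossAll (Δ X : List (Formula α)) (i : ℕ) :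
    trace (crossAll Δ X) i = if i < X.length then i + Δ.length else
      if i < X.length + Δ.length then i - X.length else i := by
  induction Δ generalizing i with
  | nil => simp only [crossAll, trace, List.length_nil]; grind
  | cons a Δ ih =>
    simp only [crossAll, trace_append, trace_whisker, trace_crossOver, ih, List.length_cons,
      List.length_nil]
    grind

/-- `crossAll` is built from `crossOver`, so an induction on `Δ` lets the gate pass one string at a
time by `crossOver_un`. -/
theorem crossAll_un (Δ : List (Formula α)) (r : UnRule α) :
    (control α).Conv (fw Δ ++ fw r.act) (fw [r.prin] ++ fw Δ)
      (⟨fw Δ, .un r, []⟩ :: crossAll Δ [r.prin]) (crossAll Δ r.act ++ [⟨[], .un r, fw Δ⟩]) := by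
  induction Δ with
  | nil => exact .refl ⟨by simp [CGate.dom], rfl⟩
  | cons a Δ ih =>
    have e1 := (ih.whisker [.fm a] []).append_right
      (φ := whisker [] (crossOver a [r.prin]) (fw Δ)) (z := fw [r.prin] ++ fw (a :: Δ))
      (by simpa using (typed_crossOver a [r.prin]).whisker [] (fw Δ))
    have e2 := Conv.append_left (P := control α) (x := fw (a :: Δ) ++ fw r.act)
      (φ := whisker [.fm a] (crossAll Δ r.act) [])
      (by simpa using (typed_crossAll Δ r.act).whisker [.fm a] [])
      ((crossOver_un a r).whisker [] (fw Δ))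
    exact (by simpa [crossAll] using e1 : (control α).Conv _ _ _ _).trans
      (by simpa [crossAll] using e2)

/-- A unary gate in the middle of a sequent, moved to the end by twisting operators. -/
theorem conv_unaryAt (Γ Δ : List (Formula α)) (r : UnRule α)
    {τ τ' : List (Slice (Color α) (CGate α))}
    (h : Realizes τ (.block Γ r.act Δ [] : Reorder (Γ ++ r.act ++ Δ) (Γ ++ Δ ++ r.act)))
    (h' : Realizes τ' (.block Γ Δ [r.prin] [] : Reorder (Γ ++ Δ ++ [r.prin]) (Γ ++ [r.prin] ++ Δ))) :
    (control α).Conv (fw (Γ ++ r.act ++ Δ)) (fw (Γ ++ [r.prin] ++ Δ))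
      (τ ++ ⟨fw (Γ ++ Δ), .un r, []⟩ :: τ') [⟨fw Γ, .un r, fw Δ⟩] := by
  rw [realizes_iff] at h h'
  -- By coherence the lower twisting diagram, whatever it is, may be taken to be `crossAll`, through
  -- which the gate can slide.
  have e1 : (control α).Conv (fw (Γ ++ Δ ++ [r.prin])) (fw (Γ ++ [r.prin] ++ Δ)) τ'
      (whisker (fw Γ) (crossAll Δ [r.prin]) []) :=
    conv_of_trace_eq h'.1 ((swapOnly_crossAll _ _).whisker _ _) h'.2.1
      (by simpa using (typed_crossAll Δ [r.prin]).whisker (fw Γ) []) fun i => by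
        rw [h'.2.2, Reorder.fn_block, trace_whisker, trace_crossAll]
        simp only [length_fw]
        grind
  -- After the slide the upper twisting diagram is followed by a `crossAll` that performs the
  -- inverse permutation.
  have e2 : (control α).Conv (fw (Γ ++ r.act ++ Δ)) (fw (Γ ++ r.act ++ Δ))
      (τ ++ whisker (fw Γ) (crossAll Δ r.act) []) [] :=
    conv_of_trace_eq (h.1.append ((swapOnly_crossAll _ _).whisker _ _)) swapOnly_nil
      (h.2.1.append (by simpa using (typed_crossAll Δ r.act).whisker (fw Γ) [])) rfl fun i => by
        rw [trace_append, h.2.2, Reorder.fn_block, trace_whisker, trace_crossAll]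
        simp only [length_fw, trace]
        grind
  have e3 := Conv.append_left (P := control α) h.2.1
    (Conv.append_left (φ := [⟨fw (Γ ++ Δ), CGate.un r, []⟩])
      (typed_slice _ _ _ (by simp [CGate.dom]) (by simp [CGate.cod])) e1)
  have e4 := Conv.append_left (P := control α) (z := fw (Γ ++ [r.prin] ++ Δ)) h.2.1
    (by simpa using (crossAll_un Δ r).whisker (fw Γ) [])
  have e5 := e2.append_right (φ := [⟨fw Γ, CGate.un r, fw Δ⟩]) (z := fw (Γ ++ [r.prin] ++ Δ))
    (typed_slice _ _ _ (by simp [CGate.dom]) (by simp [CGate.cod]))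
  exact ((by simpa using e3 : (control α).Conv _ _ _ _).trans (by simpa using e4)).trans
    (by simpa using e5)

/-! ### The canonical diagram of a derivation -/

theorem Represents.typed {Γ : List (Formula α)} {φ : List (Slice (Color α) (CGate α))}
    {d : Deriv Γ} (h : Represents φ d) : (control α).Typed φ [] (blk Γ) := by
  induction h with
  | ax A => exact ⟨rfl, rfl⟩
  | one => exact ⟨rfl, rfl⟩
  | unary r h ih =>
    exact ih.append (typed_slice _ _ _ (by simp [blk, CGate.dom]) (by simp [blk, CGate.cod]))
  | unaryAt Γ r Δ h ih =>
    exact ih.append (typed_slice _ _ _ (by simp [blk, CGate.dom]) (by simp [blk, CGate.cod]))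
  | @binary Γ Δ _ _ b d e h h' ih ih' =>
    exact (ih.append (by simpa using ih'.whisker (blk (Γ ++ [b.left])) [])).append
      (typed_slice _ _ _ (by simp [blk, CGate.dom]) (by simp [blk, CGate.cod]))
  | ex h hτ ih => exact ih.append (by simpa [blk] using hτ.2.1.whisker [.L] [.R])
  | same h h' ih => exact (SameDiagram.typed_iff h').1 ih

/-- A diagram that represents the derivation. -/
noncomputable def diag : {Γ : List (Formula α)} → Deriv Γ → List (Slice (Color α) (CGate α))
  | _, .ax A => [⟨[], .ax A, []⟩]
  | _, .one => [⟨[], .one, []⟩]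
  | _, .unary (Γ := Γ) r d => diag d ++ [⟨.L :: fw Γ, .un r, [.R]⟩]
  | _, .binary (Γ := Γ) (Δ := Δ) b d e =>
    diag d ++ whisker (blk (Γ ++ [b.left])) (diag e) [] ++ [⟨.L :: fw Γ, .bin b, fw Δ ++ [.R]⟩]
  | _, .ex σ d => diag d ++ whisker [.L] (twist σ) [.R]

theorem represents_diag {Γ : List (Formula α)} (d : Deriv Γ) : Represents (diag d) d := by
  induction d with
  | ax A => exact .ax A
  | one => exact .one
  | unary r d ih => exact .unary r ih
  | binary b d e ih ih' => exact .binary b ih ih'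
  | ex σ d ih => exact .ex ih (realizes_twist σ)

theorem typed_diag {Γ : List (Formula α)} (d : Deriv Γ) :
    (control α).Typed (diag d) [] (blk Γ) := (represents_diag d).typed

/-- A derivation has only one representation in the category presented by the control
polygraph. -/
theorem Represents.conv_diag {Γ : List (Formula α)} {φ : List (Slice (Color α) (CGate α))}
    {d : Deriv Γ} (h : Represents φ d) : (control α).Conv [] (blk Γ) φ (diag d) := by
  induction h with
  | ax A => exact .refl (Represents.ax A).typed
  | one => exact .refl Represents.one.typed
  | unary r h ih =>
    exact ih.append_right
      (typed_slice _ _ _ (by simp [blk, CGate.dom]) (by simp [blk, CGate.cod]))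
  | @unaryAt _ Γ r Δ d h ih =>
    have e := (conv_unaryAt Γ Δ r (realizes_twist _) (realizes_twist _)).symm.whisker [.L] [.R]
    have e' := ih.append (by simpa [blk] using e)
    simpa [diag, Deriv.unaryAt, blk] using e'
  | @binary Γ Δ φ ψ b d e h h' ih ih' =>
    exact (ih.append (by simpa using ih'.whisker (blk (Γ ++ [b.left])) [])).append_right
      (typed_slice _ _ _ (by simp [blk, CGate.dom]) (by simp [blk, CGate.cod]))
  | ex h hτ ih => exact ih.append (by simpa [blk] using (hτ.conv (realizes_twist _)).whisker [.L] [.R])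
  | same h h' ih => exact (Conv.of_sameDiagram h' h.typed).symm.trans ih

end MLLu

namespace MLLu
open Polygraph

/-! ### Interchange inside a larger diagram -/

namespace Polygraph

/-- The equations `hl` and `hr` leave it to the caller to bring composites into shape, and typing is
only asked of the left side: the word below `χ` is read off the first slice of `φ`. If `φ` is empty
no such slice exists, but then both sides are the same list. -/
theorem conv_interchange_ctx {P : Polygraph.{u, v}} {p q x x' y y' : List P.Color}
    {χ χ' φ ψ l r : List (Slice P.Color P.Gate)} (a b c : List P.Color)
    (hφ : P.Typed φ x x') (hψ : P.Typed ψ y y')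
    (hl : l = χ ++ whisker a φ (b ++ y ++ c) ++ whisker (a ++ x' ++ b) ψ c ++ χ')
    (hr : r = χ ++ whisker (a ++ x ++ b) ψ c ++ whisker a φ (b ++ y' ++ c) ++ χ')
    (ht : P.Typed l p q) : P.Conv p q l r := by
  subst hl hr
  have e := (Conv.interchange hφ (hψ.whisker b [])).whisker a c
  rcases φ with - | ⟨s, φ⟩
  · cases hφ
    simpa using Conv.refl ht
  · rw [List.append_assoc, List.append_assoc, List.append_assoc] at ht
    obtain ⟨w, hχ, ht⟩ := typed_append.1 ht
    rw [← List.append_assoc] at ht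
    obtain ⟨w', ht, ht'⟩ := typed_append.1 ht
    have hw : w = a ++ (x ++ (b ++ y ++ [])) ++ c := by
      obtain ⟨h, -⟩ := ht
      obtain ⟨rfl, -⟩ := hφ
      simpa using h
    subst hw
    have hw' := ht.unique (by simpa using e.typed_left)
    subst hw'
    have e' := (Conv.append_left hχ e).append_right (z := q) (φ := χ') (by simpa using ht')
    simpa using e'

/-- Here `ψ` comes first, so its first slice fixes the word below `χ`. -/
theorem conv_interchange_ctx' {P : Polygraph.{u, v}} {p q x x' y y' : List P.Color}
    {χ χ' φ ψ l r : List (Slice P.Color P.Gate)} (a b c : List P.Color)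
    (hφ : P.Typed φ x x') (hψ : P.Typed ψ y y')
    (hl : l = χ ++ whisker (a ++ x ++ b) ψ c ++ whisker a φ (b ++ y' ++ c) ++ χ')
    (hr : r = χ ++ whisker a φ (b ++ y ++ c) ++ whisker (a ++ x' ++ b) ψ c ++ χ')
    (ht : P.Typed l p q) : P.Conv p q l r := by
  subst hl hr
  have e := ((Conv.interchange hφ (hψ.whisker b [])).whisker a c).symm
  rcases ψ with - | ⟨s, ψ⟩
  · cases hψ
    simpa using Conv.refl ht
  · rw [List.append_assoc, List.append_assoc, List.append_assoc] at ht
    obtain ⟨w, hχ, ht⟩ := typed_append.1 ht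
    rw [← List.append_assoc] at ht
    obtain ⟨w', ht, ht'⟩ := typed_append.1 ht
    have hw : w = a ++ (x ++ (b ++ y ++ [])) ++ c := by
      obtain ⟨h, -⟩ := ht
      obtain ⟨rfl, -⟩ := hψ
      simpa using h
    subst hw
    have hw' := ht.unique (by simpa using e.typed_left)
    subst hw'
    have e' := (Conv.append_left hχ e).append_right (z := q) (φ := χ') (by simpa using ht')
    simpa using e'

end Polygraph

variable {α : Type u}

@[simp] theorem incl_append (φ ψ : List (Slice (Color α) (CGate α))) :
    incl (φ ++ ψ) = incl φ ++ incl ψ := List.map_append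

@[simp] theorem incl_nil : incl ([] : List (Slice (Color α) (CGate α))) = [] := rfl

@[simp] theorem incl_cons (s : Slice (Color α) (CGate α)) (φ : List (Slice (Color α) (CGate α))) :
    incl (s :: φ) = ⟨s.left, .ctrl s.gate, s.right⟩ :: incl φ := rfl

theorem incl_whisker (a b : List (Color α)) (φ : List (Slice (Color α) (CGate α))) :
    incl (whisker a φ b) = whisker a (incl φ) b := by
  simp [incl, whisker]

theorem incl_interchange {l r : List (Slice (Color α) (CGate α))}
    (h : (control α).Interchange l r) : (full α).Interchange (incl l) (incl r) := by
  obtain ⟨χ, χ', g, h, a, b, c⟩ := h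
  simpa [FGate.dom, FGate.cod] using
    Interchange.mk (P := full α) (incl χ) (incl χ') (.ctrl g) (.ctrl h) a b c

theorem incl_rewrite {l r : List (Slice (Color α) (CGate α))}
    (h : (control α).Rewrite l r) : (full α).Rewrite (incl l) (incl r) := by
  obtain ⟨χ, χ', l, r, a, b, x, y, hl, hr, h⟩ := h
  simpa [incl_whisker] using Rewrite.mk (P := full α) (incl χ) (incl χ') _ _ a b x y
    (typed_incl _ _ _ hl) (typed_incl _ _ _ hr) (.control h)

theorem conv_incl {x y : List (Color α)} {l r : List (Slice (Color α) (CGate α))}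
    (h : (control α).Conv x y l r) : (full α).Conv x y (incl l) (incl r) := by
  obtain ⟨hl, hr, h⟩ := h
  refine ⟨typed_incl _ _ _ hl, typed_incl _ _ _ hr, ?_⟩
  exact congrArg (Quot.map (ra := fun φ ψ : (control α).Diagram x y =>
      (control α).Interchange φ.slices ψ.slices ∨ (control α).Rewrite φ.slices ψ.slices)
    (rb := fun φ ψ : (full α).Diagram x y =>
      (full α).Interchange φ.slices ψ.slices ∨ (full α).Rewrite φ.slices ψ.slices) toFull
    (fun φ ψ h => h.imp incl_interchange incl_rewrite)) h

theorem realizes_of_trace {Γ Δ : List (Formula α)} {σ : Reorder Γ Δ}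
    {τ : List (Slice (Color α) (CGate α))} (hs : SwapOnly τ)
    (ht : (control α).Typed τ (fw Γ) (fw Δ)) (h : ∀ i, trace τ i = σ.fn i) : Realizes τ σ :=
  realizes_iff.2 ⟨hs, ht, h⟩

theorem realizes_nil {Γ Δ : List (Formula α)} (h : Γ = Δ) : Realizes [] (Reorder.ofEq h) :=
  realizes_of_trace swapOnly_nil (congrArg fw h) fun i => by simp [trace]

theorem Realizes.trans {Γ Δ Θ : List (Formula α)} {σ : Reorder Γ Δ} {σ' : Reorder Δ Θ}
    {τ τ' : List (Slice (Color α) (CGate α))} (h : Realizes τ σ) (h' : Realizes τ' σ') :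
    Realizes (τ ++ τ') (σ.trans σ') := by
  rw [realizes_iff] at *
  exact ⟨h.1.append h'.1, h.2.1.append h'.2.1, fun i => by
    rw [trace_append, h'.2.2, h.2.2, Reorder.fn_trans]⟩

theorem Realizes.append_refl {Γ Γ' : List (Formula α)} {σ : Reorder Γ Γ'}
    {τ : List (Slice (Color α) (CGate α))} (h : Realizes τ σ) (X : List (Formula α)) :
    Realizes (whisker [] τ (fw X)) (σ.append (.refl X)) := by
  rw [realizes_iff] at *
  refine ⟨h.1.whisker _ _, by simpa using h.2.1.whisker [] (fw X), fun i => ?_⟩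
  rw [trace_whisker, Reorder.fn_append, h.2.2]
  by_cases hi : i < Γ'.length
  · simp [hi]
  · simp [hi, σ.fn_of_le (Nat.not_lt.1 hi)]; omega

theorem Realizes.refl_append {Γ Γ' : List (Formula α)} {σ : Reorder Γ Γ'}
    {τ : List (Slice (Color α) (CGate α))} (h : Realizes τ σ) (X : List (Formula α)) :
    Realizes (whisker (fw X) τ []) (Reorder.append (.refl X) σ) := by
  rw [realizes_iff] at *
  refine ⟨h.1.whisker _ _, by simpa using h.2.1.whisker (fw X) [], fun i => ?_⟩
  rw [trace_whisker, Reorder.fn_append, h.2.2]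
  simp

theorem Represents.recast {Γ Δ : List (Formula α)} {φ : List (Slice (Color α) (CGate α))}
    {d : Deriv Γ} (h : Represents φ d) (e : Γ = Δ) : Represents φ (d.recast e) := by
  simpa [Deriv.recast] using Represents.ex h (realizes_nil e)

/-! ### Generators of the equivalence that hold in the control polygraph -/

/-- The diagrams of two derivations are equal in the category presented by the control
polygraph. -/
def DiagConv {Γ : List (Formula α)} (d d' : Deriv Γ) : Prop :=
  (control α).Conv [] (blk Γ) (diag d) (diag d')

theorem typed_gate (g : CGate α) : (control α).Typed [⟨[], g, []⟩] g.dom g.cod :=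
  typed_slice _ _ _ (by simp) (by simp)

/-- Representations are unique up to conversion, so two derivations may be compared on any
representatives, for instance with explicit crossings in place of `twist`. -/
theorem Represents.conv_of {Γ : List (Formula α)} {φ φ' : List (Slice (Color α) (CGate α))}
    {d d' : Deriv Γ} (h : Represents φ d) (h' : Represents φ' d')
    (hc : (control α).Conv [] (blk Γ) φ φ') : DiagConv d d' :=
  (h.conv_diag.symm.trans hc).trans h'.conv_diag

theorem conv_ex_unary {Γ Γ' : List (Formula α)} (ρ : Reorder Γ Γ') (r : UnRule α)
    (d : Deriv (Γ ++ r.act)) : DiagConv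
      (.unary r (.ex (ρ.append (.refl r.act)) d))
      (.ex (ρ.append (.refl [r.prin])) (.unary r d)) := by
  have h := Represents.unary r (.ex (represents_diag d) ((realizes_twist ρ).append_refl r.act))
  have h' := Represents.ex (.unary r (represents_diag d)) ((realizes_twist ρ).append_refl [r.prin])
  exact h.conv_of h' (conv_interchange_ctx (χ := diag d) (χ' := []) [.L] [] [.R] (typed_twist ρ)
    (typed_gate (.un r)) (by simp [CGate.dom]) (by simp [CGate.cod]) h.typed)

theorem conv_ex_binary {Γ Γ' Δ Δ' : List (Formula α)} (ρ : Reorder Γ Γ') (τ : Reorder Δ Δ')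
    (b : BinRule α) (d : Deriv (Γ ++ [b.left])) (e : Deriv (b.right :: Δ)) :
    DiagConv
      (.binary b (.ex (ρ.append (.refl [b.left])) d)
          (.ex (Reorder.append (.refl [b.right]) τ) e))
      (.ex ((ρ.append (.refl b.prin)).append τ) (.binary b d e)) := by
  have h := Represents.binary b (.ex (represents_diag d) ((realizes_twist ρ).append_refl [b.left]))
    (.ex (represents_diag e) ((realizes_twist τ).refl_append [b.right]))
  -- The exchange of both contexts is drawn as two separate twisting diagrams, so that each can
  -- slide to its own premise.
  have hρτ : Realizes (whisker [] (twist ρ) (fw (b.prin ++ Δ)) ++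
      whisker (fw (Γ' ++ b.prin)) (twist τ) []) ((ρ.append (.refl b.prin)).append τ) := by
    refine realizes_of_trace (((swapOnly_twist ρ).whisker _ _).append
      ((swapOnly_twist τ).whisker _ _)) (Typed.append (y := fw (Γ' ++ b.prin ++ Δ))
        (by simpa using (typed_twist ρ).whisker [] (fw (b.prin ++ Δ)))
        (by simpa using (typed_twist τ).whisker (fw (Γ' ++ b.prin)) [])) fun i => ?_
    have := ρ.fn_of_le (i := i)
    have h1 := ρ.fn_of_le (i := (Γ' ++ b.prin).length + τ.fn (i - (Γ' ++ b.prin).length))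
    simp only [trace_append, trace_whisker, trace_twist, Reorder.fn_append, Reorder.fn_refl,
      length_fw, List.length_nil, List.length_append] at *
    grind
  have h' := Represents.ex (.binary b (represents_diag d) (represents_diag e)) hρτ
  -- Three slides: the crossings of `ρ` go below the right premise, those of `τ` below the gate,
  -- then those of `ρ` below the gate.
  have c1 := conv_interchange_ctx (P := control α) (χ := diag d)
      (χ' := whisker (blk (Γ' ++ [b.left])) (whisker [.L] (whisker (fw [b.right]) (twist τ) []) [.R]) []
        ++ [⟨.L :: fw Γ', .bin b, fw Δ' ++ [.R]⟩]) [.L] (fw [b.left] ++ [.R]) [] (typed_twist ρ)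
        (typed_diag e) (by simp [blk]) rfl h.typed
  have c2 := conv_interchange_ctx' (P := control α)
      (χ := diag d ++ whisker (blk (Γ ++ [b.left])) (diag e) [] ++
        whisker [.L] (twist ρ) (.fm b.left :: .R :: blk (b.right :: Δ)))
      (χ' := []) (.L :: fw Γ') [] [.R]
      (typed_gate (.bin b)) (typed_twist τ) (by simp [blk, CGate.dom]) rfl
      c1.typed_right
  have c3 := conv_interchange_ctx (P := control α)
      (χ := diag d ++ whisker (blk (Γ ++ [b.left])) (diag e) [])
      (χ' := whisker (.L :: fw (Γ' ++ b.prin)) (twist τ) [.R]) [.L] [] (fw Δ ++ [.R])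
      (typed_twist ρ) (typed_gate (.bin b)) (by simp [blk, CGate.dom, CGate.cod])
      rfl c2.typed_right
  refine h.conv_of h' (c1.trans (c2.trans (c3.trans (.of_eq c3.typed_right ?_))))
  simp [blk, CGate.cod]

theorem conv_ex_ax (A : Formula α) : DiagConv
    (.ex (.comm [A] [A.neg]) (.ax A))
    ((Deriv.ax A.neg).recast (by simp [Formula.neg_neg])) := by
  have hs : Realizes [⟨[], .swap A A.neg, []⟩] (.comm [A] [A.neg]) :=
    realizes_of_trace (swapOnly_swap _ _ _ _) (typed_slice _ _ _ (by simp [CGate.dom])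
      (by simp [CGate.cod])) fun i => by
        simp only [trace, Reorder.fn_comm, Equiv.swap_apply_def, List.length_cons, List.length_nil]
        grind
  have h := Represents.ex (.ax A) hs
  have h' := (Represents.ax A.neg).recast (Δ := [A.neg, A]) (by simp [Formula.neg_neg])
  exact h.conv_of h' (.of_cell (P := control α) (.ax_swap A) h.typed h'.typed)

theorem conv_unary_unary (Γ Δ Θ : List (Formula α)) (r s : UnRule α)
    (d : Deriv (Γ ++ r.act ++ Δ ++ s.act ++ Θ)) :
    DiagConv
      (.unaryAt (Γ ++ [r.prin] ++ Δ) s Θ (Deriv.unaryAt Γ r (Δ ++ s.act ++ Θ) d.recast).recast)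
      (Deriv.unaryAt Γ r (Δ ++ [s.prin] ++ Θ)
        (Deriv.unaryAt (Γ ++ r.act ++ Δ) s Θ d).recast).recast := by
  have h := Represents.unaryAt (Γ ++ [r.prin] ++ Δ) s Θ
    ((Represents.unaryAt Γ r (Δ ++ s.act ++ Θ) ((represents_diag d).recast (by simp))).recast
      (by simp))
  have h' := (Represents.unaryAt Γ r (Δ ++ [s.prin] ++ Θ)
    ((Represents.unaryAt (Γ ++ r.act ++ Δ) s Θ (represents_diag d)).recast (by simp))).recast
      (Δ := Γ ++ [r.prin] ++ Δ ++ [s.prin] ++ Θ) (by simp)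
  exact h.conv_of h' (conv_interchange_ctx (χ := diag d) (χ' := []) (.L :: fw Γ) (fw Δ)
    (fw Θ ++ [.R]) (typed_gate (.un r))
    (typed_gate (.un s)) (by simp [CGate.dom, CGate.cod])
    (by simp [CGate.dom, CGate.cod]) h.typed)

theorem conv_unary_right (Δ Γ Θ : List (Formula α)) (b : BinRule α) (r : UnRule α)
    (d : Deriv (Δ ++ [b.left])) (e : Deriv (b.right :: (Γ ++ r.act ++ Θ))) :
    DiagConv
      (.unaryAt (Δ ++ b.prin ++ Γ) r Θ (Deriv.binary b d e).recast)
      (Deriv.binary b d (Deriv.unaryAt (b.right :: Γ) r Θ e.recast).recast :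
          Deriv (Δ ++ b.prin ++ (Γ ++ [r.prin] ++ Θ))).recast := by
  have h := Represents.unaryAt (Δ ++ b.prin ++ Γ) r Θ
    ((Represents.binary b (represents_diag d) (represents_diag e)).recast (by simp))
  have h' := (Represents.binary (Δ := Γ ++ [r.prin] ++ Θ) b (represents_diag d)
    ((Represents.unaryAt (b.right :: Γ) r Θ ((represents_diag e).recast (by simp))).recast
      (by simp))).recast (Δ := Δ ++ b.prin ++ Γ ++ [r.prin] ++ Θ) (by simp)
  exact h.conv_of h' (conv_interchange_ctx
    (χ := diag d ++ whisker (blk (Δ ++ [b.left])) (diag e) []) (χ' := []) (.L :: fw Δ) (fw Γ)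
    (fw Θ ++ [.R]) (typed_gate (.bin b))
    (typed_gate (.un r)) (by simp [CGate.dom, CGate.cod])
    (by simp [blk, CGate.dom, CGate.cod]) h.typed)

theorem conv_unary_left (Γ Θ Δ : List (Formula α)) (b : BinRule α) (r : UnRule α)
    (d : Deriv (Γ ++ r.act ++ Θ ++ [b.left])) (e : Deriv (b.right :: Δ)) :
    DiagConv
      (.unaryAt Γ r (Θ ++ b.prin ++ Δ) (Deriv.binary b d e).recast)
      (Deriv.binary b ((Deriv.unaryAt Γ r (Θ ++ [b.left]) d.recast).recast :
          Deriv (Γ ++ [r.prin] ++ Θ ++ [b.left])) e).recast := by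
  have h := Represents.unaryAt Γ r (Θ ++ b.prin ++ Δ)
    ((Represents.binary b (represents_diag d) (represents_diag e)).recast (by simp))
  have h' := (Represents.binary (Γ := Γ ++ [r.prin] ++ Θ) b
    ((Represents.unaryAt Γ r (Θ ++ [b.left]) ((represents_diag d).recast (by simp))).recast
      (by simp)) (represents_diag e)).recast (Δ := Γ ++ [r.prin] ++ (Θ ++ b.prin ++ Δ)) (by simp)
  -- The left premise is drawn above the right one, so the unary gate has to climb past the binary
  -- gate and then past all of `diag e`.
  have c1 := conv_interchange_ctx' (P := control α)
    (χ := diag d ++ whisker (blk (Γ ++ r.act ++ Θ ++ [b.left])) (diag e) []) (χ' := [])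
    (.L :: fw Γ) (fw Θ) (fw Δ ++ [.R]) (typed_gate (.un r))
    (typed_gate (.bin b)) (by simp [CGate.dom, CGate.cod]) rfl h.typed
  have c2 := conv_interchange_ctx' (P := control α)
    (χ := diag d) (χ' := [⟨.L :: fw (Γ ++ [r.prin] ++ Θ), .bin b, fw Δ ++ [.R]⟩])
    (.L :: fw Γ) (fw (Θ ++ [b.left]) ++ [.R]) [] (typed_gate (.un r))
    (typed_diag e) (by simp [blk, CGate.dom, CGate.cod]) rfl c1.typed_right
  exact h.conv_of h' (c1.trans (c2.trans (.of_eq c2.typed_right (by simp [blk, CGate.cod]))))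

theorem conv_binary_mid (Γ Θ Δ : List (Formula α)) (b c : BinRule α)
    (d₁ : Deriv (Γ ++ [b.left])) (d₂ : Deriv (b.right :: (Θ ++ [c.left])))
    (d₃ : Deriv (c.right :: Δ)) :
    DiagConv
      (.binary c ((Deriv.binary b d₁ d₂).recast : Deriv (Γ ++ b.prin ++ Θ ++ [c.left])) d₃)
      (Deriv.binary b d₁
        ((Deriv.binary c (d₂.recast : Deriv (b.right :: Θ ++ [c.left])) d₃).recast :
          Deriv (b.right :: (Θ ++ c.prin ++ Δ)))).recast := by
  have h := Represents.binary (Γ := Γ ++ b.prin ++ Θ) c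
    ((Represents.binary b (represents_diag d₁) (represents_diag d₂)).recast (by simp))
    (represents_diag d₃)
  have h' := (Represents.binary (Δ := Θ ++ c.prin ++ Δ) b (represents_diag d₁)
    ((Represents.binary (Γ := b.right :: Θ) c ((represents_diag d₂).recast (by simp))
      (represents_diag d₃)).recast (by simp))).recast (Δ := Γ ++ b.prin ++ Θ ++ c.prin ++ Δ)
        (by simp)
  -- The gate `b` sinks below the third premise and then below the gate `c`.
  have c1 := conv_interchange_ctx (P := control α)
    (χ := diag d₁ ++ whisker (blk (Γ ++ [b.left])) (diag d₂) [])
    (χ' := [⟨.L :: fw (Γ ++ b.prin ++ Θ), .bin c, fw Δ ++ [.R]⟩])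
    (.L :: fw Γ) (fw (Θ ++ [c.left]) ++ [.R]) [] (typed_gate (.bin b))
    (typed_diag d₃) (by simp [blk, CGate.cod]) rfl h.typed
  have c2 := conv_interchange_ctx (P := control α)
    (χ := diag d₁ ++ whisker (blk (Γ ++ [b.left])) (diag d₂) [] ++
      whisker (blk (Γ ++ [b.left]) ++ blk (b.right :: (Θ ++ [c.left]))) (diag d₃) []) (χ' := [])
    (.L :: fw Γ) (fw Θ) (fw Δ ++ [.R]) (typed_gate (.bin b))
    (typed_gate (.bin c)) (by simp [blk, CGate.dom, CGate.cod]) rfl c1.typed_right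
  exact h.conv_of h' (c1.trans (c2.trans (.of_eq c2.typed_right
    (by simp [blk, CGate.dom, CGate.cod]))))

/-! ### Termination of the control polygraph -/

/-- The values carried by the outputs of a gate, in terms of the values carried by its inputs. -/
def CGate.values : CGate α → List ℕ → List ℕ
  | .ax _, _ => [1, 1, 1, 1]
  | .one, _ => [1, 1, 1]
  | .un _, l => [l.sum + 1]
  | .bin b, _ => List.replicate b.prin.length 1
  | .swap _ _, l => [l.getD 1 1 * 2 ^ l.getD 0 1, l.getD 0 1]

/-- The heat produced by a gate, in terms of the values carried by its inputs. -/
def CGate.heat : CGate α → List ℕ → ℕ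
  | .swap _ _, l => l.getD 1 1 * (2 ^ l.getD 0 1 - 1)
  | _, _ => 0

/-- The values carried by the strings below an elementary diagram. -/
def sliceValues (s : Slice (Color α) (CGate α)) (w : List ℕ) : List ℕ :=
  w.take s.left.length ++ s.gate.values ((w.drop s.left.length).take s.gate.dom.length) ++
    (w.drop s.left.length).drop s.gate.dom.length

/-- The heat produced by an elementary diagram. -/
def sliceHeat (s : Slice (Color α) (CGate α)) (w : List ℕ) : ℕ :=
  s.gate.heat ((w.drop s.left.length).take s.gate.dom.length)

/-- The values carried by the outputs of a diagram. -/
def values : List (Slice (Color α) (CGate α)) → List ℕ → List ℕ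
  | [], w => w
  | s :: φ, w => values φ (sliceValues s w)

/-- The heat produced by a diagram. -/
def heat : List (Slice (Color α) (CGate α)) → List ℕ → ℕ
  | [], _ => 0
  | s :: φ, w => sliceHeat s w + heat φ (sliceValues s w)

theorem values_append (φ ψ : List (Slice (Color α) (CGate α))) (w : List ℕ) :
    values (φ ++ ψ) w = values ψ (values φ w) := by
  induction φ generalizing w with
  | nil => rfl
  | cons s φ ih => exact ih _

theorem heat_append (φ ψ : List (Slice (Color α) (CGate α))) (w : List ℕ) :
    heat (φ ++ ψ) w = heat φ w + heat ψ (values φ w) := by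
  induction φ generalizing w with
  | nil => simp [heat, values]
  | cons s φ ih => simp [heat, values, ih, Nat.add_assoc]

theorem getD_le_getD {l l' : List ℕ} (h : List.Forall₂ (· ≤ ·) l l') (n : ℕ) :
    l.getD n 1 ≤ l'.getD n 1 := by
  induction h generalizing n with
  | nil => simp
  | cons h _ ih => cases n <;> simp_all

theorem one_le_getD {l : List ℕ} (h : ∀ i ∈ l, 1 ≤ i) (n : ℕ) : 1 ≤ l.getD n 1 := by
  induction l generalizing n with
  | nil => simp
  | cons a l ih => cases n <;> simp_all

theorem forall₂_le_refl (l : List ℕ) : List.Forall₂ (· ≤ ·) l l := by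
  induction l <;> simp_all

theorem sum_le_of_forall₂ {l l' : List ℕ} (h : List.Forall₂ (· ≤ ·) l l') : l.sum ≤ l'.sum := by
  induction h with
  | nil => simp
  | cons h _ ih => simp; omega

theorem CGate.values_mono (g : CGate α) {l l' : List ℕ} (h : List.Forall₂ (· ≤ ·) l l') :
    List.Forall₂ (· ≤ ·) (g.values l) (g.values l') := by
  cases g with
  | un r => simpa [CGate.values] using sum_le_of_forall₂ h
  | swap A B =>
    have h0 := getD_le_getD h 0
    simp only [CGate.values, List.forall₂_cons, List.Forall₂.nil, and_true]
    exact ⟨Nat.mul_le_mul (getD_le_getD h 1) (Nat.pow_le_pow_right (by norm_num) h0), h0⟩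
  | _ => exact forall₂_le_refl _

theorem CGate.heat_mono (g : CGate α) {l l' : List ℕ} (h : List.Forall₂ (· ≤ ·) l l') :
    g.heat l ≤ g.heat l' := by
  cases g with
  | swap A B =>
    exact Nat.mul_le_mul (getD_le_getD h 1) (Nat.sub_le_sub_right
      (Nat.pow_le_pow_right (by norm_num) (getD_le_getD h 0)) 1)
  | _ => exact le_rfl

theorem CGate.one_le_values (g : CGate α) {l : List ℕ} (h : ∀ i ∈ l, 1 ≤ i) :
    ∀ i ∈ g.values l, 1 ≤ i := by
  cases g with
  | swap A B =>
    intro i hi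
    simp only [CGate.values, List.mem_cons, List.not_mem_nil, or_false] at hi
    rcases hi with rfl | rfl
    · exact Nat.mul_pos (one_le_getD h 1) (by positivity)
    · exact one_le_getD h 0
  | _ => simp [CGate.values]

theorem values_mono (φ : List (Slice (Color α) (CGate α))) {w w' : List ℕ}
    (h : List.Forall₂ (· ≤ ·) w w') :
    List.Forall₂ (· ≤ ·) (values φ w) (values φ w') ∧ heat φ w ≤ heat φ w' := by
  induction φ generalizing w w' with
  | nil => exact ⟨h, le_rfl⟩
  | cons s φ ih =>
    have h1 := List.forall₂_take s.gate.dom.length (List.forall₂_drop s.left.length h)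
    have h2 : List.Forall₂ (· ≤ ·) (sliceValues s w) (sliceValues s w') :=
      List.rel_append (List.rel_append (List.forall₂_take s.left.length h)
        (s.gate.values_mono h1)) (List.forall₂_drop _ (List.forall₂_drop s.left.length h))
    exact ⟨(ih h2).1, Nat.add_le_add (s.gate.heat_mono h1) (ih h2).2⟩

theorem one_le_values (φ : List (Slice (Color α) (CGate α))) {w : List ℕ}
    (h : ∀ i ∈ w, 1 ≤ i) : ∀ i ∈ values φ w, 1 ≤ i := by
  induction φ generalizing w with
  | nil => exact h
  | cons s φ ih =>
    refine ih fun i hi => ?_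
    simp only [sliceValues, List.mem_append] at hi
    rcases hi with (hi | hi) | hi
    · exact h i (List.mem_of_mem_take hi)
    · exact s.gate.one_le_values (fun i hi => h i (List.mem_of_mem_drop (List.mem_of_mem_take hi))) i hi
    · exact h i (List.mem_of_mem_drop (List.mem_of_mem_drop hi))

theorem CGate.length_values (g : CGate α) (l : List ℕ) : (g.values l).length = g.cod.length := by
  cases g <;> simp [CGate.values, CGate.cod]

theorem sliceValues_eq {a b : List (Color α)} {g : CGate α} {u d c : List ℕ}
    (hu : u.length = a.length) (hd : d.length = g.dom.length) :
    sliceValues ⟨a, g, b⟩ (u ++ d ++ c) = u ++ g.values d ++ c ∧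
      sliceHeat ⟨a, g, b⟩ (u ++ d ++ c) = g.heat d := by
  simp [sliceValues, sliceHeat, ← hu, ← hd]

theorem exists_split {β : Type*} {l : List β} {m n : ℕ} (h : l.length = m + n) :
    ∃ l₁ l₂, l = l₁ ++ l₂ ∧ l₁.length = m ∧ l₂.length = n :=
  ⟨l.take m, l.drop m, (List.take_append_drop m l).symm, by simp; omega, by simp; omega⟩

theorem exists_split₃ {l : List ℕ} {x y z : List (Color α)} (h : l.length = (x ++ y ++ z).length) :
    ∃ u d c, l = u ++ d ++ c ∧ u.length = x.length ∧ d.length = y.length ∧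
      c.length = z.length := by
  obtain ⟨w, c, rfl, hw, hc⟩ := exists_split (h.trans List.length_append)
  obtain ⟨u, d, rfl, hu, hd⟩ := exists_split (hw.trans List.length_append)
  exact ⟨u, d, c, rfl, hu, hd, hc⟩

theorem values_whisker {φ : List (Slice (Color α) (CGate α))} {x y : List (Color α)}
    (h : (control α).Typed φ x y) (a b : List (Color α)) {u d c : List ℕ}
    (hu : u.length = a.length) (hd : d.length = x.length) :
    values (whisker a φ b) (u ++ d ++ c) = u ++ values φ d ++ c ∧
      heat (whisker a φ b) (u ++ d ++ c) = heat φ d ∧ (values φ d).length = y.length := by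
  induction φ generalizing x d with
  | nil => cases h; exact ⟨rfl, rfl, hd⟩
  | cons s φ ih =>
    obtain ⟨rfl, h⟩ := h
    obtain ⟨u', d', c', rfl, hu', hd', hc'⟩ := exists_split₃ hd
    obtain ⟨e1, e2⟩ := sliceValues_eq (g := s.gate) (a := s.left) (b := s.right) (c := c') hu' hd'
    obtain ⟨e3, e4⟩ := sliceValues_eq (g := s.gate) (a := a ++ s.left) (b := s.right ++ b)
      (u := u ++ u') (d := d') (c := c' ++ c) (by simp [hu, hu']) hd'
    obtain ⟨i1, i2, i3⟩ := ih (d := u' ++ s.gate.values d' ++ c') h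
      (by simp [hu', hc', s.gate.length_values])
    simp only [whisker_cons, values, heat, e1, e2, i3, and_true]
    simp only [List.append_assoc] at e3 e4 i1 i2 ⊢
    rw [e3, e4, i1, i2]
    exact ⟨rfl, rfl⟩

theorem length_values {φ : List (Slice (Color α) (CGate α))} {x y : List (Color α)}
    (h : (control α).Typed φ x y) {w : List ℕ} (hw : w.length = x.length) :
    (values φ w).length = y.length :=
  (values_whisker h [] [] (u := []) (c := []) rfl hw).2.2

theorem heat_interchange {l r : List (Slice (Color α) (CGate α))} {x y : List (Color α)}
    (h : (control α).Interchange l r) (hl : (control α).Typed l x y) {w : List ℕ}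
    (hw : w.length = x.length) : values l w = values r w ∧ heat l w = heat r w := by
  obtain ⟨χ, χ', g, h, a, b, c⟩ := h
  obtain ⟨_, ht, -⟩ := typed_append.1 hl
  obtain ⟨z, hχ, ht⟩ := typed_append.1 ht
  obtain ⟨rfl, -⟩ := ht
  have hw' := length_values hχ hw
  simp only [values_append, heat_append]
  generalize values χ w = w' at hw'
  obtain ⟨u, dg, v, rfl, hu, hg, hv⟩ := exists_split₃ hw'
  obtain ⟨v, dh, c', rfl, hv, hh, -⟩ := exists_split₃ hv
  obtain ⟨e1, e2⟩ := sliceValues_eq (a := a) (b := b ++ h.dom ++ c) (c := v ++ dh ++ c') hu hg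
  obtain ⟨e3, e4⟩ := sliceValues_eq (a := a) (b := b ++ h.cod ++ c) (c := v ++ h.values dh ++ c') hu hg
  obtain ⟨e5, e6⟩ := sliceValues_eq (a := a ++ g.cod ++ b) (b := c) (u := u ++ g.values dg ++ v)
    (d := dh) (c := c') (by simp [hu, hv, g.length_values]) hh
  obtain ⟨e7, e8⟩ := sliceValues_eq (a := a ++ g.dom ++ b) (b := c) (u := u ++ dg ++ v)
    (d := dh) (c := c') (by simp [hu, hv, hg]) hh
  simp only [List.append_assoc] at e1 e2 e3 e4 e5 e6 e7 e8 ⊢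
  simp only [values, heat, e1, e2, e3, e4, e5, e6, e7, e8, true_and]
  omega

theorem heat_sameDiagram {l r : List (Slice (Color α) (CGate α))} {x y : List (Color α)}
    (h : (control α).SameDiagram l r) (hl : (control α).Typed l x y) {w : List ℕ}
    (hw : w.length = x.length) : heat l w = heat r w := by
  induction h with
  | rel _ _ h => exact (heat_interchange h hl hw).2
  | refl => rfl
  | symm _ _ h ih => exact (ih ((SameDiagram.typed_iff h).2 hl)).symm
  | trans _ _ _ h _ ih ih' => exact (ih hl).trans (ih' ((SameDiagram.typed_iff h).1 hl))

/-- Writing `2 ^ i` as `p + 1` removes the truncated subtraction in the heat of a twisting operator.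
-/
theorem exists_pow_eq {i : ℕ} (h : 1 ≤ i) : ∃ p, 2 ^ i = p + 1 ∧ i ≤ p := by
  have := Nat.lt_two_pow_self (n := i)
  exact ⟨2 ^ i - 1, by omega, by omega⟩

/-- An operator with inputs `i, j` has outputs `j * 2 ^ i, i`, and its heat is exactly the growth of
`j`; the heat along a string that crosses several others is thus the total growth of its value. In
Yang–Baxter the left side is hotter because `j` has already been inflated to `j * 2 ^ i` before the
third string crosses it. The `+ 1` in the value of a unary gate makes the relations with `⅋` and `⊥`
strict. -/
theorem heat_cell {l r : List (Slice (Color α) (CGate α))} {x y : List (Color α)}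
    (h : ControlCell l r) (hl : (control α).Typed l x y) {w : List ℕ}
    (hw : w.length = x.length) (hp : ∀ i ∈ w, 1 ≤ i) :
    List.Forall₂ (· ≤ ·) (values r w) (values l w) ∧ heat r w < heat l w := by
  cases h with
  | swap_swap A B =>
    obtain ⟨rfl, -⟩ := hl
    obtain ⟨i, j, rfl⟩ := List.length_eq_two.1 hw
    simp only [List.mem_cons, List.not_mem_nil, or_false, forall_eq_or_imp, forall_eq] at hp
    obtain ⟨p, hp1, hp2⟩ := exists_pow_eq hp.1
    simp only [values, heat, sliceValues, sliceHeat, CGate.values, CGate.heat, CGate.dom,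
      List.length_nil, List.length_cons, List.take, List.drop, List.getD, List.getElem?_cons_zero,
      List.getElem?_cons_succ, Option.getD_some, List.nil_append, List.append_nil, List.forall₂_cons,
      List.Forall₂.nil, and_true, hp1]
    have := Nat.one_le_two_pow (n := j * (p + 1))
    refine ⟨⟨by nlinarith, by nlinarith⟩, ?_⟩
    have : 0 < j * (p + 1 - 1) := Nat.mul_pos (by omega) (by omega)
    omega
  | yang_baxter A B C =>
    obtain ⟨rfl, -⟩ := hl
    obtain ⟨i, j, k, rfl⟩ := List.length_eq_three.1 hw
    simp only [List.mem_cons, List.not_mem_nil, or_false, forall_eq_or_imp, forall_eq] at hp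
    obtain ⟨p, hp1, hp2⟩ := exists_pow_eq hp.1
    obtain ⟨q, hq1, hq2⟩ := exists_pow_eq hp.2.1
    -- The exponent `j * (p + 1)` splits as `j + j * p`; the factor `2 ^ (j * p) = m + 1` is what
    -- makes the left side hotter.
    obtain ⟨m, hm1, hm2⟩ := exists_pow_eq (i := j * p) (Nat.mul_pos (by omega) (by omega))
    have hm : 2 ^ (j * (p + 1)) = (q + 1) * (m + 1) := by
      rw [← hq1, ← hm1, ← pow_add]; congr 1; ring
    simp only [values, heat, sliceValues, sliceHeat, CGate.values, CGate.heat, CGate.dom,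
      List.length_nil, List.length_cons, List.take, List.drop, List.getD, List.getElem?_cons_zero,
      List.getElem?_cons_succ, Option.getD_some, List.cons_append, List.nil_append, List.append_nil, List.forall₂_cons,
      List.Forall₂.nil, and_true, hp1, hq1, hm, Nat.add_sub_cancel, le_refl]
    have e : (q + 1) * (m + 1) - 1 = q * m + q + m := by
      rw [show (q + 1) * (m + 1) = q * m + q + m + 1 by ring]; simp
    have hk : 1 ≤ k := hp.2.2
    have hj : 1 ≤ j := hp.2.1
    have hkm : 0 < k * m := Nat.mul_pos hk (lt_of_lt_of_le (Nat.mul_pos (by omega) (by omega)) hm2)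
    rw [e]
    have h0 : 0 ≤ k * (q + 1) * m * (p + 1) := Nat.zero_le _
    have h1 : 0 ≤ k * m * q := Nat.zero_le _
    have h2 : 0 ≤ k * p * m * q := Nat.zero_le _
    have h3 : 0 ≤ k * p * m := Nat.zero_le _
    exact ⟨by nlinarith, by nlinarith⟩
  | par_swap A B C =>
    obtain ⟨rfl, -⟩ := hl
    obtain ⟨i, j, k, rfl⟩ := List.length_eq_three.1 hw
    simp only [List.mem_cons, List.not_mem_nil, or_false, forall_eq_or_imp, forall_eq] at hp
    obtain ⟨p, hp1, hp2⟩ := exists_pow_eq hp.1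
    obtain ⟨q, hq1, hq2⟩ := exists_pow_eq hp.2.1
    simp only [values, heat, sliceValues, sliceHeat, CGate.values, CGate.heat, CGate.dom,
      UnRule.act, fw, List.map, List.sum_cons, List.sum_nil,
      List.length_nil, List.length_cons, List.take, List.drop, List.getD, List.getElem?_cons_zero,
      List.getElem?_cons_succ, Option.getD_some, List.cons_append, List.nil_append, List.append_nil, List.forall₂_cons,
      List.Forall₂.nil, and_true, hp1, hq1, Nat.add_sub_cancel, le_refl, pow_add, pow_one, pow_zero, mul_one]
    have e : (p + 1) * (q + 1) * 2 - 1 = 2 * p * q + 2 * p + 2 * q + 1 := by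
      rw [show (p + 1) * (q + 1) * 2 = 2 * p * q + 2 * p + 2 * q + 1 + 1 by ring]; simp
    rw [e]
    have hk : 1 ≤ k := hp.2.2
    have h0 : 0 ≤ k * p * q := Nat.zero_le _
    have h1 : 0 ≤ k * p := Nat.zero_le _
    have h2 : 0 ≤ k * q := Nat.zero_le _
    exact ⟨by nlinarith, by nlinarith⟩
  | swap_par A B C =>
    obtain ⟨rfl, -⟩ := hl
    obtain ⟨i, j, k, rfl⟩ := List.length_eq_three.1 hw
    simp only [List.mem_cons, List.not_mem_nil, or_false, forall_eq_or_imp, forall_eq] at hp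
    obtain ⟨p, hp1, hp2⟩ := exists_pow_eq hp.1
    simp only [values, heat, sliceValues, sliceHeat, CGate.values, CGate.heat, CGate.dom,
      UnRule.act, fw, List.map, List.sum_cons, List.sum_nil,
      List.length_nil, List.length_cons, List.take, List.drop, List.getD, List.getElem?_cons_zero,
      List.getElem?_cons_succ, Option.getD_some, List.cons_append, List.nil_append, List.append_nil, List.forall₂_cons,
      List.Forall₂.nil, and_true, hp1, Nat.add_sub_cancel, le_refl]
    exact ⟨by nlinarith, by nlinarith⟩
  | ax_swap A =>
    obtain ⟨rfl, -⟩ := hl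
    obtain rfl := List.length_eq_zero_iff.1 hw
    simp [values, heat, sliceValues, sliceHeat, CGate.values, CGate.heat, CGate.dom]
  | bot_swap A =>
    obtain ⟨rfl, -⟩ := hl
    obtain ⟨i, rfl⟩ := List.length_eq_one_iff.1 hw
    have : 1 ≤ i := hp i (by simp)
    simp [values, heat, sliceValues, sliceHeat, CGate.values, CGate.heat, CGate.dom, UnRule.act]
    omega
  | swap_bot A =>
    obtain ⟨rfl, -⟩ := hl
    obtain ⟨i, rfl⟩ := List.length_eq_one_iff.1 hw
    have : 1 ≤ i := hp i (by simp)
    have h2 := Nat.lt_two_pow_self (n := i)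
    simp [values, heat, sliceValues, sliceHeat, CGate.values, CGate.heat, CGate.dom, UnRule.act]
    omega
-- Below the rewritten part the strings carry values that are no larger than before, so by
-- `values_mono` the rest of the diagram gets no hotter. This is why `heat_cell` also compares the
-- output values.
theorem heat_rewrite {l r : List (Slice (Color α) (CGate α))} {x y : List (Color α)}
    (h : (control α).Rewrite l r) (hl : (control α).Typed l x y) {w : List ℕ}
    (hw : w.length = x.length) (hp : ∀ i ∈ w, 1 ≤ i) : heat r w < heat l w := by
  obtain ⟨χ, χ', l, r, a, b, x', y', hl', hr', h⟩ := h
  obtain ⟨_, ht, -⟩ := typed_append.1 hl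
  obtain ⟨z, hχ, ht⟩ := typed_append.1 ht
  obtain rfl : z = a ++ x' ++ b := by
    rcases l with - | ⟨s, l⟩
    · cases h
    · obtain ⟨rfl, -⟩ := ht
      obtain ⟨rfl, -⟩ := hl'
      simp
  have hw' := length_values hχ hw
  have hp' := one_le_values χ hp
  simp only [values_append, heat_append]
  generalize values χ w = w' at hw' hp'
  obtain ⟨u, d, v, rfl, hu, hd, -⟩ := exists_split₃ hw'
  obtain ⟨c1, c2⟩ := heat_cell h hl' hd fun i hi => hp' i (by simp [hi])
  obtain ⟨e1, e2, -⟩ := values_whisker hl' a b (c := v) hu hd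
  obtain ⟨e3, e4, -⟩ := values_whisker hr' a b (c := v) hu hd
  rw [e1, e2, e3, e4]
  have := (values_mono χ' (List.rel_append (List.rel_append (forall₂_le_refl u) c1)
    (forall₂_le_refl v))).2
  beta_reduce at this
  omega

/-- Every diagram of the control polygraph has an irreducible form. -/
theorem exists_irreducible {x y : List (Color α)} (φ : (control α).Diagram x y) :
    ∃ ψ : (control α).Diagram x y, ψ.Irreducible ∧ (control α).Conv x y φ.slices ψ.slices := by
  -- The measure is the heat when every input string carries `1`; the comparison of heats needs
  -- positive inputs.
  induction hn : heat φ.slices (List.replicate x.length 1) using Nat.strong_induction_on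
    generalizing φ with
  | _ n ih =>
    by_cases hφ : φ.Irreducible
    · exact ⟨φ, hφ, .refl φ.typed⟩
    · simp only [Diagram.Irreducible, not_forall, not_not] at hφ
      obtain ⟨φ', ψ, hs, hr⟩ := hφ
      obtain ⟨θ, hθ, hc⟩ := ih _ (by
        rw [← hn, heat_sameDiagram hs φ.typed (by simp)]
        exact heat_rewrite hr φ'.typed (by simp) (by simp)) ψ rfl
      exact ⟨θ, hθ, ((Conv.of_sameDiagram hs φ.typed).trans
        (.of_rewrite hr φ'.typed ψ.typed)).trans hc⟩

/-- No relation has an empty source, and interchange preserves emptiness. This supplies the empty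
`N` and `N'` in the uses of `B`-introduction. -/
theorem irreducible_nil (x : List (Color α)) :
    (⟨[], rfl⟩ : (control α).Diagram x x).Irreducible := by
  intro φ' ψ hs hr
  have aux : ∀ {l r : List (Slice (Color α) (CGate α))}, (control α).SameDiagram l r →
      (l = [] ↔ r = []) := by
    intro l r h
    induction h with
    | rel _ _ h => obtain ⟨χ, χ', g, h, a, b, c⟩ := h; simp
    | refl => rfl
    | symm _ _ _ ih => exact ih.symm
    | trans _ _ _ _ _ ih ih' => exact ih.trans ih'
  have hφ := (aux hs).1 rfl
  rw [hφ] at hr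
  generalize ht : ψ.slices = t at hr
  generalize hn : ([] : List (Slice (Color α) (CGate α))) = n at hr
  obtain ⟨χ, χ', l, r, a, b, x', y', hl', hr', h⟩ := hr
  cases h <;> simp at hn

@[simp] theorem control_typed_nil {x y : List (Color α)} :
    (control α).Typed ([] : List (Slice (Color α) (CGate α))) x y ↔ x = y := Iff.rfl

@[simp] theorem full_typed_nil {x y : List (Color α)} :
    (full α).Typed ([] : List (Slice (Color α) (FGate α))) x y ↔ x = y := Iff.rfl

/-! ### Nesting of control strings -/

/-- Number of `L` minus number of `R`. -/
def height : List (Color α) → ℤ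
  | [] => 0
  | .L :: w => height w + 1
  | .R :: w => height w - 1
  | .fm _ :: w => height w

/-- Starting at height `h`, the word stays at nonnegative heights. -/
def Nonneg : ℤ → List (Color α) → Prop
  | h, [] => 0 ≤ h
  | h, .L :: w => 0 ≤ h ∧ Nonneg (h + 1) w
  | h, .R :: w => 0 ≤ h ∧ Nonneg (h - 1) w
  | h, .fm _ :: w => 0 ≤ h ∧ Nonneg h w

/-- Starting at height `h`, the word stays at heights at most one, with formulas at height one
only. -/
def Low : ℤ → List (Color α) → Prop
  | h, [] => h ≤ 1
  | h, .L :: w => h ≤ 0 ∧ Low (h + 1) w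
  | h, .R :: w => h ≤ 1 ∧ Low (h - 1) w
  | h, .fm _ :: w => h = 1 ∧ Low h w

theorem height_append (x y : List (Color α)) : height (x ++ y) = height x + height y := by
  induction x with
  | nil => simp [height]
  | cons c x ih => cases c <;> simp [height, ih] <;> ring

theorem Nonneg.nonneg {h : ℤ} {w : List (Color α)} (hw : Nonneg h w) : 0 ≤ h := by
  cases w with
  | nil => exact hw
  | cons c w => cases c <;> exact hw.1

theorem nonneg_append {h : ℤ} {x y : List (Color α)} :
    Nonneg h (x ++ y) ↔ Nonneg h x ∧ Nonneg (h + height x) y := by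
  induction x generalizing h with
  | nil => simpa [Nonneg, height] using fun h => h.nonneg
  | cons c x ih =>
    cases c <;> simp only [List.cons_append, Nonneg, height, ih, and_assoc]
    · rw [show h + (height x + 1) = h + 1 + height x by ring]
    · rw [show h + (height x - 1) = h - 1 + height x by ring]

theorem Low.le_one {h : ℤ} {w : List (Color α)} (hw : Low h w) : h ≤ 1 := by
  cases w with
  | nil => exact hw
  | cons c w => cases c <;> have := hw.1 <;> omega

theorem low_append {h : ℤ} {x y : List (Color α)} :
    Low h (x ++ y) ↔ Low h x ∧ Low (h + height x) y := by
  induction x generalizing h with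
  | nil => simpa [Low, height] using fun h => h.le_one
  | cons c x ih =>
    cases c <;> simp only [List.cons_append, Low, height, ih, and_assoc]
    · rw [show h + (height x + 1) = h + 1 + height x by ring]
    · rw [show h + (height x - 1) = h - 1 + height x by ring]

theorem height_fw (Γ : List (Formula α)) : height (fw Γ) = 0 := by
  induction Γ with
  | nil => rfl
  | cons A Γ ih => exact ih

theorem height_blk (Γ : List (Formula α)) : height (blk Γ) = 0 := by
  simp [blk, height, height_append, height_fw]

theorem nonneg_fw {h : ℤ} (hh : 0 ≤ h) (Γ : List (Formula α)) : Nonneg h (fw Γ) := by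
  induction Γ with
  | nil => exact hh
  | cons A Γ ih => exact ⟨hh, ih⟩

theorem low_fw (Γ : List (Formula α)) : Low 1 (fw Γ) := by
  induction Γ with
  | nil => exact le_rfl
  | cons A Γ ih => exact ⟨rfl, ih⟩

theorem nonneg_blk {h : ℤ} (hh : 0 ≤ h) (Γ : List (Formula α)) : Nonneg h (blk Γ) := by
  refine ⟨hh, nonneg_append.2 ⟨nonneg_fw (by omega) Γ, ?_⟩⟩
  simp [Nonneg, height_fw]; omega

theorem low_blk (Γ : List (Formula α)) : Low 0 (blk Γ) :=
  ⟨le_rfl, low_append.2 ⟨low_fw Γ, by simp [height_fw, Low]⟩⟩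

theorem height_letters (W : List (Letter α)) : height (W.flatMap Letter.word) = 0 := by
  induction W with
  | nil => rfl
  | cons l W ih => cases l <;> simp [Letter.word, height, ih]

theorem nonneg_letters {h : ℤ} (hh : 1 ≤ h) (W : List (Letter α)) :
    Nonneg h (W.flatMap Letter.word) := by
  induction W with
  | nil => simp [Nonneg]; omega
  | cons l W ih =>
    cases l <;> simp [Letter.word, Nonneg, ih] <;> omega

theorem low_letters (W : List (Letter α)) : Low 1 (W.flatMap Letter.word) := by
  induction W with
  | nil => exact le_rfl
  | cons l W ih => cases l <;> simp [Letter.word, Low, ih]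

theorem height_sheaf (W : List (Letter α)) : height (sheaf W) = 0 := by
  simp [sheaf, height, height_append, height_letters]

theorem nonneg_sheaf {h : ℤ} (hh : 0 ≤ h) (W : List (Letter α)) : Nonneg h (sheaf W) := by
  refine ⟨hh, nonneg_append.2 ⟨nonneg_letters (by omega) W, ?_⟩⟩
  simp [Nonneg, height_letters]; omega

theorem low_sheaf (W : List (Letter α)) : Low 0 (sheaf W) :=
  ⟨le_rfl, low_append.2 ⟨low_letters W, by simp [height_letters, Low]⟩⟩

theorem CGate.height_eq (g : CGate α) : height g.dom = height g.cod := by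
  cases g <;> simp [CGate.dom, CGate.cod, height, height_fw]

theorem FGate.height_eq (g : FGate α) : height g.dom = height g.cod := by
  cases g with
  | ctrl g => exact g.height_eq
  | big W W' => simp [FGate.dom, FGate.cod, height_append, height_sheaf]

theorem FGate.nonneg_cod {g : FGate α} {h : ℤ} (hg : Nonneg h g.dom) : Nonneg h g.cod := by
  have hh := hg.nonneg
  cases g with
  | ctrl g =>
    cases g <;> simp [FGate.cod, CGate.cod, Nonneg, hh, nonneg_fw] <;> omega
  | big W W' => simp [FGate.cod, nonneg_append, nonneg_sheaf, hh, height_sheaf]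

/-- The delicate gate is the binary one: its input word descends to `h - 1`, so `hg` forces `h ≥ 1`,
while the output word forces `h ≤ 1`; at height exactly one its inputs are allowed. -/
theorem FGate.low_dom {g : FGate α} {h : ℤ} (hg : Nonneg h g.dom) (hg' : Low h g.cod) :
    Low h g.dom := by
  cases g with
  | ctrl g =>
    cases g with
    | un r => obtain ⟨rfl, -⟩ := hg'; exact low_fw _
    | bin b =>
      simp only [FGate.dom, CGate.dom, Nonneg] at hg
      have := hg'.le_one
      simp only [FGate.dom, CGate.dom, Low]
      omega
    | swap A B => exact hg'
    | _ => exact le_trans hg'.1 zero_le_one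
  | big W W' =>
    simp only [FGate.dom, FGate.cod, low_append, height_sheaf, add_zero] at *
    exact hg'.symm

/-- The two conditions travel in opposite directions. `Low` is not preserved downwards, since an
axiom may be created inside a sheaf; `Nonneg` is not preserved upwards, since a cut at height zero
hides a badly nested word. A word between a well-nested source and a low target satisfies both. -/
theorem nesting_of_typed {φ : List (Slice (Color α) (FGate α))} {x y : List (Color α)}
    (h : (full α).Typed φ x y) (hx : Nonneg 0 x) :
    height x = height y ∧ Nonneg 0 y ∧ (Low 0 y → Low 0 x) := by
  induction φ generalizing x with
  | nil => cases h; exact ⟨rfl, hx, id⟩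
  | cons s φ ih =>
    obtain ⟨rfl, h⟩ := h
    rw [nonneg_append, nonneg_append, height_append] at hx
    have e : height ((full α).dom s.gate) = height ((full α).cod s.gate) := s.gate.height_eq
    obtain ⟨h1, h2, h3⟩ := ih h (by
      rw [nonneg_append, nonneg_append, height_append]
      exact ⟨⟨hx.1.1, FGate.nonneg_cod hx.1.2⟩, e ▸ hx.2⟩)
    refine ⟨by rw [← h1]; simp only [height_append, e], h2, fun hy => ?_⟩
    have h4 := h3 hy
    rw [low_append, low_append, height_append] at h4 ⊢
    exact ⟨⟨h4.1.1, FGate.low_dom hx.1.2 h4.1.2⟩, e ▸ h4.2⟩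

/-- A word that is well nested, without nested sheaves, is a sequence of sheaves. -/
theorem exists_blocks {w : List (Color α)} (h : Nonneg 0 w) (h' : Low 0 w) (h₀ : height w = 0) :
    ∃ bs : List (List (Formula α)), w = bs.flatMap blk := by
  have key : ∀ w : List (Color α),
      (Nonneg 0 w → Low 0 w → height w = 0 → ∃ bs : List (List (Formula α)), w = bs.flatMap blk) ∧
      (Nonneg 1 w → Low 1 w → height w = -1 → ∃ (Γ : List (Formula α))
        (bs : List (List (Formula α))), w = fw Γ ++ .R :: bs.flatMap blk) := by
    intro w
    induction w with
    | nil => exact ⟨fun _ _ _ => ⟨[], rfl⟩, by simp [height]⟩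
    | cons c w ih =>
      rcases c with - | - | A
      · refine ⟨fun h h' h₀ => ?_, fun h h' h₀ => by have := h'.1; omega⟩
        obtain ⟨Γ, bs, rfl⟩ := ih.2 h.2 h'.2 (by simp only [height] at h₀; omega)
        exact ⟨Γ :: bs, by simp [blk]⟩
      · refine ⟨fun h h' h₀ => by have := h.2.nonneg; omega, fun h h' h₀ => ?_⟩
        obtain ⟨bs, rfl⟩ := ih.1 h.2 h'.2 (by simp only [height] at h₀; omega)
        exact ⟨[], bs, rfl⟩
      · refine ⟨fun h h' h₀ => by have := h'.1; omega, fun h h' h₀ => ?_⟩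
        obtain ⟨Γ, bs, rfl⟩ := ih.2 h.2 h'.2 h₀
        exact ⟨A :: Γ, bs, rfl⟩
  exact (key w).1 h h' h₀

theorem flatMap_letters (Γ : List (Formula α)) :
    (Γ.map Letter.fm).flatMap Letter.word = fw Γ := by
  induction Γ with
  | nil => rfl
  | cons A Γ ih => simp [Letter.word, ih]

theorem sheaf_map_fm (Γ : List (Formula α)) : sheaf (Γ.map .fm) = blk Γ := by
  simp [sheaf, blk, flatMap_letters]

/-- The boundary `R, L` between consecutive blocks is read as the letter `rl`. -/
theorem exists_sheaf {bs : List (List (Formula α))} (h : bs ≠ []) :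
    ∃ W, bs.flatMap blk = sheaf W := by
  induction bs with
  | nil => exact absurd rfl h
  | cons Γ bs ih =>
    rcases bs with - | ⟨Δ, bs⟩
    · exact ⟨Γ.map .fm, by simp [sheaf_map_fm]⟩
    · obtain ⟨W, hW⟩ := ih (by simp)
      refine ⟨Γ.map .fm ++ .rl :: W, ?_⟩
      rw [List.flatMap_cons, hW]
      simp [sheaf, blk, flatMap_letters, Letter.word]

theorem exists_blocks_of_sheaf (W : List (Letter α)) :
    ∃ bs : List (List (Formula α)), bs ≠ [] ∧ sheaf W = bs.flatMap blk := by
  obtain ⟨bs, h⟩ := exists_blocks (nonneg_sheaf le_rfl W) (low_sheaf W) (height_sheaf W)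
  refine ⟨bs, ?_, h⟩
  rintro rfl
  simp [sheaf] at h

/-! ### A closed diagram goes through a `B`-gate -/

/-- The last gate would have to be a cut, the only gate without outputs; its input word closes a
control string that was never opened, which cannot happen below an empty source. -/
theorem eq_nil_of_typed_nil {φ : List (Slice (Color α) (CGate α))}
    (h : (control α).Typed φ [] []) : φ = [] := by
  rcases List.eq_nil_or_concat φ with rfl | ⟨φ, s, rfl⟩
  · rfl
  · obtain ⟨z, hz, hs⟩ := typed_append.1 (by simpa using h)
    have hz' := (nesting_of_typed (typed_incl _ _ _ hz) (le_refl (0 : ℤ))).2.1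
    obtain ⟨a, g, c⟩ := s
    obtain ⟨rfl, hs⟩ := hs
    simp only [control_typed_nil, List.append_eq_nil_iff] at hs
    obtain ⟨⟨rfl, hg⟩, rfl⟩ := hs
    rcases g with _ | _ | _ | b | _ <;> simp [CGate.cod] at hg
    simp only [CGate.dom, List.nil_append, List.append_nil, Nonneg] at hz'
    omega

/-- The gates pass through the `B`-gate starting with the lowest. While the word above the current
gate is nonempty it is a sequence of blocks, hence a sheaf, and `untangle_right` applies. If it is
empty, nothing precedes the gate by `eq_nil_of_typed_nil`, the gate creates the whole sheaf, and
`untangle_right_nil` erases the `B`-gate. -/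
theorem conv_big_right {φ : List (Slice (Color α) (CGate α))} {W W' : List (Letter α)}
    (h : (control α).Typed φ [] (sheaf W)) :
    (full α).Conv (sheaf W') (sheaf W ++ sheaf W')
      (whisker (sheaf W') (incl φ) [] ++ [⟨[], .big W' W, []⟩])
      (whisker [] (incl φ) (sheaf W')) := by
  induction φ using List.reverseRecOn generalizing W with
  | nil => simp [sheaf] at h
  | append_singleton φ s ih =>
    obtain ⟨z, hz, hs⟩ := typed_append.1 h
    obtain ⟨a, g, c⟩ := s
    have h1 := nesting_of_typed (typed_incl _ _ _ hz) (le_refl (0 : ℤ))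
    have h2 := nesting_of_typed (typed_incl _ _ _ hs) h1.2.1
    obtain ⟨bs, rfl⟩ := exists_blocks h1.2.1 (h2.2.2 (low_sheaf W)) h1.1.symm
    obtain ⟨e1, e2⟩ := hs
    simp only [control_typed_nil] at e2
    by_cases hbs : bs = []
    · subst hbs
      obtain rfl := eq_nil_of_typed_nil hz
      simp only [List.flatMap_nil, List.nil_eq, List.append_eq_nil_iff] at e1
      obtain ⟨⟨rfl, hg⟩, rfl⟩ := e1
      have c := Conv.of_cell (P := full α) (.untangle_right_nil g W W' hg (by simpa using e2.symm))
        (x := sheaf W') (y := sheaf W ++ sheaf W')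
        ⟨by simp [FGate.dom, hg], by simp [FGate.dom, FGate.cod, ← e2], by simp [FGate.cod]⟩
        ⟨by simp [FGate.dom, hg], by simp [FGate.cod, ← e2]⟩
      simpa using c
    · obtain ⟨W₁, hW₁⟩ := exists_sheaf hbs
      rw [hW₁] at hz e1
      have c1 := Conv.of_cell (P := full α) (.untangle_right g a c W₁ W W' e1 e2.symm)
        (x := sheaf W' ++ sheaf W₁) (y := sheaf W ++ sheaf W')
        ⟨by simp [FGate.dom, e1], by simp [FGate.dom, FGate.cod, ← e2], by simp [FGate.cod]⟩
        ⟨by simp [FGate.dom], by simp [FGate.dom, FGate.cod, e1], by simp [FGate.cod, ← e2]⟩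
      have c2 := Conv.append_left (P := full α) (x := sheaf W')
        (by simpa using (typed_incl _ _ _ hz).whisker (sheaf W') []) c1
      have c3 := (ih hz).append_right (φ := [⟨a, FGate.ctrl g, c ++ sheaf W'⟩])
        (z := sheaf W ++ sheaf W') (typed_slice _ _ _ (by simp [FGate.dom, e1])
          (by simp [FGate.cod, ← e2]))
      exact (by simpa using c2 : (full α).Conv _ _ _ _).trans (by simpa using c3)

/-! ### Block crossings -/

theorem typed_cross₁ (X : List (Formula α)) (b : Formula α) :
    (control α).Typed (cross₁ X b) (fw X ++ [.fm b]) (.fm b :: fw X) := by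
  induction X with
  | nil => exact rfl
  | cons a X ih =>
    exact Typed.append (y := Color.fm a :: Color.fm b :: fw X) (by simpa using ih.whisker [.fm a] [])
      (typed_slice _ _ _ (by simp [CGate.dom]) (by simp [CGate.cod]))

theorem swapOnly_cross₁ (X : List (Formula α)) (b : Formula α) : SwapOnly (cross₁ X b) := by
  induction X with
  | nil => exact swapOnly_nil
  | cons a X ih => exact (ih.whisker _ _).append (swapOnly_swap _ _ _ _)

theorem trace_cross₁ (X : List (Formula α)) (b : Formula α) (i : ℕ) :
    trace (cross₁ X b) i = if i = 0 then X.length else if i ≤ X.length then i - 1 else i := by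
  induction X generalizing i with
  | nil => simp only [cross₁, trace, List.length_nil]; grind
  | cons a X ih =>
    simp only [cross₁, trace_append, trace, trace_whisker, ih, Equiv.swap_apply_def,
      List.length_cons, List.length_nil]
    grind

theorem typed_cross (X Y : List (Formula α)) :
    (control α).Typed (cross X Y) (fw X ++ fw Y) (fw Y ++ fw X) := by
  induction Y with
  | nil => simp [cross]
  | cons b Y ih =>
    exact Typed.append (y := Color.fm b :: (fw X ++ fw Y))
      (by simpa using (typed_cross₁ X b).whisker [] (fw Y)) (by simpa using ih.whisker [.fm b] [])

theorem swapOnly_cross (X Y : List (Formula α)) : SwapOnly (cross X Y) := by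
  induction Y with
  | nil => exact swapOnly_nil
  | cons b Y ih => exact ((swapOnly_cross₁ X b).whisker _ _).append (ih.whisker _ _)

theorem trace_cross (X Y : List (Formula α)) (i : ℕ) :
    trace (cross X Y) i = if i < Y.length then i + X.length else
      if i < Y.length + X.length then i - Y.length else i := by
  induction Y generalizing i with
  | nil => simp only [cross, trace, List.length_nil]; grind
  | cons b Y ih =>
    simp only [cross, trace_append, trace_whisker, trace_cross₁, ih, List.length_cons,
      List.length_nil]
    grind

theorem Polygraph.Typed.of_append {P : Polygraph.{u, v}} {φ ψ : List (Slice P.Color P.Gate)}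
    {x y z : List P.Color} (h : P.Typed (φ ++ ψ) x z) (hφ : P.Typed φ x y) : P.Typed ψ y z := by
  obtain ⟨w, h1, h2⟩ := typed_append.1 h
  exact hφ.unique h1 ▸ h2

/-- Three closed diagrams side by side can be replaced by equal ones. -/
theorem conv_closed₃ {x y z w : List (Color α)}
    {φ φ' φ₁ φ₁' φ₂ φ₂' χ l r : List (Slice (Color α) (CGate α))}
    (h : (control α).Conv [] x φ φ') (h₁ : (control α).Conv [] y φ₁ φ₁')
    (h₂ : (control α).Conv [] z φ₂ φ₂')
    (hl : l = φ ++ whisker x φ₁ [] ++ whisker (x ++ y) φ₂ [] ++ χ)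
    (hr : r = φ' ++ whisker x φ₁' [] ++ whisker (x ++ y) φ₂' [] ++ χ)
    (ht : (control α).Typed l [] w) : (control α).Conv [] w l r := by
  subst hl hr
  have e := (h.append (by simpa using h₁.whisker x [])).append
    (by simpa using h₂.whisker (x ++ y) [])
  exact e.append_right (ht.of_append e.typed_left)

/-! ### Two binary rules that act on the same premise -/

/-- The diagram is equal, in the category presented by the control polygraph, to the diagrams that
represent the derivation. -/
def Draws {Γ : List (Formula α)} (d : Deriv Γ) (φ : List (Slice (Color α) (CGate α))) : Prop :=
  (control α).Conv [] (blk Γ) (diag d) φ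

theorem Represents.draws {Γ : List (Formula α)} {d : Deriv Γ}
    {φ ψ : List (Slice (Color α) (CGate α))} (h : Represents φ d)
    (h' : (control α).Conv [] (blk Γ) φ ψ) : Draws d ψ :=
  h.conv_diag.symm.trans h'

/-- Interchange lifts the three premises to the top, where they are replaced by the given diagrams.
The outcome is the source of `big_intro_left` for the single moved string `c.left` and empty `N`. -/
theorem binary_left_source (Γ Θ Δ : List (Formula α)) (b c : BinRule α)
    (d₁ : Deriv (Γ ++ [c.left] ++ [b.left])) (d₂ : Deriv (b.right :: Θ))
    (d₃ : Deriv (c.right :: Δ)) {φ φ₁ φ₂ : List (Slice (Color α) (CGate α))}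
    (h : Draws d₁ φ)
    (h₁ : Draws d₂ φ₁)
    (h₂ : Draws d₃ φ₂) :
    Draws (.binary c (.ex (.block Γ [c.left] (b.prin ++ Θ) []) (.binary b d₁ d₂) :
          Deriv (Γ ++ b.prin ++ Θ ++ [c.left])) d₃)
      (φ ++ whisker (blk (Γ ++ [c.left] ++ [b.left])) φ₁ []
          ++ whisker (blk (Γ ++ [c.left] ++ [b.left]) ++ blk (b.right :: Θ)) φ₂ []
          ++ [⟨.L :: fw (Γ ++ [c.left]), .bin b, fw Θ ++ [.R] ++ blk (c.right :: Δ)⟩]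
          ++ whisker (.L :: fw Γ) (cross [c.left] (b.prin ++ Θ)) (.R :: blk (c.right :: Δ))
          ++ [⟨.L :: fw (Γ ++ b.prin ++ Θ), .bin c, fw Δ ++ [.R]⟩]) := by
  have hτ : Realizes (whisker (fw Γ) (cross [c.left] (b.prin ++ Θ)) [])
      (.block Γ [c.left] (b.prin ++ Θ) [] :
        Reorder (Γ ++ [c.left] ++ b.prin ++ Θ) (Γ ++ b.prin ++ Θ ++ [c.left])) := by
    refine realizes_of_trace ((swapOnly_cross _ _).whisker _ _)
      (by simpa using (typed_cross [c.left] (b.prin ++ Θ)).whisker (fw Γ) []) fun i => ?_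
    rw [trace_whisker, trace_cross, Reorder.fn_block]
    simp only [length_fw, List.length_append, List.length_cons, List.length_nil]
    grind
  have hR := Represents.binary (Γ := Γ ++ b.prin ++ Θ) c
    (.ex (.binary b (represents_diag d₁) (represents_diag d₂)) hτ) (represents_diag d₃)
  have c1 := conv_interchange_ctx (P := control α)
    (χ := diag d₁ ++ whisker (blk (Γ ++ [c.left] ++ [b.left])) (diag d₂) []
      ++ [⟨.L :: fw (Γ ++ [c.left]), .bin b, fw Θ ++ [.R]⟩])
    (χ' := [⟨.L :: fw (Γ ++ b.prin ++ Θ), .bin c, fw Δ ++ [.R]⟩]) (.L :: fw Γ) [.R] []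
    (typed_cross [c.left] (b.prin ++ Θ)) (typed_diag d₃) (by simp [blk]) rfl hR.typed
  have c2 := conv_interchange_ctx (P := control α)
    (χ := diag d₁ ++ whisker (blk (Γ ++ [c.left] ++ [b.left])) (diag d₂) [])
    (χ' := whisker (.L :: fw Γ) (cross [c.left] (b.prin ++ Θ)) (.R :: blk (c.right :: Δ)) ++
      [⟨.L :: fw (Γ ++ b.prin ++ Θ), .bin c, fw Δ ++ [.R]⟩]) (.L :: fw (Γ ++ [c.left]))
    (fw Θ ++ [.R]) [] (typed_gate (.bin b)) (typed_diag d₃) (by simp [CGate.cod]) rfl c1.typed_right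
  have c3 := conv_closed₃ (χ := [⟨.L :: fw (Γ ++ [c.left]), .bin b, fw Θ ++ [.R] ++ blk (c.right :: Δ)⟩]
          ++ whisker (.L :: fw Γ) (cross [c.left] (b.prin ++ Θ)) (.R :: blk (c.right :: Δ))
          ++ [⟨.L :: fw (Γ ++ b.prin ++ Θ), .bin c, fw Δ ++ [.R]⟩]) h h₁ h₂
      (by simp [blk, CGate.dom]) rfl c2.typed_right
  exact ((hR.conv_diag.symm.trans (c1.trans c2)).trans (c3.trans (.of_eq c3.typed_right (by simp))))

/-- A detour: `C, Δ` is exchanged to `Δ, C` before `B` passes and is restored afterwards. The target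
of `big_intro_left` applies the gate `b` with the context in the order `Δ, C`, so the drawing must
contain that intermediate state. -/
theorem realizes_block_twisted (Γ B C Δ : List (Formula α)) :
    Realizes (whisker (fw (Γ ++ B)) (cross C Δ) []
        ++ whisker (fw Γ) (cross B (Δ ++ C)) []
        ++ whisker (fw Γ) (cross Δ C) (fw B))
      (.block Γ B (C ++ Δ) [] : Reorder (Γ ++ B ++ C ++ Δ) (Γ ++ C ++ Δ ++ B)) := by
  refine realizes_of_trace ((((swapOnly_cross _ _).whisker _ _).append
      ((swapOnly_cross _ _).whisker _ _)).append ((swapOnly_cross _ _).whisker _ _))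
    (Typed.append (Typed.append
      (by simpa using (typed_cross C Δ).whisker (fw (Γ ++ B)) [])
      (by simpa using (typed_cross B (Δ ++ C)).whisker (fw Γ) []))
      (by simpa using (typed_cross Δ C).whisker (fw Γ) (fw B))) fun i => ?_
  rw [trace_append, trace_append, Reorder.fn_block]
  generalize h₁ : trace (whisker (fw Γ) (cross Δ C) (fw B)) i = j₁
  generalize h₂ : trace (whisker (fw Γ) (cross B (Δ ++ C)) []) j₁ = j₂
  simp only [trace_whisker, trace_cross, length_fw, List.length_append] at h₁ h₂ ⊢
  generalize Γ.length = n, Δ.length = m, C.length = k, B.length = l at *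
  split_ifs at h₁ <;> (split_ifs at h₂ <;> try omega) <;> (split_ifs <;> omega)

/-- Counterpart of `realizes_block_twisted` below the gate `b`: it begins with the crossing that
cancels the last one there and then follows the final crossings of `big_intro_left`. -/
theorem realizes_blocks_twisted (Γ C Δ B Θ : List (Formula α)) :
    Realizes (whisker (fw Γ) (cross C Δ) (fw (B ++ Θ))
        ++ whisker (fw Γ) (cross (Δ ++ C) B) (fw Θ)
        ++ whisker (fw (Γ ++ B)) (cross (Δ ++ C) Θ) []
        ++ whisker (fw (Γ ++ B ++ Θ)) (cross Δ C) [])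
      (.block Γ (C ++ Δ) (B ++ Θ) [] : Reorder (Γ ++ C ++ Δ ++ B ++ Θ) (Γ ++ B ++ Θ ++ C ++ Δ)) := by
  refine realizes_of_trace (((((swapOnly_cross _ _).whisker _ _).append
      ((swapOnly_cross _ _).whisker _ _)).append ((swapOnly_cross _ _).whisker _ _)).append
      ((swapOnly_cross _ _).whisker _ _))
    (Typed.append (Typed.append (Typed.append
      (by simpa using (typed_cross C Δ).whisker (fw Γ) (fw (B ++ Θ)))
      (by simpa using (typed_cross (Δ ++ C) B).whisker (fw Γ) (fw Θ)))
      (by simpa using (typed_cross (Δ ++ C) Θ).whisker (fw (Γ ++ B)) []))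
      (by simpa using (typed_cross Δ C).whisker (fw (Γ ++ B ++ Θ)) [])) fun i => ?_
  rw [trace_append, trace_append, trace_append, Reorder.fn_block]
  generalize h₁ : trace (whisker (fw (Γ ++ B ++ Θ)) (cross Δ C) []) i = j₁
  generalize h₂ : trace (whisker (fw (Γ ++ B)) (cross (Δ ++ C) Θ) []) j₁ = j₂
  generalize h₃ : trace (whisker (fw Γ) (cross (Δ ++ C) B) (fw Θ)) j₂ = j₃
  simp only [trace_whisker, trace_cross, length_fw, List.length_append] at h₁ h₂ h₃ ⊢
  generalize Γ.length = n, Δ.length = m, C.length = k, B.length = p, Θ.length = q at *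
  split_ifs at h₁ <;> (split_ifs at h₂ <;> try omega) <;> (split_ifs at h₃ <;> try omega) <;>
    (split_ifs <;> omega)

/-- The drawing is what the target of `big_intro_left` becomes once the `B`-gate is removed: the
premise `φ₂` stands to the left of `φ₁`, next to `φ`. -/
theorem binary_left_target (Γ Θ Δ : List (Formula α)) (b c : BinRule α)
    (d₁ : Deriv (Γ ++ [c.left] ++ [b.left])) (d₂ : Deriv (b.right :: Θ))
    (d₃ : Deriv (c.right :: Δ)) {φ φ₁ φ₂ : List (Slice (Color α) (CGate α))}
    (h : Draws d₁ φ) (h₁ : Draws d₂ φ₁) (h₂ : Draws d₃ φ₂) :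
    Draws (.ex (.block Γ (c.prin ++ Δ) (b.prin ++ Θ) [])
          (.binary b (.ex (.block Γ [b.left] (c.prin ++ Δ) [])
            (.binary c (.ex (.block Γ [c.left] [b.left] []) d₁ :
              Deriv (Γ ++ [b.left] ++ [c.left])) d₃) :
            Deriv (Γ ++ c.prin ++ Δ ++ [b.left])) d₂) : Deriv (Γ ++ b.prin ++ Θ ++ c.prin ++ Δ))
      (φ ++ whisker (blk (Γ ++ [c.left] ++ [b.left])) φ₁ []
          ++ whisker (.L :: fw Γ) (cross [c.left] [b.left]) (.R :: blk (b.right :: Θ))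
          ++ whisker (blk (Γ ++ [b.left] ++ [c.left])) φ₂ (blk (b.right :: Θ))
          ++ [⟨.L :: fw (Γ ++ [b.left]), .bin c, fw Δ ++ [.R] ++ blk (b.right :: Θ)⟩]
          ++ whisker (.L :: fw (Γ ++ [b.left])) (cross c.prin Δ) (.R :: blk (b.right :: Θ))
          ++ whisker (.L :: fw Γ) (cross [b.left] (Δ ++ c.prin)) (.R :: blk (b.right :: Θ))
          ++ [⟨.L :: fw (Γ ++ Δ ++ c.prin), .bin b, fw Θ ++ [.R]⟩]
          ++ whisker (.L :: fw Γ) (cross (Δ ++ c.prin) b.prin) (fw Θ ++ [.R])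
          ++ whisker (.L :: fw (Γ ++ b.prin)) (cross (Δ ++ c.prin) Θ) [.R]
          ++ whisker (.L :: fw (Γ ++ b.prin ++ Θ)) (cross Δ c.prin) [.R]) := by
  have hτ : Realizes (whisker (fw Γ) (cross [c.left] [b.left]) [])
      (.block Γ [c.left] [b.left] [] :
        Reorder (Γ ++ [c.left] ++ [b.left]) (Γ ++ [b.left] ++ [c.left])) := by
    refine realizes_of_trace ((swapOnly_cross _ _).whisker _ _)
      (by simpa using (typed_cross [c.left] [b.left]).whisker (fw Γ) []) fun i => ?_
    rw [trace_whisker, trace_cross, Reorder.fn_block]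
    simp only [length_fw, List.length_cons, List.length_nil]
    grind
  have hτ₁ := realizes_block_twisted Γ [b.left] c.prin Δ
  have hτ₂ := realizes_blocks_twisted Γ c.prin Δ b.prin Θ
  have hR := Represents.ex (.binary (Γ := Γ ++ c.prin ++ Δ) b (.ex (.binary (Γ := Γ ++ [b.left]) c
    (.ex (represents_diag d₁) hτ) (represents_diag d₃)) hτ₁) (represents_diag d₂)) hτ₂
  have t₁ : (control α).Typed (whisker (.L :: fw Γ) (cross [c.left] [b.left]) [.R])
      (blk (Γ ++ [c.left] ++ [b.left])) (blk (Γ ++ [b.left] ++ [c.left])) := by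
    simpa [blk] using (typed_cross [c.left] [b.left]).whisker (.L :: fw Γ) [.R]
  have t₂ : (control α).Typed (whisker (blk (Γ ++ [b.left] ++ [c.left])) (diag d₃) []
        ++ [⟨.L :: fw (Γ ++ [b.left]), .bin c, fw Δ ++ [.R]⟩])
      (blk (Γ ++ [b.left] ++ [c.left])) (blk (Γ ++ [b.left] ++ c.prin ++ Δ)) := by
    refine Typed.append (by simpa using (typed_diag d₃).whisker (blk (Γ ++ [b.left] ++ [c.left])) [])
      (typed_slice _ _ _ ?_ ?_) <;> simp [blk, CGate.dom, CGate.cod]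
  have t₃ : (control α).Typed (whisker (.L :: fw (Γ ++ [b.left])) (cross c.prin Δ) [.R]
        ++ whisker (.L :: fw Γ) (cross [b.left] (Δ ++ c.prin)) [.R])
      (blk (Γ ++ [b.left] ++ c.prin ++ Δ)) (blk (Γ ++ Δ ++ c.prin ++ [b.left])) := by
    refine Typed.append (y := blk (Γ ++ [b.left] ++ Δ ++ c.prin))
      (by simpa [blk] using (typed_cross c.prin Δ).whisker (.L :: fw (Γ ++ [b.left])) [.R])
      (by simpa [blk] using (typed_cross [b.left] (Δ ++ c.prin)).whisker (.L :: fw Γ) [.R])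
  -- The last crossing of the upper detour sinks below the right premise (`c1`) and below the gate
  -- `b` (`c2`), where it meets its inverse.
  have c1 := conv_interchange_ctx (P := control α)
    (χ := diag d₁ ++ whisker (.L :: fw Γ) (cross [c.left] [b.left]) [.R]
      ++ whisker (blk (Γ ++ [b.left] ++ [c.left])) (diag d₃) []
      ++ [⟨.L :: fw (Γ ++ [b.left]), .bin c, fw Δ ++ [.R]⟩]
      ++ whisker (.L :: fw (Γ ++ [b.left])) (cross c.prin Δ) [.R]
      ++ whisker (.L :: fw Γ) (cross [b.left] (Δ ++ c.prin)) [.R])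
    (χ' := [⟨.L :: fw (Γ ++ c.prin ++ Δ), .bin b, fw Θ ++ [.R]⟩]
      ++ whisker (.L :: fw Γ) (cross c.prin Δ) (fw (b.prin ++ Θ) ++ [.R])
      ++ whisker (.L :: fw Γ) (cross (Δ ++ c.prin) b.prin) (fw Θ ++ [.R])
      ++ whisker (.L :: fw (Γ ++ b.prin)) (cross (Δ ++ c.prin) Θ) [.R]
      ++ whisker (.L :: fw (Γ ++ b.prin ++ Θ)) (cross Δ c.prin) [.R])
    (.L :: fw Γ) [.fm b.left, .R] [] (typed_cross Δ c.prin) (typed_diag d₂) (by simp [blk]) rfl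
    hR.typed
  have c2 := conv_interchange_ctx (P := control α)
    (χ := diag d₁ ++ whisker (.L :: fw Γ) (cross [c.left] [b.left]) [.R]
      ++ whisker (blk (Γ ++ [b.left] ++ [c.left])) (diag d₃) []
      ++ [⟨.L :: fw (Γ ++ [b.left]), .bin c, fw Δ ++ [.R]⟩]
      ++ whisker (.L :: fw (Γ ++ [b.left])) (cross c.prin Δ) [.R]
      ++ whisker (.L :: fw Γ) (cross [b.left] (Δ ++ c.prin)) [.R]
      ++ whisker (blk (Γ ++ Δ ++ c.prin ++ [b.left])) (diag d₂) [])
    (χ' := whisker (.L :: fw Γ) (cross c.prin Δ) (fw (b.prin ++ Θ) ++ [.R])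
      ++ whisker (.L :: fw Γ) (cross (Δ ++ c.prin) b.prin) (fw Θ ++ [.R])
      ++ whisker (.L :: fw (Γ ++ b.prin)) (cross (Δ ++ c.prin) Θ) [.R]
      ++ whisker (.L :: fw (Γ ++ b.prin ++ Θ)) (cross Δ c.prin) [.R])
    (.L :: fw Γ) [] (fw Θ ++ [.R]) (typed_cross Δ c.prin) (typed_gate (.bin b))
    (by simp [blk, CGate.dom]) rfl c1.typed_right
  -- The two halves of the detour cancel.
  have c3 : (control α).Conv (fw (Δ ++ c.prin)) (fw (Δ ++ c.prin))
      (cross Δ c.prin ++ cross c.prin Δ) [] := by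
    refine conv_of_trace_eq ((swapOnly_cross _ _).append (swapOnly_cross _ _)) swapOnly_nil
      (Typed.append (by simpa using typed_cross Δ c.prin) (by simpa using typed_cross c.prin Δ))
      rfl fun i => ?_
    simp only [trace_append, trace_cross, trace]
    grind
  have t₄ : (control α).Typed ([⟨.L :: fw (Γ ++ Δ ++ c.prin), .bin b, fw Θ ++ [.R]⟩]
      ++ whisker (.L :: fw Γ) (cross (Δ ++ c.prin) b.prin) (fw Θ ++ [.R])
      ++ whisker (.L :: fw (Γ ++ b.prin)) (cross (Δ ++ c.prin) Θ) [.R]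
      ++ whisker (.L :: fw (Γ ++ b.prin ++ Θ)) (cross Δ c.prin) [.R])
      (blk (Γ ++ Δ ++ c.prin ++ [b.left]) ++ blk (b.right :: Θ))
      (blk (Γ ++ b.prin ++ Θ ++ c.prin ++ Δ)) := by
    refine Typed.append (y := blk (Γ ++ b.prin ++ Θ ++ Δ ++ c.prin)) (Typed.append
      (y := blk (Γ ++ b.prin ++ Δ ++ c.prin ++ Θ)) (Typed.append
      (y := blk (Γ ++ Δ ++ c.prin ++ b.prin ++ Θ)) (typed_slice _ _ _ ?_ ?_) ?_) ?_) ?_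
    · simp [blk, CGate.dom]
    · simp [blk, CGate.cod]
    · simpa [blk] using (typed_cross (Δ ++ c.prin) b.prin).whisker (.L :: fw Γ) (fw Θ ++ [.R])
    · simpa [blk] using (typed_cross (Δ ++ c.prin) Θ).whisker (.L :: fw (Γ ++ b.prin)) [.R]
    · simpa [blk] using (typed_cross Δ c.prin).whisker (.L :: fw (Γ ++ b.prin ++ Θ)) [.R]
  have t₅ := (typed_diag d₁).append (t₁.append (t₂.append t₃))
  have t₆ := t₅.append (show (control α).Typed (whisker (blk (Γ ++ Δ ++ c.prin ++ [b.left])) (diag d₂) [])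
      (blk (Γ ++ Δ ++ c.prin ++ [b.left])) (blk (Γ ++ Δ ++ c.prin ++ [b.left]) ++ blk (b.right :: Θ))
      by simpa using (typed_diag d₂).whisker (blk (Γ ++ Δ ++ c.prin ++ [b.left])) [])
  have t₇ : (control α).Typed [⟨.L :: fw (Γ ++ Δ ++ c.prin), .bin b, fw Θ ++ [.R]⟩]
      (blk (Γ ++ Δ ++ c.prin ++ [b.left]) ++ blk (b.right :: Θ))
      (.L :: fw Γ ++ fw (Δ ++ c.prin) ++ (fw (b.prin ++ Θ) ++ [.R])) :=
    typed_slice _ _ _ (by simp [blk, CGate.dom]) (by simp [CGate.cod])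
  have t₈ : (control α).Typed (whisker (.L :: fw Γ) (cross (Δ ++ c.prin) b.prin) (fw Θ ++ [.R])
      ++ (whisker (.L :: fw (Γ ++ b.prin)) (cross (Δ ++ c.prin) Θ) [.R]
      ++ whisker (.L :: fw (Γ ++ b.prin ++ Θ)) (cross Δ c.prin) [.R])) _
      (blk (Γ ++ b.prin ++ Θ ++ c.prin ++ Δ)) :=
    Typed.of_append (by simpa only [List.append_assoc] using t₄) t₇
  have c4 := Conv.append_left (t₆.append t₇) ((c3.whisker (.L :: fw Γ)
    (fw (b.prin ++ Θ) ++ [.R])).append_right (φ := whisker (.L :: fw Γ) (cross (Δ ++ c.prin) b.prin)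
        (fw Θ ++ [.R])
      ++ whisker (.L :: fw (Γ ++ b.prin)) (cross (Δ ++ c.prin) Θ) [.R]
      ++ whisker (.L :: fw (Γ ++ b.prin ++ Θ)) (cross Δ c.prin) [.R])
      (by simpa using t₈))
  -- The premise `d₂` rises to just below `d₁`, above everything that is done with `d₃`.
  have c5 := conv_interchange_ctx (P := control α) (χ := diag d₁) (χ' := [⟨.L :: fw (Γ ++ Δ ++ c.prin), .bin b, fw Θ ++ [.R]⟩]
      ++ whisker (.L :: fw Γ) (cross (Δ ++ c.prin) b.prin) (fw Θ ++ [.R])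
      ++ whisker (.L :: fw (Γ ++ b.prin)) (cross (Δ ++ c.prin) Θ) [.R]
      ++ whisker (.L :: fw (Γ ++ b.prin ++ Θ)) (cross Δ c.prin) [.R]) [] [] []
      (t₁.append (t₂.append t₃)) (typed_diag d₂) (by simp) rfl c4.typed_right
  have c6 := ((Conv.append h (by simpa using h₁.whisker (blk (Γ ++ [c.left] ++ [b.left])) [])).append_right
    (by simpa using t₁.whisker [] (blk (b.right :: Θ)))).append
    (by simpa using h₂.whisker (blk (Γ ++ [b.left] ++ [c.left])) (blk (b.right :: Θ)))
  have c7 := c6.append_right (z := blk (Γ ++ b.prin ++ Θ ++ c.prin ++ Δ)) (φ :=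
          [⟨.L :: fw (Γ ++ [b.left]), .bin c, fw Δ ++ [.R] ++ blk (b.right :: Θ)⟩]
          ++ whisker (.L :: fw (Γ ++ [b.left])) (cross c.prin Δ) (.R :: blk (b.right :: Θ))
          ++ whisker (.L :: fw Γ) (cross [b.left] (Δ ++ c.prin)) (.R :: blk (b.right :: Θ))
          ++ [⟨.L :: fw (Γ ++ Δ ++ c.prin), .bin b, fw Θ ++ [.R]⟩]
          ++ whisker (.L :: fw Γ) (cross (Δ ++ c.prin) b.prin) (fw Θ ++ [.R])
          ++ whisker (.L :: fw (Γ ++ b.prin)) (cross (Δ ++ c.prin) Θ) [.R]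
          ++ whisker (.L :: fw (Γ ++ b.prin ++ Θ)) (cross Δ c.prin) [.R])
    (Typed.of_append (by simpa [blk] using c5.typed_right) c6.typed_left)
  refine hR.draws (c1.trans (c2.trans ?_))
  have c8 := (c4.trans (.of_eq c4.typed_right (by simp))).trans c5
  simp only [whisker_append, whisker_whisker, List.append_assoc, List.append_nil, List.nil_append,
    blk, fw_append, fw_cons, fw_nil, List.cons_append, whisker_cons, whisker_nil] at c7 c8 ⊢
  exact c8.trans c7

/-- A `B`-gate that crosses a closed diagram is removed by sliding the diagram through it. -/
theorem conv_untangle {Γ Δ : List (Formula α)} {x y z : List (Color α)}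
    {χ χ' φ ρ r : List (Slice (Color α) (CGate α))} {l : List (Slice (Color α) (FGate α))}
    (hφ : (control α).Typed φ [] (blk Δ)) (hχ : (control α).Typed χ [] (x ++ blk Γ ++ z))
    (h : (control α).Conv [] (x ++ blk Γ ++ blk Δ ++ z) χ' (χ ++ whisker (x ++ blk Γ) φ z))
    (hl : l = incl χ' ++ [⟨x, .big (Γ.map .fm) (Δ.map .fm), z⟩] ++ incl ρ)
    (hr : r = χ ++ whisker x φ (blk Γ ++ z) ++ ρ) (ht : (control α).Typed r [] y) :
    (full α).Conv [] y l (incl r) := by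
  subst hl hr
  have hρ : (control α).Typed ρ (x ++ blk Δ ++ blk Γ ++ z) y :=
    ht.of_append (hχ.append (by simpa using hφ.whisker x (blk Γ ++ z)))
  rw [← sheaf_map_fm] at hφ hχ hρ
  rw [← sheaf_map_fm, ← sheaf_map_fm Δ] at h
  rw [← sheaf_map_fm Γ] at hρ ⊢
  have e := ((conv_big_right (W' := Γ.map .fm) hφ).whisker x z).append_right (z := y) (φ := incl ρ)
    (by simpa using typed_incl _ _ _ hρ)
  have e₁ := (conv_incl h).append_right (z := y) (φ := [⟨x, .big (Γ.map .fm) (Δ.map .fm), z⟩] ++ incl ρ)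
    (Typed.append (y := x ++ sheaf (Δ.map .fm) ++ sheaf (Γ.map .fm) ++ z) (typed_slice _ _ _ (by simp [FGate.dom]) (by simp [FGate.cod]))
      (typed_incl _ _ _ hρ))
  have e₂ := Conv.append_left (typed_incl _ _ _ hχ) e
  simp only [whisker_append, incl_append, incl_whisker, whisker_whisker, List.append_assoc, List.append_nil,
    List.nil_append, whisker_cons, whisker_nil] at e₁ e₂ ⊢
  exact e₁.trans e₂

/-- A right premise is drawn below the left one, so the three premises already precede all other
gates and no interchange is needed. -/
theorem binary_right_source (Γ Θ Δ : List (Formula α)) (b c : BinRule α)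
    (d₁ : Deriv (Θ ++ [c.left])) (d₂ : Deriv (Γ ++ [b.left]))
    (d₃ : Deriv (b.right :: c.right :: Δ)) {ψ ψ₁ ψ₂ : List (Slice (Color α) (CGate α))}
    (h₁ : Draws d₁ ψ₁) (h₂ : Draws d₂ ψ₂) (h : Draws d₃ ψ) :
    Draws (.binary c d₁ (.ex (.block [] (Γ ++ b.prin) [c.right] Δ) (.binary b d₂ d₃) :
          Deriv (c.right :: (Γ ++ b.prin ++ Δ))) : Deriv (Θ ++ c.prin ++ (Γ ++ b.prin ++ Δ)))
      (ψ₁ ++ whisker (blk (Θ ++ [c.left])) ψ₂ []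
          ++ whisker (blk (Θ ++ [c.left]) ++ blk (Γ ++ [b.left])) ψ []
          ++ [⟨blk (Θ ++ [c.left]) ++ .L :: fw Γ, .bin b, fw (c.right :: Δ) ++ [.R]⟩]
          ++ whisker (blk (Θ ++ [c.left]) ++ [.L]) (cross (Γ ++ b.prin) [c.right]) (fw Δ ++ [.R])
          ++ [⟨.L :: fw Θ, .bin c, fw (Γ ++ b.prin ++ Δ) ++ [.R]⟩]) := by
  have hτ : Realizes (whisker [] (cross (Γ ++ b.prin) [c.right]) (fw Δ))
      (.block [] (Γ ++ b.prin) [c.right] Δ :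
        Reorder (Γ ++ b.prin ++ c.right :: Δ) (c.right :: (Γ ++ b.prin ++ Δ))) := by
    refine realizes_of_trace ((swapOnly_cross _ _).whisker _ _)
      (by simpa using (typed_cross (Γ ++ b.prin) [c.right]).whisker [] (fw Δ)) fun i => ?_
    rw [trace_whisker, trace_cross, Reorder.fn_block]
    simp only [List.length_append, List.length_cons, List.length_nil]
    grind
  have hR := Represents.binary (Δ := Γ ++ b.prin ++ Δ) c (represents_diag d₁)
    (.ex (.binary b (represents_diag d₂) (represents_diag d₃)) hτ)
  have c3 := conv_closed₃ (w := blk (Θ ++ c.prin ++ (Γ ++ b.prin ++ Δ)))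
    (χ := [⟨blk (Θ ++ [c.left]) ++ .L :: fw Γ, .bin b, fw (c.right :: Δ) ++ [.R]⟩]
          ++ whisker (blk (Θ ++ [c.left]) ++ [.L]) (cross (Γ ++ b.prin) [c.right]) (fw Δ ++ [.R])
          ++ [⟨.L :: fw Θ, .bin c, fw (Γ ++ b.prin ++ Δ) ++ [.R]⟩]) h₁ h₂ h
      rfl rfl (by simpa [blk] using hR.typed)
  refine hR.draws (?_)
  simpa [blk] using c3

/-- Only `d₂` is out of place. It sinks below `d₁`, `d₃` and the first crossing, the position it
takes when it has slid through the `B`-gate. -/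
theorem binary_right_target (Γ Θ Δ : List (Formula α)) (b c : BinRule α)
    (d₁ : Deriv (Θ ++ [c.left])) (d₂ : Deriv (Γ ++ [b.left]))
    (d₃ : Deriv (b.right :: c.right :: Δ)) {ψ ψ₁ ψ₂ : List (Slice (Color α) (CGate α))}
    (h₁ : Draws d₁ ψ₁) (h₂ : Draws d₂ ψ₂) (h : Draws d₃ ψ) :
    Draws (.ex (.block [] (Γ ++ b.prin) (Θ ++ c.prin) Δ)
          (.binary b d₂ (.ex (.block [] (Θ ++ c.prin) [b.right] Δ)
            (.binary c d₁ (.ex (.block [] [b.right] [c.right] Δ) d₃ :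
              Deriv (c.right :: b.right :: Δ))) :
            Deriv (b.right :: (Θ ++ c.prin ++ Δ)))) : Deriv (Θ ++ c.prin ++ (Γ ++ b.prin ++ Δ)))
      (ψ₁ ++ whisker (blk (Θ ++ [c.left])) ψ []
          ++ whisker (blk (Θ ++ [c.left]) ++ [.L]) (cross [b.right] [c.right]) (fw Δ ++ [.R])
          ++ whisker [] ψ₂ (blk (Θ ++ [c.left]) ++ blk (c.right :: b.right :: Δ))
          ++ [⟨blk (Γ ++ [b.left]) ++ .L :: fw Θ, .bin c, fw (b.right :: Δ) ++ [.R]⟩]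
          ++ whisker (blk (Γ ++ [b.left]) ++ .L :: fw Θ) (cross c.prin [b.right]) (fw Δ ++ [.R])
          ++ whisker (blk (Γ ++ [b.left]) ++ [.L]) (cross Θ [b.right]) (fw (c.prin ++ Δ) ++ [.R])
          ++ [⟨.L :: fw Γ, .bin b, fw (Θ ++ c.prin ++ Δ) ++ [.R]⟩]
          ++ whisker [.L] (cross (Γ ++ b.prin) (Θ ++ c.prin)) (fw Δ ++ [.R])) := by
  have hτ : Realizes (whisker [] (cross [b.right] [c.right]) (fw Δ))
      (.block [] [b.right] [c.right] Δ :
        Reorder (b.right :: c.right :: Δ) (c.right :: b.right :: Δ)) := by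
    refine realizes_of_trace ((swapOnly_cross _ _).whisker _ _)
      (by simpa using (typed_cross [b.right] [c.right]).whisker [] (fw Δ)) fun i => ?_
    rw [trace_whisker, trace_cross, Reorder.fn_block]
    simp only [List.length_cons, List.length_nil]
    grind
  have hτ₁ : Realizes (whisker (fw Θ) (cross c.prin [b.right]) (fw Δ)
        ++ whisker [] (cross Θ [b.right]) (fw (c.prin ++ Δ)))
      (.block [] (Θ ++ c.prin) [b.right] Δ :
        Reorder (Θ ++ c.prin ++ b.right :: Δ) (b.right :: (Θ ++ c.prin ++ Δ))) := by
    refine realizes_of_trace (((swapOnly_cross _ _).whisker _ _).append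
      ((swapOnly_cross _ _).whisker _ _)) (Typed.append (y := fw (Θ ++ [b.right] ++ c.prin ++ Δ))
      (by simpa using (typed_cross c.prin [b.right]).whisker (fw Θ) (fw Δ))
      (by simpa using (typed_cross Θ [b.right]).whisker [] (fw (c.prin ++ Δ)))) fun i => ?_
    rw [trace_append, Reorder.fn_block]
    generalize h₁ : trace (whisker [] (cross Θ [b.right]) (fw (c.prin ++ Δ))) i = j₁
    simp only [trace_whisker, trace_cross, length_fw, List.length_append, List.length_cons,
      List.length_nil] at h₁ ⊢
    split_ifs at h₁ <;> split_ifs <;> omega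
  have hτ₂ : Realizes (whisker [] (cross (Γ ++ b.prin) (Θ ++ c.prin)) (fw Δ))
      (.block [] (Γ ++ b.prin) (Θ ++ c.prin) Δ :
        Reorder (Γ ++ b.prin ++ (Θ ++ c.prin ++ Δ)) (Θ ++ c.prin ++ (Γ ++ b.prin ++ Δ))) := by
    refine realizes_of_trace ((swapOnly_cross _ _).whisker _ _)
      (by simpa using (typed_cross (Γ ++ b.prin) (Θ ++ c.prin)).whisker [] (fw Δ)) fun i => ?_
    rw [trace_whisker, trace_cross, Reorder.fn_block]
    simp only [List.length_append]
    grind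
  have hR := Represents.ex (.binary (Δ := Θ ++ c.prin ++ Δ) b (represents_diag d₂)
    (.ex (.binary (Δ := b.right :: Δ) c (represents_diag d₁) (.ex (represents_diag d₃) hτ)) hτ₁)) hτ₂
  have t₁ : (control α).Typed (whisker [.L] (cross [b.right] [c.right]) (fw Δ ++ [.R]))
      (blk (b.right :: c.right :: Δ)) (blk (c.right :: b.right :: Δ)) := by
    simpa [blk] using (typed_cross [b.right] [c.right]).whisker [.L] (fw Δ ++ [.R])
  have t₂ := (typed_diag d₁).append (show (control α).Typed
      (whisker (blk (Θ ++ [c.left])) (diag d₃ ++ whisker [.L] (cross [b.right] [c.right]) (fw Δ ++ [.R])) [])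
      _ (blk (Θ ++ [c.left]) ++ blk (c.right :: b.right :: Δ)) by
    simpa using ((typed_diag d₃).append t₁).whisker (blk (Θ ++ [c.left])) [])
  have c1 := conv_interchange_ctx (P := control α) (p := []) (q := blk (Θ ++ c.prin ++ (Γ ++ b.prin ++ Δ)))
    (χ := [])
    (χ' := [⟨blk (Γ ++ [b.left]) ++ .L :: fw Θ, .bin c, fw (b.right :: Δ) ++ [.R]⟩]
          ++ whisker (blk (Γ ++ [b.left]) ++ .L :: fw Θ) (cross c.prin [b.right]) (fw Δ ++ [.R])
          ++ whisker (blk (Γ ++ [b.left]) ++ [.L]) (cross Θ [b.right]) (fw (c.prin ++ Δ) ++ [.R])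
          ++ [⟨.L :: fw Γ, .bin b, fw (Θ ++ c.prin ++ Δ) ++ [.R]⟩]
          ++ whisker [.L] (cross (Γ ++ b.prin) (Θ ++ c.prin)) (fw Δ ++ [.R])) [] [] []
    (typed_diag d₂) t₂ rfl rfl (by simpa [blk] using hR.typed)
  have c6 := (((Conv.append h₁ (by simpa using h.whisker (blk (Θ ++ [c.left])) [])).append_right
    (z := blk (Θ ++ [c.left]) ++ blk (c.right :: b.right :: Δ)) (φ := whisker (blk (Θ ++ [c.left]) ++ [.L]) (cross [b.right] [c.right]) (fw Δ ++ [.R]))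
    (by simpa [blk] using t₁.whisker (blk (Θ ++ [c.left])) []))).append
    (by simpa using h₂.whisker [] (blk (Θ ++ [c.left]) ++ blk (c.right :: b.right :: Δ)))
  have c7 := c6.append_right (z := blk (Θ ++ c.prin ++ (Γ ++ b.prin ++ Δ))) (φ :=
          [⟨blk (Γ ++ [b.left]) ++ .L :: fw Θ, .bin c, fw (b.right :: Δ) ++ [.R]⟩]
          ++ whisker (blk (Γ ++ [b.left]) ++ .L :: fw Θ) (cross c.prin [b.right]) (fw Δ ++ [.R])
          ++ whisker (blk (Γ ++ [b.left]) ++ [.L]) (cross Θ [b.right]) (fw (c.prin ++ Δ) ++ [.R])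
          ++ [⟨.L :: fw Γ, .bin b, fw (Θ ++ c.prin ++ Δ) ++ [.R]⟩]
          ++ whisker [.L] (cross (Γ ++ b.prin) (Θ ++ c.prin)) (fw Δ ++ [.R]))
    (Typed.of_append (by simpa [blk] using c1.typed_right) c6.typed_left)
  refine hR.draws ?_
  simp only [whisker_append, whisker_whisker, List.append_assoc, List.append_nil, List.nil_append,
    blk, fw_append, fw_cons, fw_nil, List.cons_append, whisker_cons,
    whisker_nil_nil] at c1 c7 ⊢
  exact c1.trans c7

/-! ### From equivalent derivations to equal diagrams -/

/-- Two derivations whose diagrams are equal in the category presented by the polygraph of proof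
diagrams. -/
def FullConv {Γ : List (Formula α)} (d d' : Deriv Γ) : Prop :=
  (full α).Conv [] (blk Γ) (incl (diag d)) (incl (diag d'))

theorem DiagConv.fullConv {Γ : List (Formula α)} {d d' : Deriv Γ} (h : DiagConv d d') :
    FullConv d d' :=
  conv_incl h

theorem exists_irreducible_draws {Γ : List (Formula α)} (d : Deriv Γ) :
    ∃ ψ : (control α).Diagram [] (blk Γ), ψ.Irreducible ∧ Draws d ψ.slices :=
  exists_irreducible ⟨diag d, typed_diag d⟩

@[simp] theorem cross_nil_right (X : List (Formula α)) : cross X [] = [] := rfl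

@[simp] theorem cross_nil_left (Y : List (Formula α)) : cross [] Y = [] := by
  induction Y with
  | nil => rfl
  | cons b Y ih => simp [cross, cross₁, ih]

theorem noControl_nil : NoControl ([] : List (Slice (Color α) (CGate α))) := by
  simp [NoControl]

/-- Irreducible diagrams of the premises are fed to `big_intro_left`, and the `B`-gate that appears
is removed by sliding the diagram of `d₃` through it. -/
theorem full_binary_left (Γ Θ Δ : List (Formula α)) (b c : BinRule α)
    (d₁ : Deriv (Γ ++ [c.left] ++ [b.left])) (d₂ : Deriv (b.right :: Θ))
    (d₃ : Deriv (c.right :: Δ)) :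
    FullConv (.binary c (.ex (.block Γ [c.left] (b.prin ++ Θ) []) (.binary b d₁ d₂) :
          Deriv (Γ ++ b.prin ++ Θ ++ [c.left])) d₃)
        (.ex (.block Γ (c.prin ++ Δ) (b.prin ++ Θ) [])
          (.binary b (.ex (.block Γ [b.left] (c.prin ++ Δ) [])
            (.binary c (.ex (.block Γ [c.left] [b.left] []) d₁ :
              Deriv (Γ ++ [b.left] ++ [c.left])) d₃) :
            Deriv (Γ ++ c.prin ++ Δ ++ [b.left])) d₂)) := by
  obtain ⟨φ, hφ, h⟩ := exists_irreducible_draws d₁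
  obtain ⟨φ₁, hφ₁, h₁⟩ := exists_irreducible_draws d₂
  obtain ⟨φ₂, hφ₂, h₂⟩ := exists_irreducible_draws d₃
  have hs := conv_incl (binary_left_source Γ Θ Δ b c d₁ d₂ d₃ h h₁ h₂)
  have ht := binary_left_target Γ Θ Δ b c d₁ d₂ d₃ h h₁ h₂
  -- The moved strings are reduced to `c.left`, with `Z`, `N` and `N'` empty and `φ₀ = φ`, so the
  -- required factorisation of `φ` is trivial.
  have hcell := FullCell.big_intro_left b c Γ [c.left] [b.left] [] Θ Δ φ φ₁ φ₂
    ⟨[], rfl⟩ ⟨φ.slices, by simpa using φ.typed⟩ ⟨[], rfl⟩ hφ hφ₁ hφ₂ (irreducible_nil _) (irreducible_nil _) noControl_nil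
    noControl_nil (by simpa [SameDiagram] using .refl _)
  have tχ : (control α).Typed (φ.slices ++ whisker (blk (Γ ++ [c.left] ++ [b.left])) φ₁.slices []
          ++ whisker (.L :: fw Γ) (cross [c.left] [b.left]) (.R :: blk (b.right :: Θ))) []
      (blk (Γ ++ [b.left] ++ [c.left]) ++ blk (b.right :: Θ)) := by
    refine Typed.append (φ.typed.append (by simpa using φ₁.typed.whisker (blk (Γ ++ [c.left] ++ [b.left])) []))
      (by simpa [blk] using (typed_cross [c.left] [b.left]).whisker (.L :: fw Γ) (.R :: blk (b.right :: Θ)))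
  -- The crossing of `c.left` and `b.left` is lifted above `φ₂`, which then lies directly above the
  -- `B`-gate.
  have c1 := conv_interchange_ctx' (P := control α) (p := [])
    (q := blk (Γ ++ [b.left] ++ [c.left]) ++ blk (b.right :: Θ) ++ blk (c.right :: Δ))
    (χ := φ.slices ++ whisker (blk (Γ ++ [c.left] ++ [b.left])) φ₁.slices [])
    (χ' := []) (.L :: fw Γ) (.R :: blk (b.right :: Θ)) [] (typed_cross [c.left] [b.left]) φ₂.typed rfl rfl
    (by
      refine Typed.append (Typed.append (Typed.append (φ.typed.append
        (by simpa using φ₁.typed.whisker (blk (Γ ++ [c.left] ++ [b.left])) []))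
        (by simpa [blk] using φ₂.typed.whisker (blk (Γ ++ [c.left] ++ [b.left]) ++ blk (b.right :: Θ)) []))
        (by simpa [blk] using (typed_cross [c.left] [b.left]).whisker (.L :: fw Γ) (.R :: (blk (b.right :: Θ) ++ blk (c.right :: Δ)))))
        (by simp [blk, Typed]))
  have hu := conv_untangle (x := blk (Γ ++ [b.left] ++ [c.left])) (z := []) φ₂.typed (by simpa using tχ)
    (by simpa [blk] using c1) rfl (by simp only [List.append_assoc, List.append_nil]; rfl) ht.typed_right
  refine hs.trans (.trans ?_ (hu.trans (conv_incl ht).symm))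
  have hl := hs.typed_right
  have hr := hu.typed_left
  refine .trans (.of_eq hl ?_) ((Conv.of_cell (P := full α) hcell ?_ ?_).trans (.of_eq ?_ ?_))
  · simp
  · simpa using hl
  · simpa [blk] using hr
  · simpa [blk] using hr
  · simp [blk]

theorem full_binary_right (Γ Θ Δ : List (Formula α)) (b c : BinRule α)
    (d₁ : Deriv (Θ ++ [c.left])) (d₂ : Deriv (Γ ++ [b.left]))
    (d₃ : Deriv (b.right :: c.right :: Δ)) :
    FullConv (.binary c d₁ (.ex (.block [] (Γ ++ b.prin) [c.right] Δ) (.binary b d₂ d₃) :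
          Deriv (c.right :: (Γ ++ b.prin ++ Δ))))
        (.ex (.block [] (Γ ++ b.prin) (Θ ++ c.prin) Δ)
          (.binary b d₂ (.ex (.block [] (Θ ++ c.prin) [b.right] Δ)
            (.binary c d₁ (.ex (.block [] [b.right] [c.right] Δ) d₃ :
              Deriv (c.right :: b.right :: Δ))) :
            Deriv (b.right :: (Θ ++ c.prin ++ Δ))))) := by
  obtain ⟨ψ, hψ, h⟩ := exists_irreducible_draws d₃
  obtain ⟨ψ₁, hψ₁, h₁⟩ := exists_irreducible_draws d₁
  obtain ⟨ψ₂, hψ₂, h₂⟩ := exists_irreducible_draws d₂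
  have hs := conv_incl (binary_right_source Γ Θ Δ b c d₁ d₂ d₃ h₁ h₂ h)
  have ht := binary_right_target Γ Θ Δ b c d₁ d₂ d₃ h₁ h₂ h
  -- The mirror choice: `X` is empty and `Z` is the single formula `c.right`.
  have hcell := FullCell.big_intro_right b c Δ [] [b.right] [c.right] Γ Θ ψ ψ₁ ψ₂
    ⟨[], rfl⟩ ψ ⟨[], rfl⟩ hψ hψ₁ hψ₂ (irreducible_nil _) (irreducible_nil _) noControl_nil
    noControl_nil (by simpa [SameDiagram] using .refl _)
  have tψ : (control α).Typed
      (ψ.slices ++ whisker [.L] (cross [b.right] [c.right]) (fw Δ ++ [.R])) []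
      (blk (c.right :: b.right :: Δ)) :=
    ψ.typed.append (by simpa [blk] using (typed_cross [b.right] [c.right]).whisker [.L] (fw Δ ++ [.R]))
  have tχ : (control α).Typed (ψ₁.slices ++ whisker (blk (Θ ++ [c.left])) (ψ.slices ++
      whisker [.L] (cross [b.right] [c.right]) (fw Δ ++ [.R])) []) []
      (blk (Θ ++ [c.left]) ++ blk (c.right :: b.right :: Δ)) :=
    ψ₁.typed.append (by simpa using tψ.whisker (blk (Θ ++ [c.left])) [])
  -- Here `ψ₂` is the diagram that slides through the `B`-gate; it is brought next to it, below `ψ`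
  -- and its crossing.
  have c1 := conv_interchange_ctx (P := control α) (p := [])
    (q := blk (Θ ++ [c.left]) ++ blk (Γ ++ [b.left]) ++ blk (c.right :: b.right :: Δ))
    (χ := ψ₁.slices) (χ' := []) (blk (Θ ++ [c.left])) [] [] ψ₂.typed tψ rfl rfl
    (by
      refine Typed.append (Typed.append (ψ₁.typed.append
        (by simpa using ψ₂.typed.whisker (blk (Θ ++ [c.left])) []))
        (by simpa using tψ.whisker (blk (Θ ++ [c.left]) ++ blk (Γ ++ [b.left])) []))
        (by simp [Typed]))
  have hu := conv_untangle (x := []) (z := blk (c.right :: b.right :: Δ)) ψ₂.typed (by simpa using tχ)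
    (by simpa [blk] using c1) rfl
    (by simp only [List.append_assoc]; rfl)
    ht.typed_right
  refine hs.trans (.trans ?_ (hu.trans (conv_incl ht).symm))
  have hl := hs.typed_right
  have hr := hu.typed_left
  refine .trans (.of_eq hl ?_) ((Conv.of_cell (P := full α) hcell ?_ ?_).trans (.of_eq ?_ ?_))
  · simp
  · simpa using hl
  · simpa [blk] using hr
  · simpa [blk] using hr
  · simp [blk]

/-- Among the generators only `binary_left` and `binary_right` use `B`-gates; the others are already
conversions in the control polygraph. -/
theorem fullConv_of_stdEquiv {Γ : List (Formula α)} {d d' : Deriv Γ} (h : d.StdEquiv d') :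
    FullConv d d' := by
  induction h with
  | refl d => exact .refl (typed_incl _ _ _ (typed_diag d))
  | symm _ ih => exact ih.symm
  | trans _ _ ih ih' => exact ih.trans ih'
  | @congr_unary Γ r d d' _ ih =>
    have h (e : Deriv (Γ ++ r.act)) :=
      (Represents.unary r (represents_diag e)).conv_diag.symm
    refine (conv_incl (h d)).trans (.trans ?_ (conv_incl (h d')).symm)
    have t := typed_append.1 (by simpa using typed_incl _ _ _ (h d).typed_right)
    obtain ⟨z, h1, h2⟩ := t
    simpa using ih.append_right (ih.typed_left.unique h1 ▸ h2)
  | @congr_binary Γ Δ b d d' e e' _ _ ih ih' =>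
    have h (d : Deriv (Γ ++ [b.left])) (e : Deriv (b.right :: Δ)) :=
      (Represents.binary b (represents_diag d) (represents_diag e)).conv_diag.symm
    refine (conv_incl (h d e)).trans (.trans ?_ (conv_incl (h d' e')).symm)
    have c := ih.append (by simpa using ih'.whisker (blk (Γ ++ [b.left])) [])
    have t := typed_incl _ _ _ (h d e).typed_right
    rw [incl_append, incl_append, incl_whisker] at t
    simpa [incl_whisker] using c.append_right (Typed.of_append t c.typed_left)
  | @congr_ex Γ Δ σ d d' _ ih =>
    have h (d : Deriv Γ) := (Represents.ex (represents_diag d) (realizes_twist σ)).conv_diag.symm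
    refine (conv_incl (h d)).trans (.trans ?_ (conv_incl (h d')).symm)
    have t := typed_incl _ _ _ (h d).typed_right
    rw [incl_append] at t
    simpa using ih.append_right (Typed.of_append t ih.typed_left)
  | ex_refl d =>
    have h := Represents.ex (σ := .refl _) (represents_diag d) (realizes_nil rfl)
    exact (h.conv_of (represents_diag d) (.of_eq h.typed (by simp))).fullConv
  | ex_trans σ τ d =>
    refine DiagConv.fullConv ?_
    have h := Represents.ex (.ex (represents_diag d) (realizes_twist σ)) (realizes_twist τ)
    have h' := Represents.ex (represents_diag d) ((realizes_twist σ).trans (realizes_twist τ))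
    exact h.conv_of h' (.of_eq h.typed (by simp))
  | ex_unary ρ r d => exact (conv_ex_unary ρ r d).fullConv
  | ex_binary ρ τ b d e => exact (conv_ex_binary ρ τ b d e).fullConv
  | ex_ax A => exact (conv_ex_ax A).fullConv
  | unary_unary Γ Δ Θ r s d => exact (conv_unary_unary Γ Δ Θ r s d).fullConv
  | unary_right Δ Γ Θ b r d e => exact (conv_unary_right Δ Γ Θ b r d e).fullConv
  | unary_left Γ Θ Δ b r d e => exact (conv_unary_left Γ Θ Δ b r d e).fullConv
  | binary_mid Γ Θ Δ b c d₁ d₂ d₃ => exact (conv_binary_mid Γ Θ Δ b c d₁ d₂ d₃).fullConv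
  | binary_left Γ Θ Δ b c d₁ d₂ d₃ => exact full_binary_left Γ Θ Δ b c d₁ d₂ d₃
  | binary_right Γ Θ Δ b c d₁ d₂ d₃ => exact full_binary_right Γ Θ Δ b c d₁ d₂ d₃

theorem diagEquiv_of_stdEquiv {Γ : List (Formula α)} {d d' : Deriv Γ} (h : d.StdEquiv d') :
    DiagEquiv d d' :=
  ⟨⟨diag d, typed_diag d⟩, ⟨diag d', typed_diag d'⟩, represents_diag d, represents_diag d',
    (fullConv_of_stdEquiv h).2.2⟩

/-! ### Classes of derivations -/

/-- Derivations of a sequent up to the standard equivalence. -/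
def derivSetoid (Γ : List (Formula α)) : Setoid (Deriv Γ) :=
  ⟨Deriv.StdEquiv, Deriv.StdEquiv.refl, Deriv.StdEquiv.symm, Deriv.StdEquiv.trans⟩

/-- A sequent together with a class of derivations of it. -/
abbrev Item (α : Type u) : Type u := Σ Γ : List (Formula α), Quotient (derivSetoid Γ)

/-- The class of a derivation. -/
def mk {Γ : List (Formula α)} (d : Deriv Γ) : Item α := ⟨Γ, Quotient.mk (derivSetoid Γ) d⟩

@[simp] theorem mk_fst {Γ : List (Formula α)} (d : Deriv Γ) : (mk d).1 = Γ := rfl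

theorem exists_mk (x : Item α) : ∃ d : Deriv x.1, mk d = x := by
  obtain ⟨Γ, q⟩ := x
  obtain ⟨d, rfl⟩ := Quotient.exists_rep q
  exact ⟨d, rfl⟩

theorem mk_eq_iff {Γ : List (Formula α)} {d e : Deriv Γ} : mk d = mk e ↔ d.StdEquiv e := by
  refine ⟨fun h => Quotient.exact (s := derivSetoid Γ) (eq_of_heq (Sigma.mk.inj h).2), fun h => ?_⟩
  exact congrArg (Sigma.mk Γ) (Quotient.sound (s := derivSetoid Γ) h)

/-- The sequent is part of an item, so the two sides can be equated without a cast;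
`Reorder.getElem?_eq` supplies the equality of the two lists. -/
theorem mk_ex_of_fn {Γ Δ : List (Formula α)} {σ : Reorder Γ Δ} (h : ∀ i, σ.fn i = i)
    (d : Deriv Γ) : mk (.ex σ d) = mk d := by
  obtain rfl : Γ = Δ := List.ext_getElem? fun i => by rw [σ.getElem?_eq, h]
  obtain rfl : σ = .refl Γ := Reorder.ext_fn fun i => by simp [h]
  exact mk_eq_iff.2 (.ex_refl d)

@[simp] theorem mk_recast {Γ Δ : List (Formula α)} (d : Deriv Γ) (h : Γ = Δ) :
    mk (d.recast h) = mk d :=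
  mk_ex_of_fn (by simp) d

theorem mk_ex_ex {Γ Δ Θ : List (Formula α)} (σ : Reorder Γ Δ) (τ : Reorder Δ Θ) (d : Deriv Γ) :
    mk (.ex τ (.ex σ d)) = mk (.ex (σ.trans τ) d) :=
  mk_eq_iff.2 (.ex_trans σ τ d)

theorem fst_eq_of_mk_eq {Γ Γ' : List (Formula α)} {d : Deriv Γ} {d' : Deriv Γ'}
    (h : mk d = mk d') : Γ = Γ' :=
  congrArg Sigma.fst h

/-- Source and target lists may be spelled differently on the two sides: the first are identified by
`h`, the second by the values of `fn`. -/
theorem mk_ex_congr {Γ Γ' Δ Δ' : List (Formula α)} {σ : Reorder Γ Δ} {σ' : Reorder Γ' Δ'}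
    {d : Deriv Γ} {d' : Deriv Γ'} (h : mk d = mk d') (hσ : ∀ i, σ.fn i = σ'.fn i) :
    mk (.ex σ d) = mk (.ex σ' d') := by
  obtain rfl := fst_eq_of_mk_eq h
  obtain rfl : Δ = Δ' := List.ext_getElem? fun i => by rw [σ.getElem?_eq, σ'.getElem?_eq, hσ]
  obtain rfl := Reorder.ext_fn hσ
  exact mk_eq_iff.2 (.congr_ex _ (mk_eq_iff.1 h))

theorem mk_unary_congr {Γ Γ' : List (Formula α)} {r : UnRule α} {d : Deriv (Γ ++ r.act)}
    {d' : Deriv (Γ' ++ r.act)} (h : mk d = mk d') : mk (.unary r d) = mk (.unary r d') := by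
  obtain rfl : Γ = Γ' := by simpa using fst_eq_of_mk_eq h
  exact mk_eq_iff.2 (.congr_unary _ (mk_eq_iff.1 h))

theorem mk_binary_congr {Γ Γ' Δ Δ' : List (Formula α)} {b : BinRule α}
    {d : Deriv (Γ ++ [b.left])} {d' : Deriv (Γ' ++ [b.left])} {e : Deriv (b.right :: Δ)}
    {e' : Deriv (b.right :: Δ')} (h : mk d = mk d') (h' : mk e = mk e') :
    mk (.binary b d e) = mk (.binary b d' e') := by
  obtain rfl : Γ = Γ' := by simpa using fst_eq_of_mk_eq h
  obtain rfl : Δ = Δ' := by simpa using fst_eq_of_mk_eq h'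
  exact mk_eq_iff.2 (.congr_binary _ (mk_eq_iff.1 h) (mk_eq_iff.1 h'))

theorem mk_unaryAt_congr {Γ Γ' Δ Δ' : List (Formula α)} {r : UnRule α}
    {d : Deriv (Γ ++ r.act ++ Δ)} {d' : Deriv (Γ' ++ r.act ++ Δ')} (h : mk d = mk d')
    (hΓ : Γ = Γ') : mk (.unaryAt Γ r Δ d) = mk (.unaryAt Γ' r Δ' d') := by
  subst hΓ
  obtain rfl : Δ = Δ' := by simpa using fst_eq_of_mk_eq h
  exact mk_ex_congr (mk_unary_congr (mk_ex_congr h fun _ => rfl)) fun _ => rfl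

/-- A rearrangement of the context of some consecutive formulas. -/
def Reorder.around {Γ Δ Γ' Δ' : List (Formula α)} (ρ : Reorder (Γ ++ Δ) (Γ' ++ Δ'))
    (X : List (Formula α)) : Reorder (Γ ++ X ++ Δ) (Γ' ++ X ++ Δ') :=
  (Reorder.block Γ X Δ []).trans ((ρ.append (.refl X)).trans (.block Γ' Δ' X []))

theorem Reorder.fn_block_block (Γ X Y : List (Formula α)) {S T S' T' : List (Formula α)}
    (hS : S = Γ ++ (X ++ Y) ++ []) (hT : T = Γ ++ (Y ++ X) ++ []) (hS' : S' = Γ ++ (Y ++ X) ++ [])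
    (hT' : T' = Γ ++ (X ++ Y) ++ []) (i : ℕ) :
    (Reorder.block Γ X Y [] hS hT).fn ((Reorder.block Γ Y X [] hS' hT').fn i) = i := by
  simp only [fn_block]
  grind

theorem Reorder.fn_around {Γ Δ Γ' Δ' : List (Formula α)} (ρ : Reorder (Γ ++ Δ) (Γ' ++ Δ'))
    (X : List (Formula α)) (i : ℕ) : (ρ.around X).fn i =
      if Γ'.length ≤ i ∧ i < Γ'.length + X.length then Γ.length + (i - Γ'.length)
      else if ρ.fn (if i < Γ'.length then i else i - X.length) < Γ.length
        then ρ.fn (if i < Γ'.length then i else i - X.length)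
        else ρ.fn (if i < Γ'.length then i else i - X.length) + X.length := by
  have h1 := ρ.length_eq
  have h2 (j : ℕ) := ρ.fn_lt (i := j)
  have h4 (j : ℕ) := ρ.fn_of_le (i := j)
  simp only [around, fn_trans, fn_append, fn_refl, List.length_append] at *
  rw [fn_block Γ' Δ' X []]
  generalize hj : (if i < Γ'.length then i else if i < Γ'.length + X.length then i + Δ'.length else
    if i < Γ'.length + X.length + Δ'.length then i - X.length else i) = j
  generalize hl : (if j < Γ'.length + Δ'.length then ρ.fn j
    else Γ'.length + Δ'.length + (j - (Γ'.length + Δ'.length))) = l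
  rw [fn_block]
  have h3 := h2 j
  have h5 := h4 j
  have h6 := h2 (i - X.length)
  have h7 := h4 (i - X.length)
  have h8 := h2 i
  have h9 := h4 i
  clear h2 h4
  split_ifs at hj <;> subst hj <;> split_ifs at hl <;> subst hl <;> grind

/-- `unaryAt` moves the active formulas to the end and `around` brings them back, so consecutive
block exchanges cancel and the claim becomes `ex_unary` for the exchange `ρ` of the context. -/
theorem mk_unaryAt_ex {Γ Δ Γ' Δ' : List (Formula α)} (ρ : Reorder (Γ ++ Δ) (Γ' ++ Δ'))
    (r : UnRule α) (d : Deriv (Γ ++ r.act ++ Δ)) :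
    mk (.unaryAt Γ' r Δ' (.ex (ρ.around r.act) d)) =
      mk (.ex (ρ.around [r.prin]) (.unaryAt Γ r Δ d)) := by
  have e : mk (.ex (.block Γ' r.act Δ' []) (.ex (ρ.around r.act) d) : Deriv (Γ' ++ Δ' ++ r.act)) =
      mk (.ex (ρ.append (.refl r.act)) (.ex (.block Γ r.act Δ [] : Reorder _ (Γ ++ Δ ++ r.act)) d)) := by
    rw [mk_ex_ex, mk_ex_ex]
    refine mk_ex_congr rfl fun i => ?_
    simp only [Reorder.around, Reorder.fn_trans, Reorder.fn_block_block]
  have e' := (mk_unary_congr e).trans (mk_eq_iff.2 (.ex_unary _ _ _))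
  rw [Deriv.unaryAt, mk_ex_congr (σ' := .block Γ' Δ' [r.prin] []) e' (fun _ => rfl), mk_ex_ex]
  rw [Deriv.unaryAt, mk_ex_ex]
  refine mk_ex_congr rfl fun i => ?_
  simp only [Reorder.around, Reorder.fn_trans, Reorder.fn_block_block]

/-! ### Gates that act inside a sequent -/

/-- Gates without control strings. -/
inductive Loc (α : Type u) : Type u
  | un (r : UnRule α)
  | swap (A B : Formula α)

namespace Loc

def gate : Loc α → CGate α
  | .un r => .un r
  | .swap A B => .swap A B

def dom : Loc α → List (Formula α)
  | .un r => r.act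
  | .swap A B => [A, B]

def cod : Loc α → List (Formula α)
  | .un r => [r.prin]
  | .swap A B => [B, A]

theorem gate_dom (l : Loc α) : l.gate.dom = fw l.dom := by cases l <;> rfl

theorem gate_cod (l : Loc α) : l.gate.cod = fw l.cod := by cases l <;> rfl

/-- The action on derivations. -/
def op (Γ Δ : List (Formula α)) : (l : Loc α) → Deriv (Γ ++ l.dom ++ Δ) → Deriv (Γ ++ l.cod ++ Δ)
  | .un r, d => .unaryAt Γ r Δ d
  | .swap A B, d => .ex (.block Γ [A] [B] Δ (by simp [dom]) (by simp [cod])) d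

theorem mk_op_congr {Γ Γ' Δ Δ' : List (Formula α)} {l : Loc α} {d : Deriv (Γ ++ l.dom ++ Δ)}
    {d' : Deriv (Γ' ++ l.dom ++ Δ')} (h : mk d = mk d') (hΓ : Γ = Γ') :
    mk (l.op Γ Δ d) = mk (l.op Γ' Δ' d') := by
  cases l with
  | un r => exact mk_unaryAt_congr h hΓ
  | swap A B =>
    subst hΓ
    obtain rfl : Δ = Δ' := by simpa using fst_eq_of_mk_eq h
    exact mk_ex_congr h fun _ => rfl

theorem mk_op_ex {Γ Δ Γ' Δ' : List (Formula α)} (ρ : Reorder (Γ ++ Δ) (Γ' ++ Δ'))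
    (l : Loc α) (d : Deriv (Γ ++ l.dom ++ Δ)) :
    mk (l.op Γ' Δ' (.ex (ρ.around l.dom) d)) = mk (.ex (ρ.around l.cod) (l.op Γ Δ d)) := by
  cases l with
  | un r => exact mk_unaryAt_ex ρ r d
  | swap A B =>
    simp only [op]
    rw [mk_ex_ex, mk_ex_ex]
    refine mk_ex_congr rfl fun i => ?_
    have h1 := ρ.length_eq
    simp only [Reorder.fn_trans, Reorder.fn_around, Reorder.fn_block]
    simp only [dom, cod, List.length_cons, List.length_nil, List.length_append] at *
    by_cases h2 : i < Γ'.length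
    · have h3 : ¬ (Γ'.length ≤ i) := by omega
      simp only [h2, h3, if_true, false_and, if_false]
      split_ifs <;> omega
    · by_cases h3 : i < Γ'.length + 2
      · obtain rfl | rfl : i = Γ'.length ∨ i = Γ'.length + 1 := by omega
        · simp
        · simp
      · have h4 : ¬ (i < Γ'.length + 1) := by omega
        have h5 : ¬ (i < Γ'.length + 1 + 1) := by omega
        simp [h2, h4, h5]
        split_ifs <;> omega

end Loc

/-- With its left counterpart, this lets a `swap` gate be seen as an exchange of the context of
another gate. -/
theorem Reorder.fn_around_block_right (Γ Z B X Y Δ : List (Formula α)) {S T : List (Formula α)}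
    (hS : Γ ++ S = Γ ++ B ++ (X ++ Y) ++ Δ) (hT : Γ ++ T = Γ ++ B ++ (Y ++ X) ++ Δ)
    {S' T' : List (Formula α)} (hS' : S' = Γ ++ Z ++ B ++ (X ++ Y) ++ Δ)
    (hT' : T' = Γ ++ Z ++ B ++ (Y ++ X) ++ Δ) (i : ℕ) :
    (Reorder.around (Reorder.block (Γ ++ B) X Y Δ hS hT) Z).fn i =
      (Reorder.block (Γ ++ Z ++ B) X Y Δ hS' hT').fn i := by
  rw [fn_around]
  simp only [fn_block, List.length_append]
  split_ifs <;> omega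

theorem Reorder.fn_around_block_left (Γ Z B X Y Δ : List (Formula α)) {S T : List (Formula α)}
    (hS : S ++ Δ = Γ ++ (X ++ Y) ++ (B ++ Δ)) (hT : T ++ Δ = Γ ++ (Y ++ X) ++ (B ++ Δ))
    {S' T' : List (Formula α)} (hS' : S' = Γ ++ (X ++ Y) ++ (B ++ Z ++ Δ))
    (hT' : T' = Γ ++ (Y ++ X) ++ (B ++ Z ++ Δ)) (i : ℕ) :
    (Reorder.around (Reorder.block Γ X Y (B ++ Δ) hS hT) Z).fn i =
      (Reorder.block Γ X Y (B ++ Z ++ Δ) hS' hT').fn i := by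
  have h1 := congrArg List.length hS
  have h2 := congrArg List.length hT
  rw [fn_around]
  simp only [fn_block, List.length_append] at *
  split_ifs <;> omega

/-- If one of the gates is a `swap`, it is an exchange of the context of the other one and
`mk_op_ex` applies; two unary gates commute by the generator `unary_unary`. The derivations `d₁`,
`d₂`, `d₃`, known only up to `mk`, absorb the different bracketings of the sequents. -/
theorem Loc.mk_op_op (l m : Loc α) (Γ B Δ : List (Formula α))
    {d : Deriv (Γ ++ l.dom ++ (B ++ m.dom ++ Δ))} {d₁ : Deriv (Γ ++ l.cod ++ B ++ m.dom ++ Δ)}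
    (h₁ : mk d₁ = mk (l.op Γ (B ++ m.dom ++ Δ) d)) {d₂ : Deriv (Γ ++ l.dom ++ B ++ m.dom ++ Δ)}
    (h₂ : mk d₂ = mk d) {d₃ : Deriv (Γ ++ l.dom ++ (B ++ m.cod ++ Δ))}
    (h₃ : mk d₃ = mk (m.op (Γ ++ l.dom ++ B) Δ d₂)) :
    mk (m.op (Γ ++ l.cod ++ B) Δ d₁) = mk (l.op Γ (B ++ m.cod ++ Δ) d₃) := by
  cases m with
  | swap A C =>
    have e := Loc.mk_op_ex (Γ := Γ) (Γ' := Γ) (Δ := B ++ [A, C] ++ Δ) (Δ' := B ++ [C, A] ++ Δ)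
      (.block (Γ ++ B) [A] [C] Δ) l d
    refine Eq.trans ?_ (e.symm.trans (Loc.mk_op_congr (h₃.trans ?_) rfl).symm)
    · exact mk_ex_congr h₁ fun i => (Reorder.fn_around_block_right Γ l.cod B [A] [C] Δ _ _ _ _ i).symm
    · exact mk_ex_congr h₂ fun i => (Reorder.fn_around_block_right Γ l.dom B [A] [C] Δ _ _ _ _ i).symm
  | un s =>
    cases l with
    | swap A C =>
      have e := Loc.mk_op_ex (Γ := Γ ++ [A, C] ++ B) (Γ' := Γ ++ [C, A] ++ B) (Δ := Δ) (Δ' := Δ)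
        (.block Γ [A] [C] (B ++ Δ)) (.un s) d₂
      refine (Loc.mk_op_congr (l := .un s) (h₁.trans ?_) rfl).trans (e.trans ?_)
      · exact mk_ex_congr h₂.symm fun i =>
          (Reorder.fn_around_block_left Γ s.act B [A] [C] Δ _ _ _ _ i).symm
      · exact mk_ex_congr h₃.symm fun i =>
          Reorder.fn_around_block_left Γ [s.prin] B [A] [C] Δ _ _ _ _ i
    | un r =>
      have e := mk_eq_iff.2 (Deriv.StdEquiv.unary_unary Γ B Δ r s d₂)
      rw [mk_recast] at e
      refine Eq.trans (mk_unaryAt_congr (h₁.trans ?_) rfl) (e.trans (mk_unaryAt_congr ?_ rfl))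
      · exact (mk_unaryAt_congr (h₂.symm.trans (mk_recast _ _).symm) rfl).trans (mk_recast _ _).symm
      · exact (mk_recast _ _).trans h₃.symm

/-- For a unary gate this is the generator `unary_left`; for a `swap` it is `ex_binary` with the
trivial exchange on the right premise. -/
theorem Loc.mk_binary_op_left (l : Loc α) (b : BinRule α) (Γ B Δ : List (Formula α))
    {d : Deriv (Γ ++ l.dom ++ B ++ [b.left])} {e : Deriv (b.right :: Δ)}
    {d' : Deriv (Γ ++ l.dom ++ (B ++ [b.left]))} (h : mk d' = mk d)
    {d'' : Deriv (Γ ++ l.cod ++ B ++ [b.left])} (h' : mk d'' = mk (l.op Γ (B ++ [b.left]) d'))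
    {f : Deriv (Γ ++ l.dom ++ (B ++ b.prin ++ Δ))} (hf : mk f = mk (.binary b d e)) :
    mk (.binary b d'' e) = mk (l.op Γ (B ++ b.prin ++ Δ) f) := by
  cases l with
  | un r =>
    have E := mk_eq_iff.2 (Deriv.StdEquiv.unary_left Γ B Δ b r d e)
    rw [mk_recast] at E
    refine Eq.trans (mk_binary_congr ?_ rfl) (E.symm.trans (mk_unaryAt_congr ?_ rfl))
    · exact h'.trans ((mk_unaryAt_congr (h.trans (mk_recast _ _).symm) rfl).trans
        (mk_recast _ _).symm)
    · exact (mk_recast _ _).trans hf.symm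
  | swap A C =>
    have E := mk_eq_iff.2 (Deriv.StdEquiv.ex_binary (Γ := Γ ++ [A, C] ++ B) (Γ' := Γ ++ [C, A] ++ B)
      (.block Γ [A] [C] B) (.refl Δ) b d e)
    refine Eq.trans (mk_binary_congr ?_ (mk_ex_of_fn (fun i => ?_) _).symm)
      (E.trans (mk_ex_congr hf.symm fun i => ?_))
    · refine h'.trans (mk_ex_congr h fun i => ?_)
      simp only [Reorder.fn_append, Reorder.fn_block, Reorder.fn_refl, List.length_append,
        List.length_cons, List.length_nil]
      split_ifs <;> omega
    · simp only [Reorder.fn_append, Reorder.fn_refl]; split_ifs <;> omega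
    · simp only [Reorder.fn_append, Reorder.fn_block, Reorder.fn_refl, List.length_append,
        List.length_cons, List.length_nil]
      split_ifs <;> omega

theorem Loc.mk_binary_op_right (l : Loc α) (b : BinRule α) (Γ B Δ : List (Formula α))
    {d : Deriv (Γ ++ [b.left])} {e : Deriv (b.right :: (B ++ l.dom ++ Δ))}
    {e' : Deriv (b.right :: B ++ l.dom ++ Δ)} (h : mk e' = mk e)
    {e'' : Deriv (b.right :: (B ++ l.cod ++ Δ))} (h' : mk e'' = mk (l.op (b.right :: B) Δ e'))
    {f : Deriv (Γ ++ b.prin ++ B ++ l.dom ++ Δ)} (hf : mk f = mk (.binary b d e)) :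
    mk (.binary b d e'') = mk (l.op (Γ ++ b.prin ++ B) Δ f) := by
  cases l with
  | un r =>
    have E := mk_eq_iff.2 (Deriv.StdEquiv.unary_right Γ B Δ b r d e)
    rw [mk_recast] at E
    refine Eq.trans (mk_binary_congr rfl ?_) (E.symm.trans (mk_unaryAt_congr ?_ rfl))
    · exact h'.trans ((mk_unaryAt_congr (h.trans (mk_recast _ _).symm) rfl).trans
        (mk_recast _ _).symm)
    · exact (mk_recast _ _).trans hf.symm
  | swap A C =>
    have E := mk_eq_iff.2 (Deriv.StdEquiv.ex_binary (Δ := B ++ [A, C] ++ Δ) (Δ' := B ++ [C, A] ++ Δ)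
      (.refl Γ) (.block B [A] [C] Δ) b d e)
    refine Eq.trans (mk_binary_congr (mk_ex_of_fn (fun i => ?_) _).symm ?_)
      (E.trans (mk_ex_congr hf.symm fun i => ?_))
    · simp only [Reorder.fn_append, Reorder.fn_refl]; split_ifs <;> omega
    · refine h'.trans (mk_ex_congr h fun i => ?_)
      simp only [Reorder.fn_append, Reorder.fn_block, Reorder.fn_refl,
        List.length_cons, List.length_nil]
      split_ifs <;> omega
    · simp only [Reorder.fn_append, Reorder.fn_block, Reorder.fn_refl, List.length_append,
        List.length_cons, List.length_nil]
      split_ifs <;> omega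

/-- The generator `binary_mid`, with its recasts absorbed into equalities of items. -/
theorem mk_binary_binary (Γ Θ Δ : List (Formula α)) (b c : BinRule α)
    {d₁ : Deriv (Γ ++ [b.left])} {d₂ : Deriv (b.right :: (Θ ++ [c.left]))}
    {d₃ : Deriv (c.right :: Δ)} {f : Deriv (Γ ++ b.prin ++ Θ ++ [c.left])}
    (hf : mk f = mk (.binary b d₁ d₂)) {d₂' : Deriv (b.right :: Θ ++ [c.left])}
    (h₂ : mk d₂' = mk d₂) {g : Deriv (b.right :: (Θ ++ c.prin ++ Δ))}
    (hg : mk g = mk (.binary c d₂' d₃)) : mk (.binary c f d₃) = mk (.binary b d₁ g) := by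
  have E := mk_eq_iff.2 (Deriv.StdEquiv.binary_mid Γ Θ Δ b c d₁ d₂ d₃)
  rw [mk_recast] at E
  refine Eq.trans (mk_binary_congr ?_ rfl) (E.trans (mk_binary_congr rfl ?_))
  · rw [hf, mk_recast]
  · rw [hg, mk_recast]
    exact mk_binary_congr (by rw [h₂, mk_recast]) rfl

/-! ### Sequences of sheaves -/

theorem blk_append_inj {Γ Δ : List (Formula α)} {x y : List (Color α)}
    (h : fw Γ ++ .R :: x = fw Δ ++ .R :: y) : Γ = Δ ∧ x = y := by
  induction Γ generalizing Δ with
  | nil => cases Δ <;> simp_all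
  | cons A Γ ih =>
    cases Δ with
    | nil => simp at h
    | cons B Δ =>
      simp only [fw_cons, List.cons_append, List.cons.injEq, Color.fm.injEq] at h
      obtain ⟨rfl, h⟩ := h
      simpa using ih h

theorem fw_prefix {X Δ : List (Formula α)} {c w : List (Color α)}
    (h : fw X ++ c = fw Δ ++ .R :: w) : ∃ Δ', Δ = X ++ Δ' ∧ c = fw Δ' ++ .R :: w := by
  induction X generalizing Δ with
  | nil => exact ⟨Δ, rfl, h⟩
  | cons A X ih =>
    cases Δ with
    | nil => simp at h
    | cons B Δ =>
      simp only [fw_cons, List.cons_append, List.cons.injEq, Color.fm.injEq] at h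
      obtain ⟨rfl, h⟩ := h
      obtain ⟨Δ', rfl, rfl⟩ := ih h
      exact ⟨Δ', rfl, rfl⟩

/-- In a sequence of blocks a formula occurs only strictly inside a block, so a marked formula
singles out its block. -/
theorem exists_split_fm {bs : List (List (Formula α))} {a c : List (Color α)} {A : Formula α}
    (h : bs.flatMap blk = a ++ .fm A :: c) :
    ∃ bs₁ Γ Δ bs₂, bs = bs₁ ++ (Γ ++ A :: Δ) :: bs₂ ∧ a = bs₁.flatMap blk ++ .L :: fw Γ ∧
      c = fw Δ ++ .R :: bs₂.flatMap blk := by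
  have inner : ∀ (Γ : List (Formula α)) (w a : List (Color α)), fw Γ ++ .R :: w = a ++ .fm A :: c →
      (∃ Γ₁ Γ₂, Γ = Γ₁ ++ A :: Γ₂ ∧ a = fw Γ₁ ∧ c = fw Γ₂ ++ .R :: w) ∨
        ∃ a', a = fw Γ ++ .R :: a' ∧ w = a' ++ .fm A :: c := by
    intro Γ w
    induction Γ with
    | nil =>
      intro a h
      cases a with
      | nil => simp at h
      | cons x a =>
        simp only [fw_nil, List.nil_append, List.cons_append, List.cons.injEq] at h
        exact .inr ⟨a, by simp [h.1], h.2⟩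
    | cons B Γ ih =>
      intro a h
      cases a with
      | nil =>
        simp only [fw_cons, List.nil_append, List.cons_append, List.cons.injEq, Color.fm.injEq] at h
        exact .inl ⟨[], Γ, by simp [h.1], rfl, h.2.symm⟩
      | cons x a =>
        simp only [fw_cons, List.cons_append, List.cons.injEq] at h
        obtain ⟨rfl, h⟩ := h
        rcases ih a h with ⟨Γ₁, Γ₂, rfl, rfl, rfl⟩ | ⟨a', rfl, rfl⟩
        · exact .inl ⟨B :: Γ₁, Γ₂, rfl, rfl, rfl⟩
        · exact .inr ⟨a', rfl, rfl⟩
  induction bs generalizing a with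
  | nil => simp at h
  | cons Γ bs ih =>
    cases a with
    | nil => simp [blk] at h
    | cons x a =>
      simp only [List.flatMap_cons, blk, List.cons_append, List.append_assoc, List.nil_append,
        List.cons.injEq] at h
      obtain ⟨rfl, h⟩ := h
      rcases inner _ _ _ h with ⟨Γ₁, Γ₂, rfl, rfl, rfl⟩ | ⟨a', rfl, h'⟩
      · exact ⟨[], Γ₁, Γ₂, bs, rfl, rfl, rfl⟩
      · obtain ⟨bs₁, Γ', Δ, bs₂, rfl, rfl, rfl⟩ := ih h'
        exact ⟨Γ :: bs₁, Γ', Δ, bs₂, rfl, by simp [blk], rfl⟩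

/-- In a sequence of blocks an `L` occurs only at the start of a block, so a cut just before it
separates whole blocks. -/
theorem exists_split_L {bs : List (List (Formula α))} {a c : List (Color α)}
    (h : bs.flatMap blk = a ++ .L :: c) :
    ∃ bs₁ bs₂, bs = bs₁ ++ bs₂ ∧ a = bs₁.flatMap blk ∧ .L :: c = bs₂.flatMap blk := by
  have inner : ∀ (Γ : List (Formula α)) (w a : List (Color α)), fw Γ ++ .R :: w = a ++ .L :: c →
        ∃ a', a = fw Γ ++ .R :: a' ∧ w = a' ++ .L :: c := by
    intro Γ w
    induction Γ with
    | nil =>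
      intro a h
      cases a with
      | nil => simp at h
      | cons x a =>
        simp only [fw_nil, List.nil_append, List.cons_append, List.cons.injEq] at h
        exact ⟨a, by simp [h.1], h.2⟩
    | cons B Γ ih =>
      intro a h
      cases a with
      | nil => simp at h
      | cons x a =>
        simp only [fw_cons, List.cons_append, List.cons.injEq] at h
        obtain ⟨rfl, h⟩ := h
        obtain ⟨a', rfl, rfl⟩ := ih a h
        exact ⟨a', rfl, rfl⟩
  induction bs generalizing a with
  | nil => simp at h
  | cons Γ bs ih =>
    cases a with
    | nil => exact ⟨[], Γ :: bs, rfl, rfl, by simpa using h.symm⟩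
    | cons x a =>
      simp only [List.flatMap_cons, blk, List.cons_append, List.append_assoc, List.nil_append,
        List.cons.injEq] at h
      obtain ⟨rfl, h⟩ := h
      obtain ⟨a', rfl, h'⟩ := inner _ _ _ h
      obtain ⟨bs₁, bs₂, rfl, rfl, h''⟩ := ih h'
      exact ⟨Γ :: bs₁, bs₂, rfl, by simp [blk], h''⟩

theorem exists_split_left {ws bs : List (List (Formula α))} {r : List (Color α)}
    (h : ws.flatMap blk ++ r = bs.flatMap blk) : ∃ bs₃, bs = ws ++ bs₃ ∧ r = bs₃.flatMap blk := by
  induction ws generalizing bs with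
  | nil => exact ⟨bs, rfl, h⟩
  | cons w ws ih =>
    cases bs with
    | nil => simp [blk] at h
    | cons b bs =>
      simp only [List.flatMap_cons, blk, List.cons_append, List.append_assoc, List.nil_append,
        List.cons.injEq, true_and] at h
      obtain ⟨rfl, h'⟩ := blk_append_inj h
      obtain ⟨bs₃, rfl, rfl⟩ := ih h'
      exact ⟨bs₃, rfl, rfl⟩

theorem flatMap_blk_injective {bs bs' : List (List (Formula α))}
    (h : bs.flatMap blk = bs'.flatMap blk) : bs = bs' := by
  obtain ⟨bs₃, rfl, h⟩ := exists_split_left (r := []) (by simpa using h)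
  cases bs₃ with
  | nil => simp
  | cons b bs₃ => simp [blk] at h

theorem exists_split_right {ws bs : List (List (Formula α))} {r : List (Color α)}
    (h : r ++ ws.flatMap blk = bs.flatMap blk) : ∃ bs₃, bs = bs₃ ++ ws ∧ r = bs₃.flatMap blk := by
  cases ws with
  | nil => exact ⟨bs, by simp, by simpa using h⟩
  | cons w ws =>
    obtain ⟨bs₁, bs₂, rfl, rfl, h'⟩ := exists_split_L (bs := bs) (a := r)
      (c := fw w ++ .R :: ws.flatMap blk) (by rw [← h]; simp [blk])
    rw [flatMap_blk_injective (bs := bs₂) (bs' := w :: ws) (by rw [← h']; simp [blk])]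
    exact ⟨bs₁, rfl, rfl⟩

/-! ### Evaluation of diagrams on sequences of classes of derivations -/

/-- The strings that carry the sequents of some derivations. -/
def word (s : List (Item α)) : List (Color α) := (s.map Sigma.fst).flatMap blk

@[simp] theorem word_nil : word ([] : List (Item α)) = [] := rfl

@[simp] theorem word_append (s t : List (Item α)) : word (s ++ t) = word s ++ word t := by
  simp [word]

@[simp] theorem word_cons (x : Item α) (s : List (Item α)) : word (x :: s) = blk x.1 ++ word s := by
  simp [word]

theorem map_fst_eq_of_word_eq {s t : List (Item α)} (h : word s = word t) :
    s.map Sigma.fst = t.map Sigma.fst :=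
  flatMap_blk_injective h

theorem prefix_eq_of_word_eq {S S' X X' : List (Item α)} (h : word S = word S')
    (h' : S ++ X = S' ++ X') : S = S' ∧ X = X' :=
  List.append_inj h' (by simpa using congrArg List.length (map_fst_eq_of_word_eq h))

theorem prefix_eq_of_word_append_eq {S S' X X' : List (Item α)} {Γ Γ' : List (Formula α)}
    (h : word S ++ .L :: fw Γ = word S' ++ .L :: fw Γ') (h' : S ++ X = S' ++ X') :
    S = S' ∧ X = X' ∧ Γ = Γ' := by
  have e : S.map Sigma.fst ++ [Γ] = S'.map Sigma.fst ++ [Γ'] :=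
    -- Appending `R` closes the block that is still open, so that block words can be compared.
    flatMap_blk_injective (by simpa [word, blk] using congrArg (· ++ [Color.R]) h)
  have e' := List.append_inj' e rfl
  obtain ⟨rfl, rfl⟩ := List.append_inj h' (by simpa using congrArg List.length e'.1)
  exact ⟨rfl, rfl, by simpa using e'.2⟩

theorem exists_state_append {s : List (Item α)} {bs bs' : List (List (Formula α))}
    (h : word s = (bs ++ bs').flatMap blk) :
    ∃ S T, s = S ++ T ∧ word S = bs.flatMap blk ∧ word T = bs'.flatMap blk := by
  obtain ⟨S, T, rfl, rfl, rfl⟩ := List.map_eq_append_iff.1 (flatMap_blk_injective h)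
  exact ⟨S, T, rfl, rfl, rfl⟩

theorem exists_state_cons {s : List (Item α)} {Γ : List (Formula α)}
    {bs : List (List (Formula α))} (h : word s = (Γ :: bs).flatMap blk) :
    ∃ (d : Deriv Γ) (T : List (Item α)), s = mk d :: T ∧ word T = bs.flatMap blk := by
  obtain ⟨x, T, rfl, rfl, rfl⟩ := List.map_eq_cons_iff.1 (flatMap_blk_injective h)
  obtain ⟨d, hd⟩ := exists_mk x
  exact ⟨d, T, by rw [hd], rfl⟩

/-- The action of a gate on the derivations that it touches: `p` and `q` are the strings of these
derivations on the left and on the right of the gate. -/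
inductive Core : FGate α → List (Color α) → List (Color α) → List (Item α) → List (Item α) → Prop
  | ax (A : Formula α) : Core (.ctrl (.ax A)) [] [] [] [mk (.ax A)]
  | one : Core (.ctrl .one) [] [] [] [mk .one]
  | loc {g : FGate α} (l : Loc α) (hg : g = .ctrl l.gate) (Γ Δ : List (Formula α))
      (d : Deriv (Γ ++ l.dom ++ Δ)) :
      Core g (.L :: fw Γ) (fw Δ ++ [.R]) [mk d] [mk (l.op Γ Δ d)]
  | bin {Γ Δ : List (Formula α)} (b : BinRule α) (d : Deriv (Γ ++ [b.left]))
      (e : Deriv (b.right :: Δ)) :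
      Core (.ctrl (.bin b)) (.L :: fw Γ) (fw Δ ++ [.R]) [mk d, mk e] [mk (.binary b d e)]
  | big {W W' : List (Letter α)} {U V : List (Item α)} (hU : word U = sheaf W)
      (hV : word V = sheaf W') : Core (.big W W') [] [] (U ++ V) (V ++ U)

theorem Core.word_dom {g : FGate α} {p q : List (Color α)} {u u' : List (Item α)}
    (h : Core g p q u u') : word u = p ++ g.dom ++ q := by
  cases h with
  | loc l hg Γ Δ d => subst hg; simp [FGate.dom, l.gate_dom, blk]
  | big hU hV => simp [hU, hV, FGate.dom]
  | _ => simp [FGate.dom, CGate.dom, blk]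

theorem Core.word_cod {g : FGate α} {p q : List (Color α)} {u u' : List (Item α)}
    (h : Core g p q u u') : word u' = p ++ g.cod ++ q := by
  cases h with
  | loc l hg Γ Δ d => subst hg; simp [FGate.cod, l.gate_cod, blk]
  | big hU hV => simp [hU, hV, FGate.cod]
  | _ => simp [FGate.cod, CGate.cod, blk]

/-- The action of an elementary diagram. -/
def Step (s : List (Item α)) (sl : Slice (Color α) (FGate α)) (s' : List (Item α)) : Prop :=
  ∃ S T u u' p q, s = S ++ u ++ T ∧ s' = S ++ u' ++ T ∧ sl.left = word S ++ p ∧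
    sl.right = q ++ word T ∧ Core sl.gate p q u u'

theorem Step.word_dom {s s' : List (Item α)} {sl : Slice (Color α) (FGate α)}
    (h : Step s sl s') : word s = sl.left ++ sl.gate.dom ++ sl.right := by
  obtain ⟨S, T, u, u', p, q, rfl, rfl, hl, hr, h⟩ := h
  simp [hl, hr, h.word_dom]

theorem Step.word_cod {s s' : List (Item α)} {sl : Slice (Color α) (FGate α)}
    (h : Step s sl s') : word s' = sl.left ++ sl.gate.cod ++ sl.right := by
  obtain ⟨S, T, u, u', p, q, rfl, rfl, hl, hr, h⟩ := h
  simp [hl, hr, h.word_cod]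

theorem Step.frame {s s' : List (Item α)} {sl : Slice (Color α) (FGate α)}
    (h : Step s sl s') (S T : List (Item α)) :
    Step (S ++ s ++ T) ⟨word S ++ sl.left, sl.gate, sl.right ++ word T⟩ (S ++ s' ++ T) := by
  obtain ⟨S', T', u, u', p, q, rfl, rfl, hl, hr, h⟩ := h
  exact ⟨S ++ S', T' ++ T, u, u', p, q, by simp, by simp, by simp [hl], by simp [hr], h⟩

theorem Loc.gate_injective {l m : Loc α} (h : l.gate = m.gate) : l = m := by
  cases l <;> cases m <;> simp_all [Loc.gate]

theorem Loc.gate_ne_ax (l : Loc α) (A : Formula α) : l.gate ≠ .ax A := by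
  cases l <;> simp [Loc.gate]

theorem Loc.gate_ne_one (l : Loc α) : l.gate ≠ .one := by
  cases l <;> simp [Loc.gate]

theorem Loc.gate_ne_bin (l : Loc α) (b : BinRule α) : l.gate ≠ .bin b := by
  cases l <;> simp [Loc.gate]

/-- Block words are uniquely readable, so the word to the left of the gate fixes the items it
touches and its position in them; the operations depend only on classes. -/
theorem Step.unique {s t t' : List (Item α)} {sl : Slice (Color α) (FGate α)}
    (h : Step s sl t) (h' : Step s sl t') : t = t' := by
  obtain ⟨a, g, c⟩ := sl
  obtain ⟨S, T, u, u', p, q, rfl, rfl, hl, hr, h⟩ := h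
  obtain ⟨S', T', v, v', p', q', hs, rfl, hl', hr', h'⟩ := h'
  simp only at hl hr hl' hr' h h'
  subst hl hr
  rw [List.append_assoc, List.append_assoc] at hs
  cases h with
  | ax A =>
    cases h' with
    | loc l hg => simp [(l.gate_ne_ax A).symm] at hg
    | ax =>
      obtain ⟨rfl, h⟩ := prefix_eq_of_word_eq (by simpa using hl') hs
      simp_all
  | one =>
    cases h' with
    | loc l hg => simp [l.gate_ne_one.symm] at hg
    | one =>
      obtain ⟨rfl, h⟩ := prefix_eq_of_word_eq (by simpa using hl') hs
      simp_all
  | loc l hg Γ Δ d =>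
    subst hg
    generalize hg : FGate.ctrl l.gate = g at h'
    cases h' with
    | ax A => simp [l.gate_ne_ax A] at hg
    | one => simp [l.gate_ne_one] at hg
    | bin b => simp [l.gate_ne_bin b] at hg
    | big => simp at hg
    | loc m hg' Γ' Δ' d' =>
      obtain rfl : l = m := Loc.gate_injective (by simpa using hg.trans hg')
      obtain ⟨rfl, h, rfl⟩ := prefix_eq_of_word_append_eq hl' hs
      simp only [List.cons_append, List.nil_append, List.cons.injEq] at h
      obtain ⟨h, rfl⟩ := h
      rw [Loc.mk_op_congr h rfl]
  | bin b d e =>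
    cases h' with
    | loc l hg => simp [(l.gate_ne_bin b).symm] at hg
    | bin _ d' e' =>
      obtain ⟨rfl, h, rfl⟩ := prefix_eq_of_word_append_eq hl' hs
      simp only [List.cons_append, List.nil_append, List.cons.injEq] at h
      obtain ⟨h₁, h₂, rfl⟩ := h
      rw [mk_binary_congr h₁ h₂]
  | big hU hV =>
    cases h' with
    | loc l hg => simp at hg
    | big hU' hV' =>
      obtain ⟨rfl, h⟩ := prefix_eq_of_word_eq (by simpa using hl') hs
      rw [List.append_assoc, List.append_assoc] at h
      obtain ⟨rfl, h₂⟩ := prefix_eq_of_word_eq (hU.trans hU'.symm) h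
      obtain ⟨rfl, rfl⟩ := prefix_eq_of_word_eq (hV.trans hV'.symm) h₂
      rfl

/-- The hypothesis on the output word excludes an `Ax` or `1` created inside a sheaf and a `⊥`
created outside all sheaves. These are well-typed slices with no action. -/
theorem exists_step {s : List (Item α)} {a c : List (Color α)} {g : FGate α}
    {bs : List (List (Formula α))} (h : word s = a ++ g.dom ++ c)
    (h' : a ++ g.cod ++ c = bs.flatMap blk) : ∃ t, Step s ⟨a, g, c⟩ t := by
  -- The outputs of the gate begin with `L`, which must open a block of the output word; the gate
  -- therefore lies between items.
  have closed : ∀ (Γ : List (Formula α)) (d : Deriv Γ), g.dom = [] → g.cod = blk Γ →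
      Core g [] [] [] [mk d] → ∃ t, Step s ⟨a, g, c⟩ t := by
    intro Γ d h₁ h₂ hc
    obtain ⟨bs₁, bs₂, rfl, rfl, h₃⟩ := exists_split_L (bs := bs) (a := a) (c := fw Γ ++ .R :: c)
      (by rw [← h', h₂]; simp [blk])
    obtain ⟨bs₃, rfl, rfl⟩ := exists_split_left (ws := [Γ]) (r := c) (bs := bs₂)
      (by rw [← h₃]; simp [blk])
    obtain ⟨S, T, rfl, hS, hT⟩ := exists_state_append (bs := bs₁) (bs' := bs₃)
      (by rw [h, h₁]; simp)
    exact ⟨_, S, T, [], _, [], [], by simp, rfl, by simp [hS], by simp [hT], hc⟩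
  -- The block is located from the first output of the gate: `⊥` has no inputs, but every gate of
  -- this kind has an output formula.
  have loc : ∀ l : Loc α, g = .ctrl l.gate → ∃ t, Step s ⟨a, g, c⟩ t := by
    rintro l rfl
    obtain ⟨P, X, hX⟩ : ∃ P X, l.cod = P :: X := by cases l <;> exact ⟨_, _, rfl⟩
    obtain ⟨bs₁, Γ, Δ, bs₂, rfl, rfl, hc⟩ := exists_split_fm (bs := bs) (a := a) (A := P) (c := fw X ++ c)
      (by rw [← h']; simp [FGate.cod, l.gate_cod, hX])
    obtain ⟨Δ, rfl, rfl⟩ := fw_prefix hc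
    obtain ⟨S, T, rfl, hS, hT⟩ := exists_state_append (bs := bs₁)
      (bs' := (Γ ++ l.dom ++ Δ) :: bs₂) (by rw [h]; simp [FGate.dom, l.gate_dom, blk])
    obtain ⟨d, T, rfl, hT₁⟩ := exists_state_cons hT
    exact ⟨_, S, T, _, _, _, _, by simp, rfl, by simp [hS], by simp [hT₁], .loc l rfl Γ Δ d⟩
  rcases g with (A | _ | r | b | ⟨A, B⟩) | ⟨W, W'⟩
  · exact closed _ _ rfl rfl (.ax A)
  · exact closed _ _ rfl rfl .one
  · exact loc (.un r) rfl
  -- A cut has no outputs, so the two blocks are located in the input word. The strings `R, L` in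
  -- the gate force `b.left` to end its block and `b.right` to begin the next one.
  · obtain ⟨bs₁, Γ, Δ, bs₂, hbs, rfl, hc⟩ := exists_split_fm (bs := s.map Sigma.fst) (a := a) (A := b.left)
      (c := .R :: .L :: .fm b.right :: c) (h.trans (by simp [FGate.dom, CGate.dom]))
    obtain ⟨rfl, hc₁⟩ := blk_append_inj (Γ := []) hc
    obtain ⟨bs₃, Γ', Δ', bs₄, rfl, h₁, rfl⟩ := exists_split_fm (bs := bs₂)
      (a := [.L]) (A := b.right) (c := c) hc₁.symm
    obtain rfl : bs₃ = [] := by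
      cases bs₃ with
      | nil => rfl
      | cons x bs₃ => simp [blk] at h₁
    obtain rfl : Γ' = [] := by
      cases Γ' with
      | nil => rfl
      | cons x Γ' => simp at h₁
    obtain ⟨S, T, rfl, hS, hT⟩ := exists_state_append (bs := bs₁)
      (bs' := (Γ ++ [b.left]) :: (b.right :: Δ') :: bs₄) (by rw [word, hbs]; simp)
    obtain ⟨d, T, rfl, hT₁⟩ := exists_state_cons hT
    obtain ⟨e, T, rfl, hT₂⟩ := exists_state_cons hT₁
    exact ⟨_, S, T, _, _, _, _, by simp, rfl, by simp [hS], by simp [hT₂], .bin b d e⟩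
  · exact loc (.swap A B) rfl
  · obtain ⟨ws, -, hW⟩ := exists_blocks_of_sheaf W
    obtain ⟨ws', -, hW'⟩ := exists_blocks_of_sheaf W'
    obtain ⟨bs₁, bs₂, hbs, rfl, h₃⟩ := exists_split_L (bs := s.map Sigma.fst) (a := a)
      (c := W.flatMap Letter.word ++ .R :: (sheaf W' ++ c))
      (h.trans (by simp [FGate.dom, sheaf]))
    obtain ⟨bs₃, rfl, rfl⟩ := exists_split_left (ws := ws ++ ws') (r := c) (bs := bs₂)
      (by rw [← h₃, List.flatMap_append, ← hW, ← hW']; simp [sheaf])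
    obtain ⟨S, T, rfl, hS, hT⟩ := exists_state_append (bs := bs₁)
      (bs' := ws ++ (ws' ++ bs₃)) (by rw [word, hbs]; simp)
    obtain ⟨U, T, rfl, hU, hT₁⟩ := exists_state_append hT
    obtain ⟨V, T, rfl, hV, hT₂⟩ := exists_state_append hT₁
    exact ⟨_, S, T, _, _, [], [], by simp, rfl, by simp [hS], by simp [hT₂],
      .big (hU.trans hW.symm) (hV.trans hW'.symm)⟩

/-- The action of a diagram. -/
def Eval : List (Slice (Color α) (FGate α)) → List (Item α) → List (Item α) → Prop
  | [], s, t => s = t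
  | sl :: φ, s, t => ∃ s', Step s sl s' ∧ Eval φ s' t

@[simp] theorem eval_nil {s t : List (Item α)} : Eval [] s t ↔ s = t := Iff.rfl

theorem eval_append {φ ψ : List (Slice (Color α) (FGate α))} {s t : List (Item α)} :
    Eval (φ ++ ψ) s t ↔ ∃ s', Eval φ s s' ∧ Eval ψ s' t := by
  induction φ generalizing s with
  | nil => simp
  | cons sl φ ih =>
    simp only [List.cons_append, Eval, ih]
    grind

theorem eval_singleton {sl : Slice (Color α) (FGate α)} {s t : List (Item α)} :
    Eval [sl] s t ↔ Step s sl t := by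
  simp [Eval]

theorem Eval.append {φ ψ : List (Slice (Color α) (FGate α))} {s t r : List (Item α)}
    (h : Eval φ s t) (h' : Eval ψ t r) : Eval (φ ++ ψ) s r :=
  eval_append.2 ⟨t, h, h'⟩

theorem Eval.unique {φ : List (Slice (Color α) (FGate α))} {s t t' : List (Item α)}
    (h : Eval φ s t) (h' : Eval φ s t') : t = t' := by
  induction φ generalizing s with
  | nil => exact h.symm.trans h'
  | cons sl φ ih =>
    obtain ⟨r, h₁, h₂⟩ := h
    obtain ⟨r', h₁', h₂'⟩ := h'
    obtain rfl := h₁.unique h₁'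
    exact ih h₂ h₂'

theorem Eval.frame {φ : List (Slice (Color α) (FGate α))} {s t : List (Item α)}
    (h : Eval φ s t) (S T : List (Item α)) :
    Eval (whisker (word S) φ (word T)) (S ++ s ++ T) (S ++ t ++ T) := by
  induction φ generalizing s with
  | nil => rw [eval_nil] at h; subst h; rfl
  | cons sl φ ih =>
    obtain ⟨r, h₁, h₂⟩ := h
    exact ⟨_, h₁.frame S T, ih h₂⟩

theorem Eval.typed {φ : List (Slice (Color α) (FGate α))} {s t : List (Item α)}
    (h : Eval φ s t) : (full α).Typed φ (word s) (word t) := by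
  induction φ generalizing s with
  | nil => exact congrArg word h
  | cons sl φ ih =>
    obtain ⟨r, h₁, h₂⟩ := h
    have h₃ := ih h₂
    rw [h₁.word_cod] at h₃
    exact ⟨h₁.word_dom, h₃⟩

theorem height_flatMap_blk (bs : List (List (Formula α))) : height (bs.flatMap blk) = 0 := by
  induction bs with
  | nil => rfl
  | cons b bs ih => simp [height_append, height_blk, ih]

theorem nonneg_flatMap_blk (bs : List (List (Formula α))) : Nonneg 0 (bs.flatMap blk) := by
  induction bs with
  | nil => exact le_refl _
  | cons b bs ih => simpa [nonneg_append, nonneg_blk, height_blk] using ih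

theorem low_flatMap_blk (bs : List (List (Formula α))) : Low 0 (bs.flatMap blk) := by
  induction bs with
  | nil => exact zero_le_one
  | cons b bs ih => simpa [low_append, low_blk, height_blk] using ih

/-- Every intermediate word is well nested because of the source and low because of the target,
hence a sequence of blocks, which is what `exists_step` asks for. -/
theorem exists_eval {φ : List (Slice (Color α) (FGate α))} {s : List (Item α)}
    {bs : List (List (Formula α))} (h : (full α).Typed φ (word s) (bs.flatMap blk)) :
    ∃ t, Eval φ s t ∧ word t = bs.flatMap blk := by
  induction φ generalizing s with
  | nil => exact ⟨s, rfl, h⟩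
  | cons sl φ ih =>
    obtain ⟨h₁, h₂⟩ := h
    have n : Nonneg 0 (sl.left ++ (full α).cod sl.gate ++ sl.right) ∧
        height (sl.left ++ (full α).cod sl.gate ++ sl.right) = 0 := by
      have h₃ := nesting_of_typed (φ := [sl]) (x := word s) ⟨h₁, rfl⟩ (nonneg_flatMap_blk _)
      exact ⟨h₃.2.1, h₃.1.symm.trans (height_flatMap_blk _)⟩
    have l := (nesting_of_typed h₂ n.1).2.2 (low_flatMap_blk _)
    obtain ⟨bs', hbs'⟩ := exists_blocks n.1 l n.2
    obtain ⟨r, hr⟩ := exists_step h₁ hbs'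
    obtain ⟨t, ht, ht'⟩ := ih (s := r) (by rw [hr.word_cod]; exact h₂)
    exact ⟨t, ⟨r, hr, ht⟩, ht'⟩

/-! ### Interchange -/

theorem Core.step {g : FGate α} {p q : List (Color α)} {u u' : List (Item α)}
    (h : Core g p q u u') : Step u ⟨p, g, q⟩ u' :=
  ⟨[], [], u, u', p, q, by simp, by simp, by simp, by simp, h⟩

theorem Step.frame_eq {s s' r r' : List (Item α)} {a c a' c' : List (Color α)} {g : FGate α}
    (h : Step s ⟨a, g, c⟩ s') (S T : List (Item α)) (hr : r = S ++ s ++ T) (hr' : r' = S ++ s' ++ T)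
    (ha : a' = word S ++ a) (hc : c' = c ++ word T) : Step r ⟨a', g, c'⟩ r' := by
  subst hr hr' ha hc
  exact h.frame S T

/-- The case split behind `step_interchange`: `Ax`, `1` and `B`-gates act on whole items, all others
inside a single resulting item. -/
theorem Core.flat_or_local {g : FGate α} {p q : List (Color α)} {u u' : List (Item α)}
    (h : Core g p q u u') : (p = [] ∧ q = []) ∨ ∃ Γ Δ X x, p = .L :: fw Γ ∧ q = fw Δ ++ [.R] ∧
      g.cod = fw X ∧ u' = [x] ∧ x.1 = Γ ++ X ++ Δ := by
  cases h with
  | loc l hg Γ Δ d =>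
    subst hg
    exact .inr ⟨Γ, Δ, l.cod, _, rfl, rfl, l.gate_cod, rfl, rfl⟩
  | @bin Γ Δ b d e => exact .inr ⟨Γ, Δ, b.prin, _, rfl, rfl, rfl, rfl, rfl⟩
  | _ => exact .inl ⟨rfl, rfl⟩

/-- Both gates act inside the item `x`. Each is either without control strings or binary, and the
four combinations are `mk_op_op`, `mk_binary_op_left`, `mk_binary_op_right` and `mk_binary_binary`.
-/
theorem Core.interchange {g h : FGate α} {Γ Δ X B : List (Formula α)} {q : List (Color α)}
    {u y v' : List (Item α)} {x : Item α} (hX : g.cod = fw X)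
    (hg : Core g (.L :: fw Γ) (fw Δ ++ [.R]) u [x])
    (hh : Core h (.L :: fw (Γ ++ X ++ B)) q (x :: y) v') :
    ∃ w, Step (u ++ y) ⟨.L :: fw Γ ++ g.dom ++ fw B, h, q⟩ w ∧
      Step w ⟨.L :: fw Γ, g, fw B ++ h.cod ++ q⟩ v' := by
  generalize hp : Color.L :: fw Γ = p at hg
  generalize hp' : Color.L :: fw (Γ ++ X ++ B) = p' at hh
  generalize hq : fw Δ ++ [Color.R] = q₀ at hg
  generalize hx : [x] = x' at hg
  generalize hy : x :: y = y' at hh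
  have hfw : ∀ {Γ Δ : List (Formula α)}, Color.L :: fw Γ = .L :: fw Δ → Γ = Δ := fun h =>
    fw_injective (by simpa using h)
  cases hg with
  | loc l hl Γ₀ Δ₀ d =>
    subst hl
    obtain rfl := hfw hp
    obtain rfl : X = l.cod := fw_injective (by rw [← hX]; exact l.gate_cod)
    simp only [List.cons.injEq, and_true] at hx
    subst hx
    cases hh with
    | loc m hm Γ₁ Δ₁ d₁ =>
      subst hm
      obtain rfl := hfw hp'
      simp only [List.cons.injEq] at hy
      obtain ⟨hy, rfl⟩ := hy
      obtain rfl : Δ₀ = B ++ m.dom ++ Δ₁ := by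
        simpa [List.append_assoc] using fst_eq_of_mk_eq hy
      refine ⟨_, (Core.loc m rfl (Γ ++ l.dom ++ B) Δ₁ (d.recast)).step.frame_eq [] [] ?_ rfl ?_ ?_,
        ?_⟩
      · simp
      · simp [FGate.dom, l.gate_dom]
      · simp
      · rw [Loc.mk_op_op l m Γ B Δ₁ hy.symm (mk_recast d (by simp)) (d₃ := Deriv.recast _)
          (mk_recast _ (by simp))]
        refine (Core.loc l rfl Γ (B ++ m.cod ++ Δ₁) _).step.frame_eq [] [] ?_ rfl ?_ ?_
        · simp
        · simp
        · simp [FGate.cod, m.gate_cod]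
    | @bin Γ₁ Δ₁ b d₁ e =>
      obtain rfl := hfw hp'
      simp only [List.cons.injEq] at hy
      obtain ⟨hy, rfl⟩ := hy
      obtain rfl : Δ₀ = B ++ [b.left] := by
        simpa [List.append_assoc] using fst_eq_of_mk_eq hy
      refine ⟨_, (Core.bin (Γ := Γ ++ l.dom ++ B) b d.recast e).step.frame_eq [] [] ?_ rfl ?_ ?_,
        ?_⟩
      · simp
      · simp [FGate.dom, l.gate_dom]
      · simp
      · rw [Loc.mk_binary_op_left l b Γ B Δ₁ (mk_recast d (by simp)).symm hy.symm (f := Deriv.recast _)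
          (mk_recast _ (by simp))]
        refine (Core.loc l rfl Γ (B ++ b.prin ++ Δ₁) _).step.frame_eq [] [] ?_ rfl ?_ ?_
        · simp
        · simp
        · simp [FGate.cod, CGate.cod]
    | _ => simp at hp'
  | @bin Γ₀ Δ₀ b d e =>
    obtain rfl := hfw hp
    obtain rfl : X = b.prin := fw_injective hX.symm
    simp only [List.cons.injEq, and_true] at hx
    subst hx
    cases hh with
    | loc m hm Γ₁ Δ₁ d₁ =>
      subst hm
      obtain rfl := hfw hp'
      simp only [List.cons.injEq] at hy
      obtain ⟨hy, rfl⟩ := hy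
      obtain rfl : Δ₀ = B ++ m.dom ++ Δ₁ := by
        simpa [List.append_assoc] using fst_eq_of_mk_eq hy
      refine ⟨_, (Core.loc m rfl (b.right :: B) Δ₁ (e.recast)).step.frame_eq [mk d] [] ?_ rfl ?_ ?_,
        ?_⟩
      · simp
      · simp [FGate.dom, CGate.dom, blk]
      · simp
      · rw [← Loc.mk_binary_op_right m b Γ B Δ₁ (mk_recast e (by simp)) (e'' := Deriv.recast _)
          (mk_recast _ (by simp)) hy.symm]
        refine (Core.bin b d _).step.frame_eq [] [] ?_ rfl ?_ ?_
        · simp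
        · simp
        · simp [FGate.cod, m.gate_cod]
    | @bin Γ₁ Δ₁ c d₁ f =>
      obtain rfl := hfw hp'
      simp only [List.cons.injEq] at hy
      obtain ⟨hy, rfl⟩ := hy
      obtain rfl : Δ₀ = B ++ [c.left] := by
        simpa [List.append_assoc] using fst_eq_of_mk_eq hy
      refine ⟨_, (Core.bin (Γ := b.right :: B) c e.recast f).step.frame_eq [mk d] [] ?_ rfl ?_ ?_,
        ?_⟩
      · simp
      · simp [FGate.dom, CGate.dom, blk]
      · simp
      · rw [mk_binary_binary Γ B Δ₁ b c hy.symm (mk_recast e (by simp)) (g := Deriv.recast _)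
          (mk_recast _ (by simp))]
        refine (Core.bin b d _).step.frame_eq [] [] ?_ rfl ?_ ?_
        · simp
        · simp
        · simp [FGate.cod, CGate.cod]
    | _ => simp at hp'
  | _ => simp at hp

theorem step_interchange {g h : FGate α} {a b c : List (Color α)} {s s₁ s₂ : List (Item α)}
    (hg : Step s ⟨a, g, b ++ h.dom ++ c⟩ s₁) (hh : Step s₁ ⟨a ++ g.cod ++ b, h, c⟩ s₂) :
    ∃ r, Step s ⟨a ++ g.dom ++ b, h, c⟩ r ∧ Step r ⟨a, g, b ++ h.cod ++ c⟩ s₂ := by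
  have hg₀ := hg
  have hh₀ := hh
  obtain ⟨S, T, u, u', p, q, rfl, rfl, ha, hc, hg⟩ := hg
  obtain ⟨S', T', v, v', p', q', hs, rfl, ha', hc', hh⟩ := hh
  simp only at ha hc ha' hc' hg hh
  rcases hg.flat_or_local with ⟨rfl, rfl⟩ | ⟨Γ, Δ, X, x, rfl, rfl, hX, rfl, hx⟩
  -- The gate `g` produces whole items, so the strings to its right form a block word on which `h`
  -- acts alone; uniqueness of steps identifies the outcome.
  · have hd := hg.word_dom
    have hd' := hg.word_cod
    obtain ⟨bs, -, hbs⟩ := exists_split_left (ws := (S ++ u').map Sigma.fst)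
      (r := b ++ h.cod ++ c) (bs := (S' ++ v' ++ T').map Sigma.fst) (by
        change word (S ++ u') ++ _ = word _
        have := hh₀.word_cod
        simp only at this
        rw [this]; simp [ha, hd'])
    obtain ⟨T₁, hT₁⟩ := exists_step (s := T) (a := b) (c := c) (g := h) (by simpa using hc.symm) hbs
    have e := hh₀.unique (hT₁.frame_eq (S ++ u') [] (by simp) rfl (by simp [ha, hd']) (by simp))
    refine ⟨_, hT₁.frame_eq (S ++ u) [] (by simp) rfl (by simp [ha, hd]) (by simp), ?_⟩
    rw [e]
    refine hg.step.frame_eq S T₁ (by simp) (by simp) (by simp [ha]) ?_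
    simpa using hT₁.word_cod.symm
  rcases hh.flat_or_local with ⟨rfl, rfl⟩ | ⟨Γ', Δ', -, -, rfl, -, -, -, -⟩
  -- The mirror case: `h` acts on whole items, and `g` acts on the blocks to their left.
  · have hd := hh.word_dom
    have hd' := hh.word_cod
    have e := hg₀.word_dom
    obtain ⟨bs, -, hbs⟩ := exists_split_right (ws := (v ++ T').map Sigma.fst)
      (r := a ++ g.dom ++ b) (bs := (S ++ u ++ T).map Sigma.fst) (by
        change _ ++ word (v ++ T') = word _
        rw [e]; simp [hc', hd])
    obtain ⟨S₀, Y, e₀, hS₀, hY⟩ := exists_state_append (s := S ++ u ++ T) (bs := bs)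
      (bs' := (v ++ T').map Sigma.fst) (by
        rw [List.flatMap_append, ← hbs, e]
        change _ = _ ++ word (v ++ T')
        simp [hc', hd])
    change word Y = word (v ++ T') at hY
    obtain ⟨S₁, hS₁⟩ := exists_step (s := S₀) (a := a) (c := b) (g := g)
      (by rw [hS₀, hbs]) (ha'.trans (by simp [word]; rfl))
    have hS₁' := hS₁.word_cod
    have e₁ := hg₀.unique (hS₁.frame_eq [] Y (by simpa using e₀) rfl (by simp)
      (by simp [hY, hc', hd]))
    rw [hs, List.nil_append, List.append_assoc] at e₁
    obtain ⟨rfl, rfl⟩ := prefix_eq_of_word_eq (hS₁'.trans (by simpa using ha')).symm e₁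
    rw [e₀]
    refine ⟨_, hh.step.frame_eq S₀ T' (by simp) rfl (by simp [hS₀, hbs]) (by simp [hc']), ?_⟩
    exact hS₁.frame_eq [] (v' ++ T') (by simp) (by simp) (by simp) (by simp [hc', hd'])
  have hd := hg.word_dom
  have hd' := hh.word_cod
  subst ha hc'
  rw [hX] at ha'
  have key : ∀ (Y : List (Formula α)) (w : List (Color α)), fw Y ++ .R :: w ≠ fw Γ' := by
    intro Y w e
    have : Color.R ∈ fw Γ' := by rw [← e]; simp
    simp [fw] at this
  rw [List.append_assoc, List.append_assoc S'] at hs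
  -- Both gates act inside blocks. Either `h` meets the item `x` produced by `g`, or it stays
  -- strictly to the right of it; it cannot start further left, because in the word it stands to the
  -- right of `g`.
  obtain ⟨M, rfl, hM⟩ | ⟨m, M, rfl⟩ : (∃ M, S' = S ++ M ∧ [x] ++ T = M ++ (v ++ T')) ∨
      ∃ m M, S = S' ++ m :: M := by
    rcases List.append_eq_append_iff.1 hs with ⟨M, rfl, hM⟩ | ⟨M, rfl, hM⟩
    · exact .inl ⟨M, rfl, hM⟩
    · cases M with
      | nil => exact .inl ⟨[], by simp, by simpa using hM.symm⟩
      | cons m M => exact .inr ⟨m, M, rfl⟩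
  · rcases M with - | ⟨x', M⟩
    · simp only [List.append_nil, List.append_assoc, List.append_cancel_left_eq,
        List.cons_append, List.cons.injEq, true_and] at ha'
      obtain ⟨Γ₁, B', rfl, h₁, h₂⟩ := fw_eq_append ha'.symm
      obtain rfl := fw_injective h₁
      obtain ⟨X', B, rfl, h₁, rfl⟩ := fw_eq_append h₂.symm
      obtain rfl := fw_injective h₁
      obtain ⟨y, rfl, rfl⟩ : ∃ y, v = x :: y ∧ T = y ++ T' := by
        rcases v with - | ⟨z, y⟩
        · have := hh.word_dom; simp at this
        · simp only [List.cons_append, List.nil_append, List.cons.injEq] at hM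
          exact ⟨y, by rw [hM.1], hM.2⟩
      rw [← List.append_assoc] at hh
      obtain ⟨w, h₁, h₂⟩ := hg.interchange hX hh
      refine ⟨_, h₁.frame_eq S T' (by simp) rfl (by simp) (by simp), ?_⟩
      exact h₂.frame_eq S T' rfl (by simp) (by simp) (by simp)
    · simp only [List.cons_append, List.nil_append, List.cons.injEq] at hM
      obtain ⟨rfl, rfl⟩ := hM
      obtain ⟨Z, hZ, rfl⟩ : ∃ Z : Unit, True ∧
          b = fw Δ ++ [.R] ++ (word M ++ .L :: fw Γ') := by
        refine ⟨(), trivial, ?_⟩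
        simpa [hx, blk] using ha'
      refine ⟨_, hh.step.frame_eq (S ++ u ++ M) T' (by simp) rfl (by simp [hd]) (by simp), ?_⟩
      refine hg.step.frame_eq S (M ++ v' ++ T') (by simp) (by simp) (by simp) (by simp [hd'])
  · simp [blk] at ha'
    exact absurd ha' (key _ _)

/-- Diagrams related by interchange have the same action. -/
theorem Eval.interchange {φ ψ : List (Slice (Color α) (FGate α))} (h : (full α).Interchange φ ψ)
    {s t : List (Item α)} (hs : Eval φ s t) : Eval ψ s t := by
  obtain ⟨χ, χ', g, h, a, b, c⟩ := h
  obtain ⟨s₂, h₀, h₂⟩ := eval_append.1 hs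
  obtain ⟨s₁, h₁, s₃, h₃, s₄, h₄, rfl⟩ := eval_append.1 h₀
  obtain ⟨r, hr, hr'⟩ := step_interchange h₃ h₄
  exact eval_append.2 ⟨_, eval_append.2 ⟨s₁, h₁, r, hr, _, hr', rfl⟩, h₂⟩

/-- The converse needs no second analysis: the other diagram has some outcome by `exists_eval`, and
uniqueness makes it the same one. -/
theorem eval_interchange_iff {φ ψ : List (Slice (Color α) (FGate α))}
    (h : (full α).Interchange φ ψ) {s t : List (Item α)} : Eval φ s t ↔ Eval ψ s t := by
  refine ⟨.interchange h, fun hs => ?_⟩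
  obtain ⟨t', ht, -⟩ := exists_eval (bs := t.map Sigma.fst) (h.typed_iff.2 hs.typed)
  rwa [hs.unique (ht.interchange h)]

/-! ### Soundness of the control relations -/

theorem Eval.frame_eq {φ ψ : List (Slice (Color α) (FGate α))} {s t r r' : List (Item α)}
    (h : Eval φ s t) (S T : List (Item α)) (hψ : ψ = whisker (word S) φ (word T))
    (hr : r = S ++ s ++ T) (hr' : r' = S ++ t ++ T) : Eval ψ r r' := by
  subst hψ hr hr'
  exact h.frame S T

theorem SwapOnly.exists_realizes {Γ Δ : List (Formula α)} {τ : List (Slice (Color α) (CGate α))}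
    (hs : SwapOnly τ) (ht : (control α).Typed τ (fw Γ) (fw Δ)) :
    ∃ σ : Reorder Γ Δ, Realizes τ σ := by
  induction τ generalizing Γ with
  | nil => exact ⟨_, realizes_nil (fw_injective ht)⟩
  | cons sl τ ih =>
    obtain ⟨a, g, c⟩ := sl
    obtain ⟨A, B, hg⟩ := hs _ List.mem_cons_self
    simp only at hg
    subst hg
    obtain ⟨h₁, h₂⟩ := ht
    obtain ⟨Γ₁, Γ', rfl, h₃, rfl⟩ := fw_eq_append h₁
    obtain ⟨Γ₁, X, rfl, rfl, hX⟩ := fw_eq_append h₃.symm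
    obtain rfl : X = [A, B] := fw_injective (by rw [← hX]; rfl)
    obtain ⟨σ, hσ⟩ := ih (Γ := Γ₁ ++ [B, A] ++ Γ') (fun s h => hs s (List.mem_cons_of_mem _ h))
      (by simpa [CGate.cod] using h₂)
    refine ⟨_, Realizes.trans (τ := [⟨fw Γ₁, .swap A B, fw Γ'⟩]) (σ := .block Γ₁ [A] [B] Γ') ?_ hσ⟩
    refine realizes_of_trace (swapOnly_swap _ _ A B)
      (typed_slice _ _ _ (by simp [CGate.dom]) (by simp [CGate.cod])) fun i => ?_
    rw [Reorder.fn_block]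
    simp only [trace, Equiv.swap_apply_def, length_fw, List.length_cons, List.length_nil]
    grind

/-- Each operator acts as an exchange of two neighbours; successive exchanges compose, and only the
total permutation matters. -/
theorem eval_twist {Γ Δ : List (Formula α)} {τ : List (Slice (Color α) (CGate α))}
    {σ : Reorder Γ Δ} (h : Realizes τ σ) (d : Deriv Γ) :
    Eval (incl (whisker [.L] τ [.R])) [mk d] [mk (.ex σ d)] := by
  rw [realizes_iff] at h
  obtain ⟨hs, ht, htr⟩ := h
  induction τ generalizing Γ with
  | nil =>
    rw [mk_ex_of_fn (fun i => by rw [← htr]; rfl)]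
    rfl
  | cons sl τ ih =>
    obtain ⟨a, g, c⟩ := sl
    obtain ⟨A, B, hg⟩ := hs _ List.mem_cons_self
    simp only at hg
    subst hg
    obtain ⟨h₁, h₂⟩ := ht
    obtain ⟨Γ₁, Γ', rfl, h₃, rfl⟩ := fw_eq_append h₁
    obtain ⟨Γ₁, X, rfl, rfl, hX⟩ := fw_eq_append h₃.symm
    obtain rfl : X = [A, B] := fw_injective (by rw [← hX]; rfl)
    have hs' : SwapOnly τ := fun s hs₁ => hs s (List.mem_cons_of_mem _ hs₁)
    have h₂' : (control α).Typed τ (fw (Γ₁ ++ [B, A] ++ Γ')) (fw Δ) := by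
      simpa [CGate.cod] using h₂
    obtain ⟨σ', hσ'⟩ := hs'.exists_realizes h₂'
    have e := ih (Γ := Γ₁ ++ [B, A] ++ Γ') (σ := σ') (.ex (.block Γ₁ [A] [B] Γ') d) hs' h₂'
      (realizes_iff.1 hσ').2.2
    have e' : mk (.ex σ' (.ex (.block Γ₁ [A] [B] Γ') d)) = mk (.ex σ d) := by
      rw [mk_ex_ex]
      refine mk_ex_congr rfl fun i => ?_
      rw [Reorder.fn_trans, ← htr, Reorder.fn_block, ← (realizes_iff.1 hσ').2.2]
      simp only [trace, Equiv.swap_apply_def, length_fw, List.length_cons, List.length_nil]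
      grind
    rw [e'] at e
    exact ⟨_, (Core.loc (.swap A B) rfl Γ₁ Γ' d).step.frame_eq [] [] rfl rfl rfl (by simp), e⟩

/-- Every action of the left diagram, in any context, is an action of the right one. -/
def Sound (x : List (Color α)) (l r : List (Slice (Color α) (FGate α))) : Prop :=
  ∀ (a b : List (Color α)) (s t : List (Item α)), word s = a ++ x ++ b →
    Eval (whisker a l b) s t → Eval (whisker a r b) s t

/-- The first string of the nonempty word `X` picks one block, and both diagrams then act inside
that item. By determinism one outcome on a single derivation suffices. -/
theorem sound_of_local {X : List (Formula α)} (hX : X ≠ [])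
    {l r : List (Slice (Color α) (CGate α))}
    (h : ∀ (Γ Δ : List (Formula α)) (d : Deriv (Γ ++ X ++ Δ)), ∃ x,
      Eval (incl (whisker (.L :: fw Γ) l (fw Δ ++ [.R]))) [mk d] [x] ∧
      Eval (incl (whisker (.L :: fw Γ) r (fw Δ ++ [.R]))) [mk d] [x]) :
    Sound (fw X) (incl l) (incl r) := by
  intro a b s t hs ht
  obtain ⟨A, X, rfl⟩ := List.exists_cons_of_ne_nil hX
  obtain ⟨bs₁, Γ, Δ, bs₂, hbs, rfl, hc⟩ := exists_split_fm (bs := s.map Sigma.fst) (a := a) (A := A)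
    (c := fw X ++ b) (hs.trans (by simp))
  obtain ⟨Δ, rfl, rfl⟩ := fw_prefix hc
  obtain ⟨S, T, rfl, hS, hT⟩ := exists_state_append (bs := bs₁)
      (bs' := (Γ ++ (A :: X) ++ Δ) :: bs₂) (by rw [word, hbs]; simp)
  obtain ⟨d, T, rfl, hT₁⟩ := exists_state_cons hT
  obtain ⟨x, h₁, h₂⟩ := h Γ Δ d
  have h₃ := h₁.frame_eq (r := S ++ mk d :: T) (ψ := whisker (bs₁.flatMap blk ++ .L :: fw Γ) (incl l)
      (fw Δ ++ .R :: bs₂.flatMap blk)) S T (by simp [incl_whisker, hS, hT₁]) (by simp) rfl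
  rw [ht.unique h₃]
  exact h₂.frame_eq S T (by simp [incl_whisker, hS, hT₁]) (by simp) rfl

/-- The output of a closed diagram begins with `L`, so in a context where it acts it must stand
between two blocks. -/
theorem sound_of_closed {Γ : List (Formula α)} {bs : List (List (Formula α))}
    {l r : List (Slice (Color α) (FGate α))}
    (hl : (full α).Typed l [] ((Γ :: bs).flatMap blk))
    (h : ∀ t, Eval l [] t → word t = (Γ :: bs).flatMap blk → Eval r [] t) : Sound [] l r := by
  intro a b s t hs ht
  obtain ⟨t₀, h₁, h₂⟩ := exists_eval (s := []) hl
  have h₃ : word t = a ++ (Γ :: bs).flatMap blk ++ b := by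
    refine (ht.typed.unique ?_)
    rw [hs]
    simpa using hl.whisker a b
  obtain ⟨bs₁, bs₂, -, rfl, h₄⟩ := exists_split_L (bs := t.map Sigma.fst) (a := a)
    (c := fw Γ ++ .R :: (bs.flatMap blk ++ b)) (h₃.trans (by simp [blk]))
  obtain ⟨bs₃, -, rfl⟩ := exists_split_left (ws := Γ :: bs) (r := b) (bs := bs₂)
    (by rw [← h₄]; simp [blk])
  obtain ⟨S, T, rfl, hS, hT⟩ := exists_state_append (bs := bs₁) (bs' := bs₃) (hs.trans (by simp))
  have h₅ := h₁.frame_eq S T rfl (r := S ++ T) (by simp) rfl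
  rw [hS, hT] at h₅
  rw [ht.unique h₅]
  exact (h t₀ h₁ h₂).frame_eq S T (by rw [hS, hT]) (by simp) rfl

theorem sound_of_swapOnly {X : List (Formula α)} (hX : X ≠ []) {Y : List (Formula α)}
    {l r : List (Slice (Color α) (CGate α))} (hl : SwapOnly l) (hr : SwapOnly r)
    (tl : (control α).Typed l (fw X) (fw Y)) (tr : (control α).Typed r (fw X) (fw Y))
    (h : ∀ i, trace l i = trace r i) : Sound (fw X) (incl l) (incl r) := by
  refine sound_of_local hX fun Γ Δ d => ?_
  have t₁ : (control α).Typed (whisker (fw Γ) l (fw Δ)) (fw (Γ ++ X ++ Δ)) (fw (Γ ++ Y ++ Δ)) := by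
    simpa using tl.whisker (fw Γ) (fw Δ)
  have t₂ : (control α).Typed (whisker (fw Γ) r (fw Δ)) (fw (Γ ++ X ++ Δ)) (fw (Γ ++ Y ++ Δ)) := by
    simpa using tr.whisker (fw Γ) (fw Δ)
  obtain ⟨σ, hσ⟩ := (hl.whisker _ _).exists_realizes t₁
  have hσ' : Realizes (whisker (fw Γ) r (fw Δ)) σ :=
    realizes_of_trace (hr.whisker _ _) t₂ fun i => by
      rw [← (realizes_iff.1 hσ).2.2, trace_whisker, trace_whisker, h]
  exact ⟨_, by simpa using eval_twist hσ d, by simpa using eval_twist hσ' d⟩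

/-- Treats `par_swap` and `bot_swap` at once; `τ` is the crossing of the active formulas with `C`.
-/
theorem sound_un_swap (r : UnRule α) (C : Formula α) {τ : List (Slice (Color α) (CGate α))}
    (hs : SwapOnly τ) (ht : (control α).Typed τ (fw (r.act ++ [C])) (fw ([C] ++ r.act)))
    (htr : ∀ i, trace τ i = trace (cross r.act [C]) i) :
    Sound (fw (r.act ++ [C])) (incl [⟨[], .un r, [.fm C]⟩, ⟨[], .swap r.prin C, []⟩])
      (incl (τ ++ [⟨[.fm C], .un r, []⟩])) := by
  refine sound_of_local (by simp) fun Γ Δ d => ⟨_, ⟨_, (Core.loc (.un r) rfl Γ ([C] ++ Δ)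
    (d.recast (by simp [Loc.dom]))).step.frame_eq [] [] ?_ rfl ?_ ?_, ⟨_, (Core.loc (.swap r.prin C)
    rfl Γ Δ (Deriv.recast (Γ := Γ ++ [r.prin] ++ ([C] ++ Δ)) (Loc.op Γ ([C] ++ Δ) (.un r)
      (d.recast (by simp [Loc.dom]))) (by simp [Loc.dom]))).step.frame_eq [] [] ?_ rfl ?_ ?_, rfl⟩⟩, ?_⟩
  · simp
  · simp
  · simp
  · exact congrArg (· :: []) (mk_recast _ _).symm
  · simp
  · simp
  · have t : (control α).Typed (whisker (fw Γ) τ (fw Δ)) (fw (Γ ++ (r.act ++ [C]) ++ Δ))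
        (fw (Γ ++ ([C] ++ r.act) ++ Δ)) := by simpa using ht.whisker (fw Γ) (fw Δ)
    obtain ⟨σ, hσ⟩ := (hs.whisker _ _).exists_realizes t
    rw [whisker_append, incl_append]
    refine (by simpa using eval_twist hσ d : Eval _ _ _).append (eval_singleton.2 ?_)
    refine (Core.loc (.un r) rfl (Γ ++ [C]) Δ
      ((Deriv.ex σ d).recast (by simp [Loc.dom]))).step.frame_eq [] [] ?_ ?_ ?_ ?_
    · exact congrArg (· :: []) (mk_recast _ _).symm
    -- The context `Γ, C, Δ` is not rearranged at all: only the place of the rule moves, from before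
    -- `C` to after it.
    · have e := mk_unaryAt_ex (Γ := Γ) (Δ := [C] ++ Δ) (Γ' := Γ ++ [C]) (Δ' := Δ)
        (.ofEq (by simp)) r (d.recast (by simp))
      refine congrArg (· :: []) (Eq.trans ?_ (e.symm.trans (mk_unaryAt_congr ?_ rfl)))
      · refine mk_ex_congr (mk_recast _ _) fun i => ?_
        simp only [Reorder.fn_around, Reorder.fn_block, Reorder.fn_ofEq]
        simp only [List.length_append, List.length_cons, List.length_nil]
        split_ifs <;> omega
      · refine Eq.trans ?_ (mk_recast _ _).symm
        refine mk_ex_congr (mk_recast _ _) fun i => ?_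
        rw [← (realizes_iff.1 hσ).2.2, trace_whisker, htr, trace_cross]
        simp only [Reorder.fn_around, Reorder.fn_ofEq]
        simp only [length_fw, List.length_append, List.length_cons, List.length_nil]
        split_ifs <;> omega
    · simp
    · simp

theorem sound_swap_un (r : UnRule α) (C : Formula α) {τ : List (Slice (Color α) (CGate α))}
    (hs : SwapOnly τ) (ht : (control α).Typed τ (fw ([C] ++ r.act)) (fw (r.act ++ [C])))
    (htr : ∀ i, trace τ i = trace (cross [C] r.act) i) :
    Sound (fw ([C] ++ r.act)) (incl [⟨[.fm C], .un r, []⟩, ⟨[], .swap C r.prin, []⟩])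
      (incl (τ ++ [⟨[], .un r, [.fm C]⟩])) := by
  refine sound_of_local (by simp) fun Γ Δ d => ⟨_, ⟨_, (Core.loc (.un r) rfl (Γ ++ [C]) Δ
    (d.recast (by simp [Loc.dom]))).step.frame_eq [] [] ?_ rfl ?_ ?_, ⟨_, (Core.loc (.swap C r.prin)
    rfl Γ Δ (Deriv.recast (Γ := Γ ++ [C] ++ [r.prin] ++ Δ) (Loc.op (Γ ++ [C]) Δ (.un r)
      (d.recast (by simp [Loc.dom]))) (by simp [Loc.dom]))).step.frame_eq [] [] ?_ rfl ?_ ?_, rfl⟩⟩, ?_⟩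
  · simp
  · simp
  · simp
  · exact congrArg (· :: []) (mk_recast _ _).symm
  · simp
  · simp
  · have t : (control α).Typed (whisker (fw Γ) τ (fw Δ)) (fw (Γ ++ ([C] ++ r.act) ++ Δ))
        (fw (Γ ++ (r.act ++ [C]) ++ Δ)) := by simpa using ht.whisker (fw Γ) (fw Δ)
    obtain ⟨σ, hσ⟩ := (hs.whisker _ _).exists_realizes t
    rw [whisker_append, incl_append]
    refine (by simpa using eval_twist hσ d : Eval _ _ _).append (eval_singleton.2 ?_)
    refine (Core.loc (.un r) rfl Γ ([C] ++ Δ)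
      ((Deriv.ex σ d).recast (by simp [Loc.dom]))).step.frame_eq [] [] ?_ ?_ ?_ ?_
    · exact congrArg (· :: []) (mk_recast _ _).symm
    · have e := mk_unaryAt_ex (Γ := Γ ++ [C]) (Δ := Δ) (Γ' := Γ) (Δ' := [C] ++ Δ)
        (.ofEq (by simp)) r (d.recast (by simp))
      refine congrArg (· :: []) (Eq.trans ?_ (e.symm.trans (mk_unaryAt_congr ?_ rfl)))
      · refine mk_ex_congr (mk_recast _ _) fun i => ?_
        simp only [Reorder.fn_around, Reorder.fn_block, Reorder.fn_ofEq]
        simp only [List.length_append, List.length_cons, List.length_nil]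
        split_ifs <;> omega
      · refine Eq.trans ?_ (mk_recast _ _).symm
        refine mk_ex_congr (mk_recast _ _) fun i => ?_
        rw [← (realizes_iff.1 hσ).2.2, trace_whisker, htr, trace_cross]
        simp only [Reorder.fn_around, Reorder.fn_ofEq]
        simp only [length_fw, List.length_append, List.length_cons, List.length_nil]
        split_ifs <;> omega
    · simp
    · simp

theorem sound_ax_swap (A : Formula α) :
    Sound [] (incl [⟨[], .ax A, []⟩, ⟨[.L], .swap A A.neg, [.R]⟩]) (incl [⟨[], .ax A.neg, []⟩]) := by
  refine sound_of_closed (Γ := [A.neg, A]) (bs := []) ?_ fun t ht _ => ?_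
  · exact ⟨rfl, rfl, rfl⟩
  · have h : Eval (incl [⟨[], .ax A, []⟩, ⟨[.L], .swap A A.neg, [.R]⟩]) []
        [mk (.ex (.comm [A] [A.neg]) (.ax A))] := by
      refine ⟨_, (Core.ax A).step, _, (Core.loc (.swap A A.neg) rfl [] [] (.ax A)).step, ?_⟩
      refine congrArg (· :: []) (mk_ex_congr rfl fun i => ?_)
      rw [Reorder.fn_block, Reorder.fn_comm]
      simp only [List.length_cons, List.length_nil]
      split_ifs <;> omega
    rw [ht.unique h, mk_eq_iff.2 (.ex_ax A), mk_recast]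
    exact ⟨_, (Core.ax A.neg).step, rfl⟩

theorem sound_control {x y : List (Color α)} {l r : List (Slice (Color α) (CGate α))}
    (h : ControlCell l r) (hl : (control α).Typed l x y) (hr : (control α).Typed r x y) :
    Sound x (incl l) (incl r) := by
  cases h with
  | swap_swap A B =>
    obtain rfl := hl.1
    exact sound_of_swapOnly (X := [A, B]) (Y := [A, B]) (by simp) ((swapOnly_swap _ _ A B).append (swapOnly_swap _ _ B A))
      swapOnly_nil ⟨rfl, rfl, rfl⟩ rfl fun i => by simp [trace]
  | yang_baxter A B C =>
    obtain rfl := hl.1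
    refine sound_of_swapOnly (X := [A, B, C]) (Y := [C, B, A]) (by simp)
      (((swapOnly_swap _ _ A B).append (swapOnly_swap _ _ A C)).append (swapOnly_swap _ _ B C))
      (((swapOnly_swap _ _ B C).append (swapOnly_swap _ _ A C)).append (swapOnly_swap _ _ A B))
      ⟨rfl, rfl, rfl, rfl⟩ ⟨rfl, rfl, rfl, rfl⟩ fun i => ?_
    simp only [trace, Equiv.swap_apply_def, List.length_cons, List.length_nil]
    grind
  | par_swap A B C =>
    obtain rfl := hl.1
    refine sound_un_swap (.par A B) C (τ := [⟨[.fm A], .swap B C, []⟩, ⟨[], .swap A C, [.fm B]⟩])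
      ((swapOnly_swap _ _ B C).append (swapOnly_swap _ _ A C)) ⟨rfl, rfl, rfl⟩ fun i => ?_
    rw [trace_cross]
    simp only [trace, Equiv.swap_apply_def, UnRule.act, List.length_cons, List.length_nil]
    grind
  | swap_par A B C =>
    obtain rfl := hl.1
    refine sound_swap_un (.par B C) A (τ := [⟨[], .swap A B, [.fm C]⟩, ⟨[.fm B], .swap A C, []⟩])
      ((swapOnly_swap _ _ A B).append (swapOnly_swap _ _ A C)) ⟨rfl, rfl, rfl⟩ fun i => ?_
    rw [trace_cross]
    simp only [trace, Equiv.swap_apply_def, UnRule.act, List.length_cons, List.length_nil]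
    grind
  | ax_swap A =>
    obtain rfl := hl.1
    exact sound_ax_swap A
  | bot_swap A =>
    obtain rfl := hl.1
    exact sound_un_swap .bot A (τ := []) swapOnly_nil rfl fun i => by
      rw [trace_cross]; simp only [trace, UnRule.act, List.length_cons, List.length_nil]; grind
  | swap_bot A =>
    obtain rfl := hl.1
    exact sound_swap_un .bot A (τ := []) swapOnly_nil rfl fun i => by
      rw [trace_cross]; simp only [trace, UnRule.act, List.length_cons, List.length_nil]; grind

/-! ### Soundness of the untangle relations -/

theorem sound_of_states {x : List (Color α)} {ws : List (List (Formula α))} (hw : ws ≠ [])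
    (hx : x = ws.flatMap blk) {l r : List (Slice (Color α) (FGate α))}
    (h : ∀ U, word U = x → ∃ t, Eval l U t ∧ Eval r U t) : Sound x l r := by
  subst hx
  intro a b s t hs ht
  obtain ⟨Γ, ws, rfl⟩ := List.exists_cons_of_ne_nil hw
  obtain ⟨bs₁, bs₂, hbs, rfl, h₄⟩ := exists_split_L (bs := s.map Sigma.fst) (a := a)
    (c := fw Γ ++ .R :: (ws.flatMap blk ++ b)) (hs.trans (by simp [blk]))
  obtain ⟨bs₃, rfl, rfl⟩ := exists_split_left (ws := Γ :: ws) (r := b) (bs := bs₂)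
    (by rw [← h₄]; simp [blk])
  obtain ⟨S, T, rfl, hS, hT⟩ := exists_state_append (bs := bs₁) (bs' := (Γ :: ws) ++ bs₃)
    (by rw [word, hbs])
  obtain ⟨U, T, rfl, hU, hT⟩ := exists_state_append hT
  obtain ⟨t₀, h₁, h₂⟩ := h U hU
  have h₃ := h₁.frame_eq S T rfl (r := S ++ (U ++ T)) (by simp) rfl
  rw [hS, hT] at h₃
  rw [ht.unique h₃]
  exact h₂.frame_eq S T (by rw [hS, hT]) (by simp) rfl

theorem exists_gate_action {g : FGate α} {a c : List (Color α)} {W : List (Letter α)}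
    {U : List (Item α)} (h : word U = a ++ g.dom ++ c) (h₂ : sheaf W = a ++ g.cod ++ c) :
    ∃ U', Step U ⟨a, g, c⟩ U' ∧ word U' = sheaf W := by
  obtain ⟨ws, -, hw⟩ := exists_blocks_of_sheaf W
  obtain ⟨U', hU'⟩ := exists_step h (h₂.symm.trans hw)
  exact ⟨U', hU', by rw [hU'.word_cod, h₂]⟩

/-- Acting on a sublist commutes with exchanging it with its neighbour. The diagram `χ` is what
remains above the gate: a `B`-gate in `untangle_left`, and nothing in `untangle_left_nil`, where
`ws` is empty. -/
theorem sound_untangle_left (g : FGate α) (a c : List (Color α)) (W₂ W' : List (Letter α))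
    {ws : List (List (Formula α))} (h : ws.flatMap blk = a ++ g.dom ++ c)
    (h₂ : sheaf W₂ = a ++ g.cod ++ c) {χ : List (Slice (Color α) (FGate α))}
    (hχ : ∀ U V, word U = ws.flatMap blk → word V = sheaf W' → Eval χ (U ++ V) (V ++ U)) :
    Sound (a ++ g.dom ++ (c ++ sheaf W'))
      [⟨a, g, c ++ sheaf W'⟩, ⟨[], .big W₂ W', []⟩] (χ ++ [⟨sheaf W' ++ a, g, c⟩]) := by
  obtain ⟨ws', hw, hw'⟩ := exists_blocks_of_sheaf W'
  have hx : a ++ g.dom ++ (c ++ sheaf W') = (ws ++ ws').flatMap blk := by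
    rw [List.flatMap_append, h, ← hw']; simp
  refine sound_of_states (by simp [hw]) hx fun s hs => ?_
  obtain ⟨U, V, rfl, hU, hV⟩ := exists_state_append (hs.trans hx)
  rw [← hw'] at hV
  obtain ⟨U', hU', hW⟩ := exists_gate_action (hU.trans h) h₂
  refine ⟨V ++ U', ⟨_, hU'.frame_eq [] V rfl rfl rfl (by rw [hV]),
    eval_singleton.2 (Core.big hW hV).step⟩, (hχ U V hU hV).append (eval_singleton.2 ?_)⟩
  exact hU'.frame_eq V [] (by simp) (by simp) (by rw [hV]) (by simp)

theorem sound_untangle_right (g : FGate α) (a c : List (Color α)) (W₂ W' : List (Letter α))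
    {ws : List (List (Formula α))} (h : ws.flatMap blk = a ++ g.dom ++ c)
    (h₂ : sheaf W₂ = a ++ g.cod ++ c) {χ : List (Slice (Color α) (FGate α))}
    (hχ : ∀ U V, word U = ws.flatMap blk → word V = sheaf W' → Eval χ (V ++ U) (U ++ V)) :
    Sound (sheaf W' ++ a ++ g.dom ++ c)
      [⟨sheaf W' ++ a, g, c⟩, ⟨[], .big W' W₂, []⟩] (χ ++ [⟨a, g, c ++ sheaf W'⟩]) := by
  obtain ⟨ws', hw, hw'⟩ := exists_blocks_of_sheaf W'
  have hx : sheaf W' ++ a ++ g.dom ++ c = (ws' ++ ws).flatMap blk := by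
    rw [List.flatMap_append, h, ← hw']; simp
  refine sound_of_states (by simp [hw]) hx fun s hs => ?_
  obtain ⟨V, U, rfl, hV, hU⟩ := exists_state_append (hs.trans hx)
  rw [← hw'] at hV
  obtain ⟨U', hU', hW⟩ := exists_gate_action (hU.trans h) h₂
  refine ⟨U' ++ V, ⟨_, hU'.frame_eq V [] (by simp) rfl (by rw [hV]) (by simp),
    eval_singleton.2 ?_⟩, (hχ U V hU hV).append (eval_singleton.2 ?_)⟩
  · simpa using (Core.big hV hW).step
  · exact hU'.frame_eq [] V rfl rfl rfl (by rw [hV])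

theorem eval_big {W W' : List (Letter α)} {U V : List (Item α)} (hU : word U = sheaf W)
    (hV : word V = sheaf W') : Eval [⟨[], .big W W', []⟩] (U ++ V) (V ++ U) :=
  eval_singleton.2 (Core.big hU hV).step

theorem eq_nil_of_word_eq_nil {s : List (Item α)} (h : word s = []) : s = [] := by
  cases s with
  | nil => rfl
  | cons x s => simp [blk] at h

/-! ### Diagrams without control strings -/

/-- For a gate of `N` between the strings `A` and `C`, the context consists of these strings
together with the context of `N`. This compares the rearrangement of the larger context with that of
the smaller one. -/
theorem Reorder.fn_around_around {Γ Δ Γ' Δ' : List (Formula α)} (ρ : Reorder (Γ ++ Δ) (Γ' ++ Δ'))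
    (A X C : List (Formula α)) {S T : List (Formula α)} (hS : Γ ++ A ++ (C ++ Δ) = S)
    (hT : T = Γ' ++ A ++ (C ++ Δ')) (h : S = Γ ++ (A ++ C) ++ Δ) (h' : Γ' ++ (A ++ C) ++ Δ' = T)
    (i : ℕ) :
    (Reorder.around (Γ := Γ ++ A) (Δ := C ++ Δ) (Γ' := Γ' ++ A) (Δ' := C ++ Δ')
      ((Reorder.ofEq (hS.trans h)).trans ((ρ.around (A ++ C)).trans (.ofEq (h'.trans hT)))) X).fn i =
      (ρ.around (A ++ X ++ C)).fn i := by
  have h1 := ρ.length_eq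
  have h2 (j : ℕ) := ρ.fn_lt (i := j)
  have h4 (j : ℕ) := ρ.fn_of_le (i := j)
  simp only [Reorder.fn_around, Reorder.fn_trans, Reorder.fn_ofEq]
  simp only [List.length_append] at *
  generalize hj : (if i < Γ'.length then i else i - (A.length + X.length + C.length)) = j
  generalize hl : (if i < Γ'.length + A.length then i else i - X.length) = l
  have h3 := h2 j
  have h5 := h4 j
  generalize hk : (if l < Γ'.length then l else l - (A.length + C.length)) = k
  -- The positions `j` and `k` can differ only inside the block `A, X, C`, where the value of `ρ`
  -- plays no role.
  by_cases hjk : j = k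
  · subst hjk
    generalize ρ.fn j = m at *
    clear h2 h4
    split_ifs at hj <;> split_ifs at hl <;> split_ifs at hk <;> split_ifs <;> omega
  · clear h2 h4 h3 h5
    split_ifs at hj <;> split_ifs at hl <;> split_ifs at hk <;> split_ifs <;> omega

/-- Each gate of `N` commutes with exchanges of its context (`mk_op_ex`). The point is uniformity in
`ρ`: a single `d'` describes `N` wherever its strings are placed among the others. -/
theorem eval_noControl {N : List (Slice (Color α) (CGate α))} (hN : NoControl N)
    {X X' : List (Formula α)} (ht : (control α).Typed N (fw X) (fw X')) {Γ Δ : List (Formula α)}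
    (d : Deriv (Γ ++ X ++ Δ)) : ∃ d' : Deriv (Γ ++ X' ++ Δ),
      ∀ (Γ₂ Δ₂ : List (Formula α)) (ρ : Reorder (Γ ++ Δ) (Γ₂ ++ Δ₂)),
        Eval (incl (whisker (.L :: fw Γ₂) N (fw Δ₂ ++ [.R]))) [mk (.ex (ρ.around X) d)]
          [mk (.ex (ρ.around X') d')] := by
  induction N generalizing X with
  | nil =>
    obtain rfl : X = X' := fw_injective ht
    exact ⟨d, fun _ _ _ => rfl⟩
  | cons sl N ih =>
    obtain ⟨a, g, c⟩ := sl
    obtain ⟨l, rfl⟩ : ∃ l : Loc α, g = l.gate := by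
      rcases hN _ List.mem_cons_self with ⟨A, B, h⟩ | ⟨r, h⟩
      · exact ⟨.swap A B, h⟩
      · exact ⟨.un r, h⟩
    obtain ⟨h₁, h₂⟩ := ht
    simp only [l.gate_dom, l.gate_cod] at h₁ h₂
    obtain ⟨X₁, C, rfl, h₃, rfl⟩ := fw_eq_append h₁
    obtain ⟨A, Y, rfl, rfl, hX⟩ := fw_eq_append h₃.symm
    obtain rfl := fw_injective hX
    obtain ⟨d', hd'⟩ := ih (X := A ++ l.cod ++ C) (fun s h => hN s (List.mem_cons_of_mem _ h))
      (by simpa using h₂) ((l.op (Γ ++ A) (C ++ Δ) (d.recast (by simp))).recast (by simp))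
    refine ⟨d', fun Γ₂ Δ₂ ρ => ⟨_, (Core.loc l rfl (Γ₂ ++ A) (C ++ Δ₂)
      ((Deriv.ex (ρ.around (A ++ l.dom ++ C)) d).recast (by simp))).step.frame_eq [] []
      ?_ rfl ?_ ?_, ?_⟩⟩
    · exact congrArg (· :: []) (mk_recast _ _).symm
    · simp
    · simp
    · have e := Loc.mk_op_ex (Γ := Γ ++ A) (Δ := C ++ Δ) (Γ' := Γ₂ ++ A) (Δ' := C ++ Δ₂)
        ((Reorder.ofEq (by simp)).trans ((ρ.around (A ++ C)).trans (.ofEq (by simp)))) l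
        (d.recast (by simp))
      have e' : mk (l.op (Γ₂ ++ A) (C ++ Δ₂) ((Deriv.ex (ρ.around (A ++ l.dom ++ C)) d).recast
          (by simp))) = mk (.ex (ρ.around (A ++ l.cod ++ C))
            ((l.op (Γ ++ A) (C ++ Δ) (d.recast (by simp))).recast (by simp))) := by
        refine (Loc.mk_op_congr ?_ rfl).trans (e.trans ?_)
        · refine (mk_recast _ _).trans (mk_ex_congr (mk_recast _ _).symm fun i => ?_)
          exact (Reorder.fn_around_around ρ A l.dom C (S := Γ ++ A ++ (C ++ Δ)) rfl rfl (by simp) (by simp) i).symm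
        · refine mk_ex_congr (mk_recast _ _).symm fun i => ?_
          exact Reorder.fn_around_around ρ A l.cod C (S := Γ ++ A ++ (C ++ Δ)) rfl rfl (by simp) (by simp) i
      rw [List.nil_append, List.append_nil, e']
      exact hd' _ _ ρ

theorem Reorder.fn_around_ofEq {Γ Δ : List (Formula α)} (X : List (Formula α)) (i : ℕ) :
    ((Reorder.refl (Γ ++ Δ)).around X).fn i = i := by
  simp only [Reorder.fn_around, Reorder.fn_refl]
  split_ifs <;> omega

/-- The interchange rule for a diagram and a gate on its right. -/
theorem eval_diagram_gate {ψ χ : List (Slice (Color α) (FGate α))} {x y : List (Color α)}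
    (ht : (full α).Typed ψ x y) (h : FGate α) (a b c : List (Color α)) {s t : List (Item α)} :
    Eval (whisker a ψ (b ++ h.dom ++ c) ++ ⟨a ++ y ++ b, h, c⟩ :: χ) s t ↔
      Eval (⟨a ++ x ++ b, h, c⟩ :: (whisker a ψ (b ++ h.cod ++ c) ++ χ)) s t := by
  induction ψ generalizing x s with
  | nil => obtain rfl := ht; rfl
  | cons sl ψ ih =>
    obtain ⟨p, g, q⟩ := sl
    obtain ⟨rfl, ht⟩ := ht
    have e := eval_interchange_iff (s := s) (t := t) (Interchange.mk (P := full α) []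
      (whisker a ψ (b ++ h.cod ++ c) ++ χ) g h (a ++ p) (q ++ b) c)
    simp only [whisker_cons, List.cons_append, Eval, ih ht] at e ⊢
    simpa [Eval] using e

/-- The interchange rule for a gate and a diagram on its right. -/
theorem eval_gate_diagram {ψ χ : List (Slice (Color α) (FGate α))} {x y : List (Color α)}
    (ht : (full α).Typed ψ x y) (g : FGate α) (a b c : List (Color α)) {s t : List (Item α)} :
    Eval (⟨a, g, b ++ x ++ c⟩ :: (whisker (a ++ g.cod ++ b) ψ c ++ χ)) s t ↔
      Eval (whisker (a ++ g.dom ++ b) ψ c ++ ⟨a, g, b ++ y ++ c⟩ :: χ) s t := by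
  induction ψ generalizing x s with
  | nil => obtain rfl := ht; rfl
  | cons sl ψ ih =>
    obtain ⟨p, h, q⟩ := sl
    obtain ⟨rfl, ht⟩ := ht
    have e := eval_interchange_iff (s := s) (t := t) (Interchange.mk (P := full α) []
      (whisker (a ++ g.cod ++ b) ψ c ++ χ) g h a (b ++ p) (q ++ c))
    simp only [whisker_cons, List.cons_append, Eval, ← ih ht] at e ⊢
    simpa [Eval] using e

theorem exists_eval_closed {Γ : List (Formula α)} (φ : (control α).Diagram [] (blk Γ)) :
    ∃ d : Deriv Γ, Eval (incl φ.slices) [] [mk d] := by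
  obtain ⟨t, h, ht⟩ := exists_eval (s := []) (bs := [Γ]) (by simpa using typed_incl _ _ _ φ.typed)
  obtain ⟨d, T, rfl, hT⟩ := exists_state_cons ht
  obtain rfl := eq_nil_of_word_eq_nil hT
  exact ⟨d, h⟩

theorem sound_of_eval {Γ : List (Formula α)} {d : Deriv Γ}
    {l r : List (Slice (Color α) (FGate α))} (hl : Eval l [] [mk d]) (hr : Eval r [] [mk d]) :
    Sound [] l r :=
  sound_of_closed (Γ := Γ) (bs := []) (by simpa using hl.typed) fun t ht _ => by
    rwa [ht.unique hl]

/-! ### Soundness of the introduction of big gates, left -/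

/-- Two instances of `eval_noControl` in which the context keeps its order: `X` in its own place,
and `X` moved to the end of the sequent. -/
theorem eval_noControl_right {N : List (Slice (Color α) (CGate α))} (hN : NoControl N)
    {X X' : List (Formula α)} (ht : (control α).Typed N (fw X) (fw X')) {Γ B : List (Formula α)}
    (d : Deriv (Γ ++ X ++ B)) : ∃ d' : Deriv (Γ ++ X' ++ B),
      Eval (incl (whisker (.L :: fw Γ) N (fw B ++ [.R]))) [mk d] [mk d'] ∧
      Eval (incl (whisker (.L :: fw (Γ ++ B)) N [.R]))
        [mk (.ex (.block Γ X B [] : Reorder _ (Γ ++ B ++ X)) d)]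
        [mk (.ex (.block Γ X' B [] : Reorder _ (Γ ++ B ++ X')) d')] := by
  obtain ⟨d', h⟩ := eval_noControl hN ht d
  refine ⟨d', ?_, ?_⟩
  · have e := h _ _ (.refl _)
    rwa [mk_ex_of_fn (Reorder.fn_around_ofEq X), mk_ex_of_fn (Reorder.fn_around_ofEq X')] at e
  · have e (Y : List (Formula α)) (f : Deriv (Γ ++ Y ++ B)) :
        mk (.ex (Reorder.around (Γ' := Γ ++ B) (Δ' := []) (.ofEq (by simp)) Y) f) =
          mk (.ex (.block Γ Y B [] : Reorder _ (Γ ++ B ++ Y)) f) := by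
      refine mk_ex_congr rfl fun i => ?_
      simp only [Reorder.fn_around, Reorder.fn_ofEq, Reorder.fn_block, List.length_append]
      split_ifs <;> omega
    have e' := h (Γ ++ B) [] (.ofEq (by simp))
    rwa [e, e] at e'

theorem eval_cross (Γ X Y Δ : List (Formula α)) {S T : List (Formula α)}
    (hS : S = Γ ++ (X ++ Y) ++ Δ) (hT : T = Γ ++ (Y ++ X) ++ Δ) (d : Deriv S) :
    Eval (incl (whisker (.L :: fw Γ) (cross X Y) (fw Δ ++ [.R]))) [mk d]
      [mk (.ex (.block Γ X Y Δ hS hT) d)] := by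
  subst hS hT
  have h : Realizes (whisker (fw Γ) (cross X Y) (fw Δ))
      (.block Γ X Y Δ rfl rfl : Reorder (Γ ++ (X ++ Y) ++ Δ) (Γ ++ (Y ++ X) ++ Δ)) := by
    refine realizes_of_trace ((swapOnly_cross _ _).whisker _ _)
      (by simpa using (typed_cross X Y).whisker (fw Γ) (fw Δ)) fun i => ?_
    rw [trace_whisker, trace_cross, Reorder.fn_block, length_fw]
    grind
  simpa using eval_twist h d

theorem eval_bin {Γ Δ : List (Formula α)} (b : BinRule α) (d : Deriv (Γ ++ [b.left]))
    (e : Deriv (b.right :: Δ)) :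
    Eval (incl [⟨.L :: fw Γ, .bin b, fw Δ ++ [.R]⟩]) [mk d, mk e] [mk (.binary b d e)] :=
  eval_singleton.2 (Core.bin b d e).step

/-- The source of `B`-introduction applies `N` after the gate `b`, the target applies it before. One
`d'` must account for both, so that `binary_left` can be used with `d'` as its first premise. -/
theorem exists_noControl_left {N : List (Slice (Color α) (CGate α))} (hN : NoControl N)
    {X X' : List (Formula α)} (ht : (control α).Typed N (fw X) (fw X')) {Γ Δ : List (Formula α)}
    (b : BinRule α) (d : Deriv (Γ ++ X ++ [b.left])) (e : Deriv (b.right :: Δ)) :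
    ∃ d' : Deriv (Γ ++ X' ++ [b.left]),
      Eval (incl (whisker (.L :: fw (Γ ++ [b.left])) N [.R]))
        [mk (.ex (.block Γ X [b.left] [] : Reorder _ (Γ ++ [b.left] ++ X)) d)]
        [mk (.ex (.block Γ X' [b.left] [] : Reorder _ (Γ ++ [b.left] ++ X')) d')] ∧
      Eval (incl (whisker (.L :: fw (Γ ++ b.prin ++ Δ)) N [.R]))
        [mk (.ex (.block Γ X (b.prin ++ Δ) [] : Reorder _ (Γ ++ b.prin ++ Δ ++ X)) (.binary b d e))]
        [mk (.ex (.block Γ X' (b.prin ++ Δ) [] : Reorder _ (Γ ++ b.prin ++ Δ ++ X'))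
          (.binary b d' e))] := by
  obtain ⟨d', h₁, h₂⟩ := eval_noControl_right hN ht d
  obtain ⟨f', h₃, h₄⟩ := eval_noControl_right hN ht (Γ := Γ) (B := b.prin ++ Δ)
    ((Deriv.binary b d e).recast (by simp))
  refine ⟨d', h₂, ?_⟩
  -- Interchange of `N` with the gate `b` identifies the derivation `f'`, obtained by applying `N`
  -- below `b`, with `binary b d' e`.
  have e₁ := (eval_diagram_gate (typed_incl _ _ _ ht) (.ctrl (.bin b)) (.L :: fw Γ) []
    (fw Δ ++ [.R]) (χ := []) (s := [mk d, mk e]) (t := [mk (.binary b d' e)])).1 (by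
      refine (Eval.append (t := [mk d', mk e]) ?_ (by simpa using eval_bin b d' e))
      exact h₁.frame_eq [] [mk e] (by simp [incl_whisker, FGate.dom, CGate.dom, blk]) rfl rfl)
  obtain ⟨r, h₅, h₆⟩ := e₁
  obtain rfl := h₅.unique (by simpa using eval_singleton.1 (eval_bin b d e))
  rw [mk_recast] at h₃
  have e₂ := h₃.unique (by simpa [FGate.cod, CGate.cod, incl_whisker] using h₆)
  simp only [List.cons.injEq, and_true] at e₂
  have e₃ (Y : List (Formula α)) {f : Deriv (Γ ++ Y ++ (b.prin ++ Δ))}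
      {g : Deriv (Γ ++ Y ++ b.prin ++ Δ)} (h : mk f = mk g) :
      mk (.ex (.block Γ Y (b.prin ++ Δ) [] : Reorder _ (Γ ++ (b.prin ++ Δ) ++ Y)) f) =
        mk (.ex (.block Γ Y (b.prin ++ Δ) [] : Reorder _ (Γ ++ b.prin ++ Δ ++ Y)) g) :=
    mk_ex_congr h fun i => by simp only [Reorder.fn_block]
  rw [e₃ X (mk_recast _ _), e₃ X' e₂] at h₄
  simpa using h₄

theorem eval_source_left {Γ P Δ Θ : List (Formula α)} {b c : BinRule α}
    {N : List (Slice (Color α) (CGate α))}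
    {d₁ : Deriv (Γ ++ P ++ [b.left])} {d₂ : Deriv (b.right :: Δ)} {d₃ : Deriv (c.right :: Θ)}
    {d' : Deriv (Γ ++ [c.left] ++ [b.left])}
    (hN : Eval (incl (whisker (.L :: fw (Γ ++ b.prin ++ Δ)) N [.R]))
        [mk (.ex (.block Γ P (b.prin ++ Δ) [] : Reorder _ (Γ ++ b.prin ++ Δ ++ P)) (.binary b d₁ d₂))]
        [mk (.ex (.block Γ [c.left] (b.prin ++ Δ) [] : Reorder _ (Γ ++ b.prin ++ Δ ++ [c.left]))
          (.binary b d' d₂))]) :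
    Eval (incl ([⟨.L :: fw (Γ ++ P), .bin b, fw Δ ++ [.R] ++ blk (c.right :: Θ)⟩]
          ++ whisker (.L :: fw Γ) (cross P (b.prin ++ Δ)) (.R :: blk (c.right :: Θ))
          ++ whisker (.L :: fw (Γ ++ b.prin ++ Δ)) N (.R :: blk (c.right :: Θ))
          ++ [⟨.L :: fw (Γ ++ b.prin ++ Δ), .bin c, fw Θ ++ [.R]⟩])) [mk d₁, mk d₂, mk d₃]
      [mk (.binary c (.ex (.block Γ [c.left] (b.prin ++ Δ) []) (.binary b d' d₂) :
          Deriv (Γ ++ b.prin ++ Δ ++ [c.left])) d₃)] := by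
  simp only [incl_append]
  have h₁ := (eval_bin b d₁ d₂).frame_eq (ψ := incl [⟨.L :: fw (Γ ++ P), .bin b,
    fw Δ ++ [.R] ++ blk (c.right :: Θ)⟩]) [] [mk d₃] (by simp) rfl rfl
  have h₂ := (eval_cross Γ P (b.prin ++ Δ) [] (T := Γ ++ b.prin ++ Δ ++ P) (by simp) (by simp)
    (.binary b d₁ d₂)).frame_eq (ψ := incl (whisker (.L :: fw Γ) (cross P (b.prin ++ Δ))
      (.R :: blk (c.right :: Θ)))) [] [mk d₃] (by simp [incl_whisker]) rfl rfl
  have h₃ := hN.frame_eq (ψ := incl (whisker (.L :: fw (Γ ++ b.prin ++ Δ)) N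
    (.R :: blk (c.right :: Θ)))) [] [mk d₃] (by simp [incl_whisker]) rfl rfl
  exact ((h₁.append h₂).append h₃).append (eval_bin c _ d₃)

/-- The `B`-gate exchanges `d₂` and `d₃` in the list, so that `c` can act before `b`. It remains to
see that the many crossings add up to the exchanges in `binary_left`. -/
theorem eval_target_left {Γ P Δ Θ : List (Formula α)} {b c : BinRule α}
    {N : List (Slice (Color α) (CGate α))}
    {d₁ : Deriv (Γ ++ P ++ [b.left])} {d₂ : Deriv (b.right :: Δ)} {d₃ : Deriv (c.right :: Θ)}
    {d' : Deriv (Γ ++ [c.left] ++ [b.left])}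
    (hN : Eval (incl (whisker (.L :: fw (Γ ++ [b.left])) N [.R]))
        [mk (.ex (.block Γ P [b.left] [] : Reorder _ (Γ ++ [b.left] ++ P)) d₁)]
        [mk (.ex (.block Γ [c.left] [b.left] [] : Reorder _ (Γ ++ [b.left] ++ [c.left])) d')]) :
    Eval (incl (whisker (.L :: fw Γ) (cross P [b.left])
              (.R :: (blk (b.right :: Δ) ++ blk (c.right :: Θ))))
          ++ [⟨blk (Γ ++ [b.left] ++ P),
              .big ((b.right :: Δ).map .fm) ((c.right :: Θ).map .fm), []⟩]
          ++ incl (whisker (.L :: fw (Γ ++ [b.left])) N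
              (.R :: (blk (c.right :: Θ) ++ blk (b.right :: Δ)))
          ++ [⟨.L :: fw (Γ ++ [b.left]), .bin c, fw Θ ++ [.R] ++ blk (b.right :: Δ)⟩]
          ++ whisker (.L :: fw (Γ ++ [b.left])) (cross c.prin Θ) (.R :: blk (b.right :: Δ))
          ++ whisker (.L :: fw Γ) (cross [b.left] (Θ ++ c.prin)) (.R :: blk (b.right :: Δ))
          ++ [⟨.L :: fw (Γ ++ Θ ++ c.prin), .bin b, fw Δ ++ [.R]⟩]
          ++ whisker (.L :: fw Γ) (cross (Θ ++ c.prin) b.prin) (fw Δ ++ [.R])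
          ++ whisker (.L :: fw (Γ ++ b.prin)) (cross (Θ ++ c.prin) Δ) [.R]
          ++ whisker (.L :: fw (Γ ++ b.prin ++ Δ)) (cross Θ c.prin) [.R]))
      [mk d₁, mk d₂, mk d₃]
      [mk (.ex (.block Γ (c.prin ++ Θ) (b.prin ++ Δ) [] : Reorder _ (Γ ++ b.prin ++ Δ ++ c.prin ++ Θ))
          (.binary b (.ex (.block Γ [b.left] (c.prin ++ Θ) [])
            (.binary c (.ex (.block Γ [c.left] [b.left] []) d' :
              Deriv (Γ ++ [b.left] ++ [c.left])) d₃) :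
            Deriv (Γ ++ c.prin ++ Θ ++ [b.left])) d₂))] := by
  simp only [incl_append]
  let f : Deriv (Γ ++ [b.left] ++ c.prin ++ Θ) :=
    .binary c (.ex (.block Γ [c.left] [b.left] []) d' : Deriv (Γ ++ [b.left] ++ [c.left])) d₃
  let f₁ : Deriv (Γ ++ [b.left] ++ Θ ++ c.prin) := .ex (.block (Γ ++ [b.left]) c.prin Θ []) f
  let f₂ : Deriv (Γ ++ Θ ++ c.prin ++ [b.left]) := .ex (.block Γ [b.left] (Θ ++ c.prin) []) f₁
  let g : Deriv (Γ ++ Θ ++ c.prin ++ b.prin ++ Δ) := .binary b f₂ d₂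
  let g₁ : Deriv (Γ ++ b.prin ++ Θ ++ c.prin ++ Δ) := .ex (.block Γ (Θ ++ c.prin) b.prin Δ) g
  let g₂ : Deriv (Γ ++ b.prin ++ Δ ++ Θ ++ c.prin) :=
    .ex (.block (Γ ++ b.prin) (Θ ++ c.prin) Δ []) g₁
  let g₃ : Deriv (Γ ++ b.prin ++ Δ ++ c.prin ++ Θ) := .ex (.block (Γ ++ b.prin ++ Δ) Θ c.prin []) g₂
  let f₀ : Deriv (Γ ++ c.prin ++ Θ ++ [b.left]) := .ex (.block Γ [b.left] (c.prin ++ Θ) []) f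
  -- In the drawing `b` meets the context in the order `Θ, c.prin`, in `binary_left` in the order
  -- `c.prin, Θ`. The difference is an exchange of the context of `b`, which `ex_binary` carries
  -- below the rule in `h₂`.
  have h₁ : mk f₂ = mk (.ex (.append (.block Γ c.prin Θ [] : Reorder (Γ ++ c.prin ++ Θ) (Γ ++ Θ ++ c.prin))
      (.refl [b.left])) f₀) := by
    simp only [f₂, f₁, f₀, mk_ex_ex]
    refine mk_ex_congr rfl fun i => ?_
    simp only [Reorder.fn_trans, Reorder.fn_block, Reorder.fn_append, Reorder.fn_refl,
      List.length_append, List.length_cons, List.length_nil]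
    grind
  have h₂ : mk g₃ = mk (.ex (.block Γ (c.prin ++ Θ) (b.prin ++ Δ) [] :
      Reorder _ (Γ ++ b.prin ++ Δ ++ c.prin ++ Θ)) (.binary b f₀ d₂)) := by
    have e := (mk_binary_congr h₁ (mk_ex_of_fn (σ := Reorder.append (.refl [b.right]) (.refl Δ)) (fun i => by
      simp only [Reorder.fn_append, Reorder.fn_refl]; split_ifs <;> omega) d₂).symm).trans
      (mk_eq_iff.2 (.ex_binary _ _ _ _ _))
    simp only [g₃, g₂, g₁, mk_ex_ex, g]
    refine (mk_ex_congr e fun _ => rfl).trans ?_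
    rw [mk_ex_ex]
    refine mk_ex_congr rfl fun i => ?_
    simp only [Reorder.fn_trans]
    generalize h₃ : (Reorder.block (Γ ++ b.prin ++ Δ) Θ c.prin [] _ _).fn i = j₁
    generalize h₄ : (Reorder.block (Γ ++ b.prin) (Θ ++ c.prin) Δ [] _ _).fn j₁ = j₂
    generalize h₅ : (Reorder.block Γ (Θ ++ c.prin) b.prin Δ _ _).fn j₂ = j₃
    simp only [Reorder.fn_block, Reorder.fn_append, Reorder.fn_refl, List.length_append] at h₃ h₄ h₅ ⊢
    generalize Γ.length = n, Δ.length = m, c.prin.length = k, b.prin.length = p, Θ.length = q at *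
    split_ifs at h₃ <;> (split_ifs at h₄ <;> try omega) <;> (split_ifs at h₅ <;> try omega) <;>
      (split_ifs <;> omega)
  rw [← h₂]
  have s₁ := (eval_cross Γ P [b.left] [] (T := Γ ++ [b.left] ++ P) (by simp) (by simp) d₁).frame_eq
    (ψ := incl (whisker (.L :: fw Γ) (cross P [b.left])
      (.R :: (blk (b.right :: Δ) ++ blk (c.right :: Θ))))) [] [mk d₂, mk d₃] (by simp [incl_whisker])
    rfl rfl
  have s₂ := (eval_big (W := (b.right :: Δ).map .fm) (W' := (c.right :: Θ).map .fm)
    (U := [mk d₂]) (V := [mk d₃]) (by rw [sheaf_map_fm]; simp)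
    (by rw [sheaf_map_fm]; simp)).frame_eq
    (ψ := [⟨blk (Γ ++ [b.left] ++ P), .big ((b.right :: Δ).map .fm) ((c.right :: Θ).map .fm), []⟩])
    [mk (.ex (.block Γ P [b.left] [] : Reorder _ (Γ ++ [b.left] ++ P)) d₁)] [] (by simp) rfl rfl
  have s₃ := hN.frame_eq (ψ := incl (whisker (.L :: fw (Γ ++ [b.left])) N
    (.R :: (blk (c.right :: Θ) ++ blk (b.right :: Δ))))) [] [mk d₃, mk d₂] (by simp [incl_whisker])
    rfl rfl
  have s₄ := (eval_bin (Γ := Γ ++ [b.left]) c (.ex (.block Γ [c.left] [b.left] []) d') d₃).frame_eq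
    (ψ := incl [⟨.L :: fw (Γ ++ [b.left]), .bin c, fw Θ ++ [.R] ++ blk (b.right :: Δ)⟩])
    [] [mk d₂] (by simp) rfl rfl
  have s₅ := (eval_cross (Γ ++ [b.left]) c.prin Θ [] (T := Γ ++ [b.left] ++ Θ ++ c.prin) (by simp)
    (by simp) f).frame_eq (ψ := incl (whisker (.L :: fw (Γ ++ [b.left])) (cross c.prin Θ)
      (.R :: blk (b.right :: Δ)))) [] [mk d₂] (by simp [incl_whisker]) rfl rfl
  have s₆ := (eval_cross Γ [b.left] (Θ ++ c.prin) [] (T := Γ ++ Θ ++ c.prin ++ [b.left]) (by simp)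
    (by simp) f₁).frame_eq (ψ := incl (whisker (.L :: fw Γ) (cross [b.left] (Θ ++ c.prin))
      (.R :: blk (b.right :: Δ)))) [] [mk d₂] (by simp [incl_whisker]) rfl rfl
  have s₈ := eval_cross Γ (Θ ++ c.prin) b.prin Δ (T := Γ ++ b.prin ++ Θ ++ c.prin ++ Δ) (by simp)
    (by simp) g
  have s₉ := eval_cross (Γ ++ b.prin) (Θ ++ c.prin) Δ [] (T := Γ ++ b.prin ++ Δ ++ Θ ++ c.prin)
    (by simp) (by simp) g₁
  have s₀ := eval_cross (Γ ++ b.prin ++ Δ) Θ c.prin [] (T := Γ ++ b.prin ++ Δ ++ c.prin ++ Θ)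
    (by simp) (by simp) g₂
  exact (s₁.append s₂).append ((((((((s₃.append s₄).append s₅).append s₆).append
    (eval_bin b f₂ d₂)).append s₈).append s₉).append s₀))

/-! ### Soundness of the introduction of big gates, right -/

theorem eval_noControl_left {N : List (Slice (Color α) (CGate α))} (hN : NoControl N)
    {X X' : List (Formula α)} (ht : (control α).Typed N (fw X) (fw X')) {B Γ : List (Formula α)}
    (d : Deriv (B ++ X ++ Γ)) : ∃ d' : Deriv (B ++ X' ++ Γ),
      Eval (incl (whisker (.L :: fw B) N (fw Γ ++ [.R]))) [mk d] [mk d'] ∧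
      Eval (incl (whisker [.L] N (fw (B ++ Γ) ++ [.R])))
        [mk (.ex (.block [] B X Γ : Reorder _ (X ++ (B ++ Γ))) d)]
        [mk (.ex (.block [] B X' Γ : Reorder _ (X' ++ (B ++ Γ))) d')] := by
  obtain ⟨d', h⟩ := eval_noControl hN ht d
  refine ⟨d', ?_, ?_⟩
  · have e := h _ _ (.refl _)
    rwa [mk_ex_of_fn (Reorder.fn_around_ofEq X), mk_ex_of_fn (Reorder.fn_around_ofEq X')] at e
  · have e (Y : List (Formula α)) (f : Deriv (B ++ Y ++ Γ)) :
        mk (.ex (Reorder.around (Γ' := []) (Δ' := B ++ Γ) (.ofEq (by simp)) Y) f) =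
          mk (.ex (.block [] B Y Γ : Reorder _ (Y ++ (B ++ Γ))) f) := by
      refine mk_ex_congr rfl fun i => ?_
      simp only [Reorder.fn_around, Reorder.fn_ofEq, Reorder.fn_block, List.length_nil]
      split_ifs <;> omega
    have e' := h [] (B ++ Γ) (.ofEq (by simp))
    rwa [e, e] at e'

theorem exists_noControl_right {N : List (Slice (Color α) (CGate α))} (hN : NoControl N)
    {X X' : List (Formula α)} (ht : (control α).Typed N (fw X) (fw X')) {Γ Δ : List (Formula α)}
    (b : BinRule α) (e : Deriv (Δ ++ [b.left])) (d : Deriv ([b.right] ++ X ++ Γ)) :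
    ∃ d' : Deriv ([b.right] ++ X' ++ Γ),
      Eval (incl (whisker [.L] N (fw ([b.right] ++ Γ) ++ [.R])))
        [mk (.ex (.block [] [b.right] X Γ : Reorder _ (X ++ ([b.right] ++ Γ))) d)]
        [mk (.ex (.block [] [b.right] X' Γ : Reorder _ (X' ++ ([b.right] ++ Γ))) d')] ∧
      Eval (incl (whisker [.L] N (fw (Δ ++ b.prin ++ Γ) ++ [.R])))
        [mk (.ex (.block [] (Δ ++ b.prin) X Γ : Reorder _ (X ++ (Δ ++ b.prin ++ Γ)))
          (.binary b e (d : Deriv (b.right :: (X ++ Γ)))))]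
        [mk (.ex (.block [] (Δ ++ b.prin) X' Γ : Reorder _ (X' ++ (Δ ++ b.prin ++ Γ)))
          (.binary b e (d' : Deriv (b.right :: (X' ++ Γ)))))] := by
  obtain ⟨d', h₁, h₂⟩ := eval_noControl_left hN ht d
  obtain ⟨f', h₃, h₄⟩ := eval_noControl_left hN ht (Γ := Γ) (B := Δ ++ b.prin)
    ((Deriv.binary b e (d : Deriv (b.right :: (X ++ Γ)))).recast (by simp))
  refine ⟨d', h₂, ?_⟩
  have e₁ := (eval_gate_diagram (typed_incl _ _ _ ht) (.ctrl (.bin b)) (.L :: fw Δ) []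
    (fw Γ ++ [.R]) (χ := []) (s := [mk e, mk d])
    (t := [mk (.binary b e (d' : Deriv (b.right :: (X' ++ Γ))))])).2 (by
      refine (Eval.append (t := [mk e, mk d']) ?_
        (by simpa using eval_bin b e (d' : Deriv (b.right :: (X' ++ Γ)))))
      exact h₁.frame_eq [mk e] [] (by simp [incl_whisker, FGate.dom, CGate.dom, blk]) rfl rfl)
  obtain ⟨r, h₅, h₆⟩ := e₁
  obtain rfl := h₅.unique
    (by simpa using eval_singleton.1 (eval_bin b e (d : Deriv (b.right :: (X ++ Γ)))))
  rw [mk_recast] at h₃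
  have e₂ := h₃.unique (by simpa [FGate.cod, CGate.cod, incl_whisker] using h₆)
  simp only [List.cons.injEq, and_true] at e₂
  have e₃ (Y : List (Formula α)) {f : Deriv (Δ ++ b.prin ++ Y ++ Γ)}
      {g : Deriv (Δ ++ b.prin ++ (Y ++ Γ))} (h : mk f = mk g) :
      mk (.ex (.block [] (Δ ++ b.prin) Y Γ : Reorder _ (Y ++ (Δ ++ b.prin ++ Γ))) f) =
        mk (.ex (.block [] (Δ ++ b.prin) Y Γ : Reorder _ (Y ++ (Δ ++ b.prin ++ Γ))) g) :=
    mk_ex_congr h fun i => by simp only [Reorder.fn_block]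
  rw [e₃ X (mk_recast _ _), e₃ X' e₂] at h₄
  exact h₄

theorem eval_source_right {Γ P Δ Θ : List (Formula α)} {b c : BinRule α}
    {N : List (Slice (Color α) (CGate α))}
    {d₁ : Deriv (Θ ++ [c.left])} {d₂ : Deriv (Δ ++ [b.left])} {d₃ : Deriv (b.right :: (P ++ Γ))}
    {d' : Deriv (b.right :: c.right :: Γ)}
    (hN : Eval (incl (whisker [.L] N (fw (Δ ++ b.prin ++ Γ) ++ [.R])))
        [mk (.ex (.block [] (Δ ++ b.prin) P Γ : Reorder _ (P ++ (Δ ++ b.prin ++ Γ)))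
          (.binary b d₂ d₃))]
        [mk (.ex (.block [] (Δ ++ b.prin) [c.right] Γ : Reorder _ (c.right :: (Δ ++ b.prin ++ Γ)))
          (.binary b d₂ d'))]) :
    Eval (incl ([⟨blk (Θ ++ [c.left]) ++ .L :: fw Δ, .bin b, fw (P ++ Γ) ++ [.R]⟩]
          ++ whisker (blk (Θ ++ [c.left]) ++ [.L]) (cross (Δ ++ b.prin) P) (fw Γ ++ [.R])
          ++ whisker (blk (Θ ++ [c.left]) ++ [.L]) N (fw (Δ ++ b.prin ++ Γ) ++ [.R])
          ++ [⟨.L :: fw Θ, .bin c, fw (Δ ++ b.prin ++ Γ) ++ [.R]⟩])) [mk d₁, mk d₂, mk d₃]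
      [mk (.binary c d₁ (.ex (.block [] (Δ ++ b.prin) [c.right] Γ) (.binary b d₂ d') :
          Deriv (c.right :: (Δ ++ b.prin ++ Γ))))] := by
  simp only [incl_append]
  have h₁ := (eval_bin b d₂ d₃).frame_eq (ψ := incl [⟨blk (Θ ++ [c.left]) ++ .L :: fw Δ, .bin b,
    fw (P ++ Γ) ++ [.R]⟩]) [mk d₁] [] (by simp) rfl rfl
  have h₂ := (eval_cross [] (Δ ++ b.prin) P Γ (T := P ++ (Δ ++ b.prin ++ Γ)) (by simp) (by simp)
    (.binary b d₂ d₃)).frame_eq (ψ := incl (whisker (blk (Θ ++ [c.left]) ++ [.L])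
      (cross (Δ ++ b.prin) P) (fw Γ ++ [.R]))) [mk d₁] [] (by simp [incl_whisker]) rfl rfl
  have h₃ := hN.frame_eq (ψ := incl (whisker (blk (Θ ++ [c.left]) ++ [.L]) N
    (fw (Δ ++ b.prin ++ Γ) ++ [.R]))) [mk d₁] [] (by simp [incl_whisker]) rfl rfl
  exact ((h₁.append h₂).append h₃).append (eval_bin c d₁ _)

theorem eval_target_right {Γ P Δ Θ : List (Formula α)} {b c : BinRule α}
    {N : List (Slice (Color α) (CGate α))}
    {d₁ : Deriv (Θ ++ [c.left])} {d₂ : Deriv (Δ ++ [b.left])} {d₃ : Deriv (b.right :: (P ++ Γ))}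
    {d' : Deriv (b.right :: c.right :: Γ)}
    (hN : Eval (incl (whisker [.L] N (fw ([b.right] ++ Γ) ++ [.R])))
        [mk (.ex (.block [] [b.right] P Γ : Reorder _ (P ++ ([b.right] ++ Γ))) d₃)]
        [mk (.ex (.block [] [b.right] [c.right] Γ : Reorder _ (c.right :: b.right :: Γ)) d')]) :
    Eval (incl (whisker (blk (Θ ++ [c.left]) ++ blk (Δ ++ [b.left]) ++ [.L])
              (cross [b.right] P) (fw Γ ++ [.R]))
          ++ [⟨[], .big ((Θ ++ [c.left]).map .fm) ((Δ ++ [b.left]).map .fm),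
              blk (P ++ [b.right] ++ Γ)⟩]
          ++ incl (whisker (blk (Δ ++ [b.left]) ++ blk (Θ ++ [c.left]) ++ [.L]) N
              (fw ([b.right] ++ Γ) ++ [.R])
          ++ [⟨blk (Δ ++ [b.left]) ++ .L :: fw Θ, .bin c, fw ([b.right] ++ Γ) ++ [.R]⟩]
          ++ whisker (blk (Δ ++ [b.left]) ++ .L :: fw Θ) (cross c.prin [b.right]) (fw Γ ++ [.R])
          ++ whisker (blk (Δ ++ [b.left]) ++ [.L]) (cross Θ [b.right]) (fw (c.prin ++ Γ) ++ [.R])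
          ++ [⟨.L :: fw Δ, .bin b, fw (Θ ++ c.prin ++ Γ) ++ [.R]⟩]
          ++ whisker [.L] (cross (Δ ++ b.prin) (Θ ++ c.prin)) (fw Γ ++ [.R])))
      [mk d₁, mk d₂, mk d₃]
      [mk (.ex (.block [] (Δ ++ b.prin) (Θ ++ c.prin) Γ :
          Reorder _ (Θ ++ c.prin ++ (Δ ++ b.prin ++ Γ)))
          (.binary b d₂ (.ex (.block [] (Θ ++ c.prin) [b.right] Γ)
            (.binary c d₁ (.ex (.block [] [b.right] [c.right] Γ) d' :
              Deriv (c.right :: b.right :: Γ))) :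
            Deriv (b.right :: (Θ ++ c.prin ++ Γ)))))] := by
  simp only [incl_append]
  let f : Deriv (Θ ++ c.prin ++ b.right :: Γ) :=
    .binary c d₁ (.ex (.block [] [b.right] [c.right] Γ) d' : Deriv (c.right :: b.right :: Γ))
  let f₁ : Deriv (Θ ++ [b.right] ++ (c.prin ++ Γ)) := .ex (.block Θ c.prin [b.right] Γ) f
  let f₂ : Deriv (b.right :: (Θ ++ c.prin ++ Γ)) := .ex (.block [] Θ [b.right] (c.prin ++ Γ)) f₁
  let g : Deriv (Δ ++ b.prin ++ (Θ ++ c.prin ++ Γ)) := .binary b d₂ f₂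
  let g₁ : Deriv (Θ ++ c.prin ++ (Δ ++ b.prin ++ Γ)) := .ex (.block [] (Δ ++ b.prin) (Θ ++ c.prin) Γ) g
  have h₁ : mk f₂ = mk (.ex (.block [] (Θ ++ c.prin) [b.right] Γ :
      Reorder _ (b.right :: (Θ ++ c.prin ++ Γ))) f) := by
    simp only [f₂, f₁, mk_ex_ex]
    refine mk_ex_congr rfl fun i => ?_
    simp only [Reorder.fn_trans, Reorder.fn_block, List.length_append, List.length_cons,
      List.length_nil]
    grind
  have h₂ := mk_ex_congr (σ := .block [] (Δ ++ b.prin) (Θ ++ c.prin) Γ)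
    (σ' := .block [] (Δ ++ b.prin) (Θ ++ c.prin) Γ) (Δ := Θ ++ c.prin ++ (Δ ++ b.prin ++ Γ))
    (mk_binary_congr (d := d₂) rfl h₁) fun _ => rfl
  rw [← h₂]
  have s₁ := (eval_cross [] [b.right] P Γ (T := P ++ ([b.right] ++ Γ)) (by simp) (by simp) d₃).frame_eq
    (ψ := incl (whisker (blk (Θ ++ [c.left]) ++ blk (Δ ++ [b.left]) ++ [.L])
      (cross [b.right] P) (fw Γ ++ [.R]))) [mk d₁, mk d₂] [] (by simp [incl_whisker]) rfl rfl
  have s₂ := (eval_big (W := (Θ ++ [c.left]).map .fm) (W' := (Δ ++ [b.left]).map .fm)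
    (U := [mk d₁]) (V := [mk d₂]) (by rw [sheaf_map_fm]; simp)
    (by rw [sheaf_map_fm]; simp)).frame_eq
    (ψ := [⟨[], .big ((Θ ++ [c.left]).map .fm) ((Δ ++ [b.left]).map .fm), blk (P ++ [b.right] ++ Γ)⟩])
    [] [mk (.ex (.block [] [b.right] P Γ : Reorder _ (P ++ ([b.right] ++ Γ))) d₃)] (by simp) rfl rfl
  have s₃ := hN.frame_eq (ψ := incl (whisker (blk (Δ ++ [b.left]) ++ blk (Θ ++ [c.left]) ++ [.L]) N
    (fw ([b.right] ++ Γ) ++ [.R]))) [mk d₂, mk d₁] [] (by simp [incl_whisker]) rfl rfl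
  have s₄ := (eval_bin (Δ := b.right :: Γ) c d₁ (.ex (.block [] [b.right] [c.right] Γ) d')).frame_eq
    (ψ := incl [⟨blk (Δ ++ [b.left]) ++ .L :: fw Θ, .bin c, fw ([b.right] ++ Γ) ++ [.R]⟩])
    [mk d₂] [] (by simp) rfl rfl
  have s₅ := (eval_cross Θ c.prin [b.right] Γ (T := Θ ++ [b.right] ++ (c.prin ++ Γ)) (by simp)
    (by simp) f).frame_eq (ψ := incl (whisker (blk (Δ ++ [b.left]) ++ .L :: fw Θ)
      (cross c.prin [b.right]) (fw Γ ++ [.R]))) [mk d₂] [] (by simp [incl_whisker]) rfl rfl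
  have s₆ := (eval_cross [] Θ [b.right] (c.prin ++ Γ) (T := b.right :: (Θ ++ c.prin ++ Γ)) (by simp)
    (by simp) f₁).frame_eq (ψ := incl (whisker (blk (Δ ++ [b.left]) ++ [.L]) (cross Θ [b.right])
      (fw (c.prin ++ Γ) ++ [.R]))) [mk d₂] [] (by simp [incl_whisker]) rfl rfl
  have s₈ := eval_cross [] (Δ ++ b.prin) (Θ ++ c.prin) Γ (T := Θ ++ c.prin ++ (Δ ++ b.prin ++ Γ))
    (by simp) (by simp) g
  exact (s₁.append s₂).append (((((s₃.append s₄).append s₅).append s₆).append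
    (eval_bin b d₂ f₂)).append s₈)

/-! ### Soundness of all relations -/

theorem eq_nil_of_typed_append {P : Polygraph.{u, v}} {φ χ : List (Slice P.Color P.Gate)}
    {x y z : List P.Color} (h : P.Typed φ [] z) (hz : z ≠ []) (h' : P.Typed (φ ++ χ) x y) :
    x = [] := by
  rcases φ with - | ⟨s, φ⟩
  · exact absurd h.symm hz
  · exact h'.1.trans h.1.symm

theorem typed_of_incl {φ : List (Slice (Color α) (CGate α))} {x y : List (Color α)}
    (h : (full α).Typed (incl φ) x y) : (control α).Typed φ x y := by
  induction φ generalizing x with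
  | nil => exact h
  | cons s φ ih => exact ⟨h.1, ih h.2⟩

/-- The closed diagrams evaluate to derivations `d₁`, `d₂`, `d₃`, and `N` turns `d₁` into `d'`;
source and target then evaluate to the two sides of `binary_left` for `d'`, `d₂`, `d₃`. -/
theorem sound_big_intro_left (b c : BinRule α) {Γ P Δ Θ : List (Formula α)}
    (φ : (control α).Diagram [] (blk (Γ ++ P ++ [b.left])))
    (φ₁ : (control α).Diagram [] (blk (b.right :: Δ)))
    (φ₂ : (control α).Diagram [] (blk (c.right :: Θ)))
    {N : List (Slice (Color α) (CGate α))} (ht : (control α).Typed N (fw P) (fw [c.left]))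
    (hN : NoControl N) :
    Sound []
      (incl (φ.slices
          ++ whisker (blk (Γ ++ P ++ [b.left])) φ₁.slices []
          ++ whisker (blk (Γ ++ P ++ [b.left]) ++ blk (b.right :: Δ)) φ₂.slices []
          ++ [⟨.L :: fw (Γ ++ P), .bin b, fw Δ ++ [.R] ++ blk (c.right :: Θ)⟩]
          ++ whisker (.L :: fw Γ) (cross P (b.prin ++ Δ)) (.R :: blk (c.right :: Θ))
          ++ whisker (.L :: fw (Γ ++ b.prin ++ Δ)) N (.R :: blk (c.right :: Θ))
          ++ [⟨.L :: fw (Γ ++ b.prin ++ Δ), .bin c, fw Θ ++ [.R]⟩]))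
      (incl (φ.slices
          ++ whisker (blk (Γ ++ P ++ [b.left])) φ₁.slices []
          ++ whisker (blk (Γ ++ P ++ [b.left]) ++ blk (b.right :: Δ)) φ₂.slices []
          ++ whisker (.L :: fw Γ) (cross P [b.left])
              (.R :: (blk (b.right :: Δ) ++ blk (c.right :: Θ))))
          ++ [⟨blk (Γ ++ [b.left] ++ P),
              .big ((b.right :: Δ).map .fm) ((c.right :: Θ).map .fm), []⟩]
          ++ incl (whisker (.L :: fw (Γ ++ [b.left])) N
              (.R :: (blk (c.right :: Θ) ++ blk (b.right :: Δ)))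
          ++ [⟨.L :: fw (Γ ++ [b.left]), .bin c, fw Θ ++ [.R] ++ blk (b.right :: Δ)⟩]
          ++ whisker (.L :: fw (Γ ++ [b.left])) (cross c.prin Θ) (.R :: blk (b.right :: Δ))
          ++ whisker (.L :: fw Γ) (cross [b.left] (Θ ++ c.prin)) (.R :: blk (b.right :: Δ))
          ++ [⟨.L :: fw (Γ ++ Θ ++ c.prin), .bin b, fw Δ ++ [.R]⟩]
          ++ whisker (.L :: fw Γ) (cross (Θ ++ c.prin) b.prin) (fw Δ ++ [.R])
          ++ whisker (.L :: fw (Γ ++ b.prin)) (cross (Θ ++ c.prin) Δ) [.R]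
          ++ whisker (.L :: fw (Γ ++ b.prin ++ Δ)) (cross Θ c.prin) [.R])) := by
  obtain ⟨d₁, h₁⟩ := exists_eval_closed φ
  obtain ⟨d₂, h₂⟩ := exists_eval_closed φ₁
  obtain ⟨d₃, h₃⟩ := exists_eval_closed φ₂
  obtain ⟨d', hd, hd'⟩ := exists_noControl_left hN ht b d₁ d₂
  have h₀ := (h₁.append (h₂.frame_eq (ψ := incl (whisker (blk (Γ ++ P ++ [b.left])) φ₁.slices []))
    [mk d₁] [] (by simp [incl_whisker]) rfl rfl)).append
    (h₃.frame_eq (ψ := incl (whisker (blk (Γ ++ P ++ [b.left]) ++ blk (b.right :: Δ)) φ₂.slices []))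
      [mk d₁, mk d₂] [] (by simp [incl_whisker]) rfl rfl)
  have hs := h₀.append (eval_source_left (d₃ := d₃) hd')
  have hr := h₀.append (eval_target_left (d₂ := d₂) (d₃ := d₃) hd)
  rw [mk_eq_iff.2 (.binary_left Γ Δ Θ b c d' d₂ d₃)] at hs
  refine sound_of_eval (by simpa using hs) (by simpa using hr)

theorem sound_big_intro_right (b c : BinRule α) {Γ P Δ Θ : List (Formula α)}
    (ψ : (control α).Diagram [] (blk ([b.right] ++ P ++ Γ)))
    (ψ₁ : (control α).Diagram [] (blk (Θ ++ [c.left])))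
    (ψ₂ : (control α).Diagram [] (blk (Δ ++ [b.left])))
    {N : List (Slice (Color α) (CGate α))} (ht : (control α).Typed N (fw P) (fw [c.right]))
    (hN : NoControl N) :
    Sound []
      (incl (ψ₁.slices
          ++ whisker (blk (Θ ++ [c.left])) ψ₂.slices []
          ++ whisker (blk (Θ ++ [c.left]) ++ blk (Δ ++ [b.left])) ψ.slices []
          ++ [⟨blk (Θ ++ [c.left]) ++ .L :: fw Δ, .bin b, fw (P ++ Γ) ++ [.R]⟩]
          ++ whisker (blk (Θ ++ [c.left]) ++ [.L]) (cross (Δ ++ b.prin) P) (fw Γ ++ [.R])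
          ++ whisker (blk (Θ ++ [c.left]) ++ [.L]) N (fw (Δ ++ b.prin ++ Γ) ++ [.R])
          ++ [⟨.L :: fw Θ, .bin c, fw (Δ ++ b.prin ++ Γ) ++ [.R]⟩]))
      (incl (ψ₁.slices
          ++ whisker (blk (Θ ++ [c.left])) ψ₂.slices []
          ++ whisker (blk (Θ ++ [c.left]) ++ blk (Δ ++ [b.left])) ψ.slices []
          ++ whisker (blk (Θ ++ [c.left]) ++ blk (Δ ++ [b.left]) ++ [.L])
              (cross [b.right] P) (fw Γ ++ [.R]))
          ++ [⟨[], .big ((Θ ++ [c.left]).map .fm) ((Δ ++ [b.left]).map .fm),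
              blk (P ++ [b.right] ++ Γ)⟩]
          ++ incl (whisker (blk (Δ ++ [b.left]) ++ blk (Θ ++ [c.left]) ++ [.L]) N
              (fw ([b.right] ++ Γ) ++ [.R])
          ++ [⟨blk (Δ ++ [b.left]) ++ .L :: fw Θ, .bin c, fw ([b.right] ++ Γ) ++ [.R]⟩]
          ++ whisker (blk (Δ ++ [b.left]) ++ .L :: fw Θ) (cross c.prin [b.right]) (fw Γ ++ [.R])
          ++ whisker (blk (Δ ++ [b.left]) ++ [.L]) (cross Θ [b.right]) (fw (c.prin ++ Γ) ++ [.R])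
          ++ [⟨.L :: fw Δ, .bin b, fw (Θ ++ c.prin ++ Γ) ++ [.R]⟩]
          ++ whisker [.L] (cross (Δ ++ b.prin) (Θ ++ c.prin)) (fw Γ ++ [.R]))) := by
  obtain ⟨d₁, h₁⟩ := exists_eval_closed ψ₁
  obtain ⟨d₂, h₂⟩ := exists_eval_closed ψ₂
  obtain ⟨d₃, h₃⟩ := exists_eval_closed ψ
  obtain ⟨d', hd, hd'⟩ := exists_noControl_right hN ht b d₂ d₃
  have h₀ := (h₁.append (h₂.frame_eq (ψ := incl (whisker (blk (Θ ++ [c.left])) ψ₂.slices []))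
    [mk d₁] [] (by simp [incl_whisker]) rfl rfl)).append
    (h₃.frame_eq (ψ := incl (whisker (blk (Θ ++ [c.left]) ++ blk (Δ ++ [b.left])) ψ.slices []))
      [mk d₁, mk d₂] [] (by simp [incl_whisker]) rfl rfl)
  have hs := h₀.append (eval_source_right (Γ := Γ) (P := P) (d₁ := d₁) (d' := d') hd')
  have hr := h₀.append (eval_target_right (Γ := Γ) (P := P) (d₁ := d₁) (d₂ := d₂) (d' := d') hd)
  rw [mk_eq_iff.2 (.binary_right Δ Θ Γ b c d₁ d₂ d')] at hs
  refine sound_of_eval (by simpa using hs) (by simpa using hr)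

theorem sound_cell {x y : List (Color α)} {l r : List (Slice (Color α) (FGate α))}
    (h : FullCell l r) (hl : (full α).Typed l x y) (hr : (full α).Typed r x y) :
    Sound x l r := by
  cases h with
  | control h => exact sound_control h (typed_of_incl hl) (typed_of_incl hr)
  | untangle_left g a c W W₂ W' h h₂ =>
    obtain rfl := hl.1
    obtain ⟨ws, -, hw⟩ := exists_blocks_of_sheaf W
    exact sound_untangle_left (.ctrl g) a c W₂ W' (hw.symm.trans h) h₂ (χ := [⟨[], .big W W', []⟩])
      fun U V hU hV => eval_big (hU.trans hw.symm) hV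
  | untangle_right g a c W W₂ W' h h₂ =>
    obtain rfl := hl.1
    obtain ⟨ws, -, hw⟩ := exists_blocks_of_sheaf W
    exact sound_untangle_right (.ctrl g) a c W₂ W' (hw.symm.trans h) h₂
      (χ := [⟨[], .big W' W, []⟩]) fun U V hU hV => eval_big hV (hU.trans hw.symm)
  | untangle_left_nil g W₂ W' h h₂ =>
    obtain rfl := hl.1
    have e := sound_untangle_left (.ctrl g) [] [] W₂ W' (ws := []) (by simp [FGate.dom, h])
      (by simpa [FGate.cod] using h₂) (χ := []) fun U V hU hV => by
        rw [eq_nil_of_word_eq_nil hU]; simp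
    simpa using e
  | untangle_right_nil g W₂ W' h h₂ =>
    obtain rfl := hl.1
    have e := sound_untangle_right (.ctrl g) [] [] W₂ W' (ws := []) (by simp [FGate.dom, h])
      (by simpa [FGate.cod] using h₂) (χ := []) fun U V hU hV => by
        rw [eq_nil_of_word_eq_nil hU]; simp
    simpa using e
  | big_intro_left b c Γ X Y Z Δ Θ φ φ₁ φ₂ N φ₀ N' hφ hφ₁ hφ₂ hN hN' hNc hNc' hφ₀ =>
    obtain rfl : x = [] := eq_nil_of_typed_append φ.typed (by simp [blk])
      (by simpa only [List.append_assoc] using typed_of_incl hl)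
    exact sound_big_intro_left b c φ φ₁ φ₂ N.typed hNc
  | big_intro_right b c Γ X Y Z Δ Θ ψ ψ₁ ψ₂ N ψ₀ N' hψ hψ₁ hψ₂ hN hN' hNc hNc' hψ₀ =>
    obtain rfl : x = [] := eq_nil_of_typed_append ψ₁.typed (by simp [blk])
      (by simpa only [List.append_assoc] using typed_of_incl hl)
    exact sound_big_intro_right b c ψ ψ₁ ψ₂ N.typed hNc

theorem FullCell.ne_nil {l r : List (Slice (Color α) (FGate α))} (h : FullCell l r) : l ≠ [] := by
  cases h with
  | control h => cases h <;> simp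
  | _ => simp

theorem Eval.rewrite {l r : List (Slice (Color α) (FGate α))} (h : (full α).Rewrite l r)
    {s t : List (Item α)} (hs : Eval l s t) : Eval r s t := by
  obtain ⟨χ, χ', l, r, a, b, x, y, hl, hr, h⟩ := h
  obtain ⟨s₂, h₀, h₂⟩ := eval_append.1 hs
  obtain ⟨s₁, h₁, h₃⟩ := eval_append.1 h₀
  refine (h₁.append (sound_cell h hl hr a b s₁ s₂ ?_ h₃)).append h₂
  -- The first slice of the source of the rule determines the word of `s₁`.
  obtain ⟨sl, l, rfl⟩ := List.exists_cons_of_ne_nil h.ne_nil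
  rw [hl.1]
  simpa using h₃.typed.1

theorem eval_iff_of_cls_eq {Γ : List (Formula α)} {φ φ' : (full α).Diagram [] (blk Γ)}
    (h : φ.cls = φ'.cls) (t : List (Item α)) : Eval φ.slices [] t ↔ Eval φ'.slices [] t := by
  let F : (full α).Hom [] (blk Γ) → Prop := Quot.lift (fun ψ => Eval ψ.slices [] t) (by
    intro ψ ψ' hψ
    refine propext ⟨fun h => hψ.elim (fun e => h.interchange e) fun e => h.rewrite e, fun h => ?_⟩
    -- The upper diagram has some outcome, the rule or interchange carries it to the lower one, and
    -- uniqueness makes it equal to `t`.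
    obtain ⟨t', ht, -⟩ := exists_eval (s := []) (bs := [Γ]) (by simpa using ψ.typed)
    rwa [h.unique (hψ.elim (fun e => ht.interchange e) fun e => ht.rewrite e)])
  exact iff_of_eq (congrArg F h)

/-! ### Diagrams that represent a derivation act as this derivation -/

theorem eval_sameDiagram {φ φ' : List (Slice (Color α) (CGate α))}
    (h : (control α).SameDiagram φ φ') {s t : List (Item α)} :
    Eval (incl φ) s t ↔ Eval (incl φ') s t := by
  induction h with
  | rel _ _ h => exact eval_interchange_iff (incl_interchange h)
  | refl _ => exact Iff.rfl
  | symm _ _ _ ih => exact ih.symm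
  | trans _ _ _ _ _ ih ih' => exact ih.trans ih'

theorem Represents.eval {Γ : List (Formula α)} {φ : List (Slice (Color α) (CGate α))}
    {d : Deriv Γ} (h : Represents φ d) : Eval (incl φ) [] [mk d] := by
  induction h with
  | ax A => exact ⟨_, (Core.ax A).step, rfl⟩
  | one => exact ⟨_, Core.one.step, rfl⟩
  | @unary Γ φ r d h ih =>
    -- A rule at the end of the sequent is `unaryAt` with empty right context, where both block
    -- exchanges are trivial.
    have e : mk (Deriv.unary r d) = mk (Loc.op Γ [] (.un r) (d.recast (by simp [Loc.dom]))) := by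
      refine (mk_unary_congr ?_).trans (mk_ex_of_fn (fun i => ?_) _).symm
      · refine ((mk_ex_of_fn (fun i => ?_) _).trans (mk_recast _ _)).symm
        rw [Reorder.fn_block]
        grind
      · exact (Reorder.fn_block Γ [] [r.prin] [] _ _ i).trans (by grind)
    rw [incl_append, e]
    refine ih.append (eval_singleton.2 ?_)
    exact (Core.loc (.un r) rfl Γ [] (d.recast (by simp [Loc.dom]))).step.frame_eq [] []
      (congrArg (· :: []) (mk_recast _ _).symm) rfl rfl rfl
  | unaryAt Γ r Δ h ih =>
    rw [incl_append]
    exact ih.append (eval_singleton.2 (Core.loc (.un r) rfl Γ Δ _).step)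
  | @binary Γ Δ φ ψ b d e h h' ih ih' =>
    simp only [incl_append]
    refine (ih.append ?_).append (eval_bin b d e)
    exact ih'.frame_eq [mk d] [] (by simp [incl_whisker]) rfl rfl
  | ex h hτ ih =>
    rw [incl_append]
    exact ih.append (eval_twist hτ _)
  | same h h' ih => exact (eval_sameDiagram h').1 ih

theorem stdEquiv_of_diagEquiv {Γ : List (Formula α)} {d d' : Deriv Γ} (h : DiagEquiv d d') :
    d.StdEquiv d' := by
  obtain ⟨φ, φ', h, h', e⟩ := h
  have h₁ := ((eval_iff_of_cls_eq e [mk d]).1 h.eval).unique h'.eval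
  exact mk_eq_iff.1 (by simpa using h₁)

end MLLu

theorem mainTheorem2 {α : Type*} {Γ : List (MLLu.Formula α)} (d d' : MLLu.Deriv Γ) :
    MLLu.Deriv.StdEquiv d d' ↔ MLLu.DiagEquiv d d' :=
  ⟨MLLu.diagEquiv_of_stdEquiv, MLLu.stdEquiv_of_diagEquiv⟩
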